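/- Let $d\ge 1$ and let $\mathbf A=\mathrm{diag}(A_1,\dots,A_d)$ be a random diagonal matrix and $\mathbf B=(B_1,\dots,B_d)$, $\mathbf X=(X_1,\dots,X_d)$ random vectors in $\mathbb R^d$, defined on a common probability space, such that $\mathbf A$ and $\mathbf X$ are independent ($\mathbf B$ may depend on both) and $$\mathbf X\stackrel{d}{=}\mathbf A\mathbf X+\mathbf B .$$ Let $\alpha_1,\dots,\alpha_d>0$ and assume that for every $j=1,\dots,d$: (A0) the law of $\log|A_j|$ conditioned on $A_j\ne 0$ is non-arithmetic, i.e. not concentrated on $h\mathbb Z$ for any $h>0$; (A1) $\mathbb E|A_j|^{\alpha_j}=1$; (A2) $\mathbb E\big[|A_j|^{\alpha_j}\log^+|A_j|\big]<\infty$, and $\mathbb E|B_j|^{\alpha_j+\sigma}<\infty$ for some $\sigma>0$. For $x\in\mathbb R^d$ and $t>0$ put $|x|_\alpha=\max_{1\le j\le d}|x_j|^{\alpha_j}$, $\delta_t(x)=(t^{1/\alpha_1}x_1,\dots,t^{1/\alpha_d}x_d)$ and $S^{d-1}=\{x\in\mathbb R^d: |x|_\alpha=1\}$. Then the finite limit $$c_\infty=\lim_{t\to\infty}t\,\mathbb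 P(|\mathbf X|_\alpha>t)$$ exists. If $c_\infty>0$, then, as $t\to\infty$, the measures $$m_t(U)=\mathbb P\big(\delta_{|\mathbf X|_\alpha^{-1}}\mathbf X\in U\ \big|\ |\mathbf X|_\alpha>t\big),\qquad U\subset S^{d-1}\text{ Borel},$$ converge weakly on $S^{d-1}$ to a (nonzero) probability measure $\nu$. -/

import Mathlib

open MeasureTheory ProbabilityTheory Filter Topology

noncomputable section

/-- A measure on `ℝ` is arithmetic if it is concentrated on `hℤ` for some `h > 0`;
it is non-arithmetic otherwise. -/
def NonArithmetic (μ : Measure ℝ) : Prop :=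
  ¬ ∃ h : ℝ, 0 < h ∧ ∀ᵐ x ∂μ, ∃ n : ℤ, x = n * h

/-- `|x|_α = max_j |x_j| ^ α_j` for `x ∈ ℝ^d`. -/
def alphaNorm {d : ℕ} (α : Fin d → ℝ) (x : Fin d → ℝ) : ℝ :=
  ⨆ j, |x j| ^ α j

/-- The dilation `δ_t(x) = (t^{1/α_1} x_1, …, t^{1/α_d} x_d)`. -/
def dilation {d : ℕ} (α : Fin d → ℝ) (t : ℝ) (x : Fin d → ℝ) : Fin d → ℝ :=
  fun j => t ^ (1 / α j) * x j

/-- The unit sphere `S^{d-1} = {x : |x|_α = 1}`. -/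
def alphaSphere {d : ℕ} (α : Fin d → ℝ) : Set (Fin d → ℝ) :=
  {x | alphaNorm α x = 1}

/-- The measure `m_t(U) = P(δ_{|X|_α^{-1}} X ∈ U ∣ |X|_α > t)`, for Borel `U ⊆ S^{d-1}`. -/
def angularMeasure {Ω : Type*} [MeasurableSpace Ω] (P : Measure Ω) {d : ℕ} (α : Fin d → ℝ)
    (X : Ω → Fin d → ℝ) (t : ℝ) : Measure (alphaSphere α) :=
  Measure.comap Subtype.val
    (Measure.map (fun ω => dilation α (alphaNorm α (X ω))⁻¹ (X ω))
      (cond P {ω | t < alphaNorm α (X ω)}))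

instance angularMeasure_isFiniteMeasure {Ω : Type*} [MeasurableSpace Ω] (P : Measure Ω)
    [IsProbabilityMeasure P] {d : ℕ} (α : Fin d → ℝ) (X : Ω → Fin d → ℝ) (t : ℝ) :
    IsFiniteMeasure (angularMeasure P α X t) := by
  have : IsFiniteMeasure (cond P {ω | t < alphaNorm α (X ω)}) := inferInstance
  unfold angularMeasure
  infer_instance

/-- `m_t` as an element of the space of finite Borel measures on `S^{d-1}`, which carries
the topology of weak convergence. -/
def angularFiniteMeasure {Ω : Type*} [MeasurableSpace Ω] (P : Measure Ω)
    [IsProbabilityMeasure P] {d : ℕ} (α : Fin d → ℝ) (X : Ω → Fin d → ℝ) (t : ℝ) :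
    FiniteMeasure (alphaSphere α) :=
  ⟨angularMeasure P α X t, inferInstance⟩

end

/-! Write u_j = |A_j|^{α_j}, so that E u_j = 1, and for a bounded Lipschitz f vanishing near 0 put
ψ_f(t) = e^t E f(δ_{e^{-t}} X). The heart of the matter is that ψ_f(t) converges as t → ∞ for every
such f.

Replacing X by AX in ψ_f costs a term that decays exponentially at both ends, thanks to the extra
moment of B (`inhom_bound`). Suppose f depends only on coordinates whose multipliers agree a.s. with
one u. On these coordinates A acts as δ_u composed with a change of signs, and the factor e^t turns
E into an expectation under the tilted law u dP. Hence the functions ψ_f, taken over all sign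
changes of f, solve a renewal equation on ℝ × {±1}^d with steps (log u, sign A) and drift E u log u
> 0 (`renewal_equation`). They converge by `tendsto_of_renewal`.

That renewal theorem rests on an energy estimate. For a bounded solution the mean squared increment
along a step equals, up to an integrable term, the difference between the averaged shift of Σ_g Ψ_g²
and this sum itself, so it is integrable in time. Uniform continuity makes the increments along
almost every step tend to 0. Since signs square to 1, twice each step is an asymptotic period, and
non-arithmeticity makes every translation one. Integrating the equation then forces convergence,
because the drift is not 0.

Boundedness of ψ_f requires P(|X_j|^{α_j} > s) = O(1/s). Iterating the equation in law with E u_j^β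
< 1 gives O(s^{-β}) for β < 1, and comparison with an explicit supersolution lifts this to the
critical exponent (`tail_critical`).

If u_i and u_j differ with positive probability, then E √(u_i u_j) < 1 by the strict AM-GM
inequality, and the normalized joint tail of X_i and X_j contracts under the equation up to
vanishing errors. So coordinates from different blocks are not large together
(`tendsto_joint_tail`), and ψ_f is asymptotically a sum over blocks (`tendsto_scaledMean`).
Squeezing the tail of |X|_α with ramps yields c_∞. Continuous functions of the angle, cut off to
annuli, give convergence of all integrals against m_t, and compactness of the sphere supplies the
limit measure. -/

/-! ### A renewal theorem for functions on `ℝ × G` with `G` a finite elementary `2`-group -/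

/-- A nonnegative uniformly continuous function that is integrable at `∞` tends to `0`. -/
theorem tendsto_zero_of_uniformContinuous_of_integrableOn {f : ℝ → ℝ} (h0 : ∀ t, 0 ≤ f t)
    (hf : UniformContinuous f) (hi : IntegrableOn f (Set.Ioi 0)) :
    Tendsto f atTop (𝓝 0) := by
  rw [Metric.tendsto_atTop]
  intro ε hε
  obtain ⟨δ, hδ, hd⟩ := Metric.uniformContinuous_iff.1 hf (ε / 2) (by positivity)
  have h1 := intervalIntegral_tendsto_integral_Ioi 0 hi tendsto_id
  have h2 := intervalIntegral_tendsto_integral_Ioi 0 hi (tendsto_atTop_add_const_right atTop (δ/2)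
    tendsto_id)
  have h3 := h2.sub h1
  rw [sub_self] at h3
  -- If f(t) ≥ ε, then f ≥ ε/2 on [t, t + δ/2], so that window carries mass at least (δ/2)(ε/2). The
  -- Cauchy property of the integral excludes this for large t.
  obtain ⟨N, hN⟩ := Metric.tendsto_atTop.1 h3 (δ / 2 * (ε / 2)) (by positivity)
  refine ⟨N, fun t ht => ?_⟩
  have h4 := hN t ht
  simp only [id, Real.dist_eq, sub_zero] at h4
  have hii : ∀ a b, IntervalIntegrable f volume a b := fun a b => hf.continuous.intervalIntegrable a b
  rw [intervalIntegral.integral_interval_sub_left (hii _ _) (hii _ _)] at h4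
  rw [Real.dist_eq, sub_zero, abs_of_nonneg (h0 t)]
  by_contra! hcon
  have h5 : ∫ x in t..t + δ / 2, (ε / 2) ≤ ∫ x in t..t + δ / 2, f x := by
    apply intervalIntegral.integral_mono_on (by linarith) (by simp) (hii _ _)
    intro x hx
    have := hd (a := x) (b := t) (by rw [Real.dist_eq, abs_lt]; constructor <;> linarith [hx.1, hx.2])
    rw [Real.dist_eq, abs_lt] at this
    linarith [this.1]
  rw [intervalIntegral.integral_const, smul_eq_mul] at h5
  have := le_abs_self (∫ x in t..t + δ / 2, f x)
  have h6 : t + δ / 2 - t = δ / 2 := by ring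
  rw [h6] at h5
  linarith

section
variable {Ω : Type*} [MeasurableSpace Ω] {Q : Measure Ω}

/-- Fubini's theorem for the increments of a bounded continuous function along a random shift. -/
theorem intervalIntegral_sub_integral_shift [IsProbabilityMeasure Q] {φ : ℝ → ℝ} (hφ : Continuous φ) {C : ℝ}
    (hC : ∀ t, |φ t| ≤ C) {ξ : Ω → ℝ} (hξ : Measurable ξ) (T : ℝ) :
    ∫ t in (0 : ℝ)..T, (φ t - ∫ ω, φ (t - ξ ω) ∂Q) =
      (∫ ω, (∫ y in (T - ξ ω)..T, φ y) - (∫ y in (-ξ ω)..0, φ y) ∂Q) := by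
  have hm : Measurable (fun p : ℝ × Ω => φ p.1 - φ (p.1 - ξ p.2)) := by
    have := hφ.measurable
    fun_prop
  have hii : ∀ a b, IntervalIntegrable φ volume a b := fun a b => hφ.intervalIntegrable a b
  have h1 : ∀ t, φ t - ∫ ω, φ (t - ξ ω) ∂Q = ∫ ω, (φ t - φ (t - ξ ω)) ∂Q := by
    intro t
    rw [integral_sub (integrable_const _), integral_const]
    · simp
    · apply Integrable.of_bound (C := C)
      · exact (hφ.measurable.comp (measurable_const.sub hξ)).aestronglyMeasurable
      · exact ae_of_all _ fun ω => hC _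
  simp_rw [h1]
  rw [intervalIntegral_integral_swap]
  · apply integral_congr_ae
    refine ae_of_all _ fun ω => ?_
    simp only
    have hs : IntervalIntegrable (fun x => φ (x - ξ ω)) volume 0 T :=
      Continuous.intervalIntegrable (by fun_prop) _ _
    rw [intervalIntegral.integral_sub (hii _ _) hs]
    rw [intervalIntegral.integral_comp_sub_right (fun y => φ y), zero_sub]
    have e1 := intervalIntegral.integral_add_adjacent_intervals (hii (-ξ ω) 0) (hii 0 T)
    have e2 := intervalIntegral.integral_add_adjacent_intervals (hii (-ξ ω) (T - ξ ω)) (hii (T - ξ ω) T)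
    linarith
  · have : IsFiniteMeasure (volume.restrict (Set.uIoc 0 T)) := by
      rw [Set.uIoc]; infer_instance
    apply Integrable.of_bound (C := C + C)
    · exact hm.aestronglyMeasurable
    · exact ae_of_all _ fun p => (norm_sub_le _ _).trans (add_le_add (hC _) (hC _))

theorem abs_intervalIntegral_le_mul_of_bound {φ : ℝ → ℝ} {C : ℝ}
    (hC : ∀ t, |φ t| ≤ C) (a b : ℝ) : |∫ y in a..b, φ y| ≤ C * |b - a| := by
  rw [← Real.norm_eq_abs]
  exact intervalIntegral.norm_integral_le_of_norm_le_const fun y _ => hC y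

theorem measurable_intervalIntegral_shift {φ : ℝ → ℝ} (hφ : Continuous φ) {ξ η : Ω → ℝ}
    (hξ : Measurable ξ) (hη : Measurable η) : Measurable fun ω => ∫ y in (ξ ω)..(η ω), φ y := by
  have hii : ∀ a b, IntervalIntegrable φ volume a b := fun a b => hφ.intervalIntegrable a b
  have hF : Continuous fun x => ∫ y in (0 : ℝ)..x, φ y := intervalIntegral.continuous_primitive hii 0
  have : (fun ω => ∫ y in (ξ ω)..(η ω), φ y) =
      fun ω => (∫ y in (0 : ℝ)..(η ω), φ y) - ∫ y in (0 : ℝ)..(ξ ω), φ y := by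
    ext ω
    rw [intervalIntegral.integral_interval_sub_left (hii _ _) (hii _ _)]
  rw [this]
  exact (hF.measurable.comp hη).sub (hF.measurable.comp hξ)

theorem integrable_intervalIntegral_shift {φ : ℝ → ℝ} (hφ : Continuous φ) {C : ℝ}
    (hC : ∀ t, |φ t| ≤ C) {ξ : Ω → ℝ} (hξ : Measurable ξ) (hi : Integrable ξ Q) (T : ℝ) :
    Integrable (fun ω => ∫ y in (T - ξ ω)..T, φ y) Q := by
  refine (hi.abs.const_mul C).mono'
    (measurable_intervalIntegral_shift hφ (measurable_const.sub hξ)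
      measurable_const).aestronglyMeasurable (ae_of_all _ fun ω => ?_)
  have := abs_intervalIntegral_le_mul_of_bound hC (T - ξ ω) T
  simpa using this

/-- A bounded continuous solution of a scalar renewal equation that is asymptotically invariant
under translations converges at `∞`. -/
theorem tendsto_of_renewal_of_translation [IsProbabilityMeasure Q] {φ r : ℝ → ℝ} (hφ : Continuous φ) {C : ℝ}
    (hC : ∀ t, |φ t| ≤ C) {ξ : Ω → ℝ} (hξ : Measurable ξ) (hi : Integrable ξ Q)
    (hm : ∫ ω, ξ ω ∂Q ≠ 0) (hr : IntegrableOn r (Set.Ioi 0))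
    (heq : ∀ t, φ t = ∫ ω, φ (t - ξ ω) ∂Q + r t)
    (htr : ∀ b, Tendsto (fun t => φ (t - b) - φ t) atTop (𝓝 0)) :
    ∃ l, Tendsto φ atTop (𝓝 l) := by
  have hC0 : 0 ≤ C := (abs_nonneg _).trans (hC 0)
  have hii : ∀ a b, IntervalIntegrable φ volume a b := fun a b => hφ.intervalIntegrable a b
  -- Integrating the equation over [0, T] telescopes: only the windows at the two ends survive, and
  -- the one at 0 does not depend on T.
  have h1 : ∀ T, ∫ ω, (∫ y in (T - ξ ω)..T, φ y) ∂Q =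
      (∫ t in (0 : ℝ)..T, r t) + ∫ ω, (∫ y in (-ξ ω)..0, φ y) ∂Q := by
    intro T
    have h := intervalIntegral_sub_integral_shift (Q := Q) hφ hC hξ T
    have h' := integrable_intervalIntegral_shift hφ hC hξ hi (Q := Q) 0
    simp only [zero_sub] at h'
    rw [integral_sub (integrable_intervalIntegral_shift hφ hC hξ hi T) h'] at h
    have : ∀ t, φ t - ∫ ω, φ (t - ξ ω) ∂Q = r t := fun t => by linarith [heq t]
    simp_rw [this] at h
    linarith
  -- Asymptotic translation invariance makes φ nearly constant on the window [T - ξ, T], whose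
  -- integral is thus ξ φ(T) + o(1); 2C|ξ| dominates.
  have h2 : Tendsto (fun T => ∫ ω, ((∫ y in (T - ξ ω)..T, φ y) - ξ ω * φ T) ∂Q) atTop (𝓝 0) := by
    have : (0 : ℝ) = ∫ ω : Ω, (0 : ℝ) ∂Q := by simp
    rw [this]
    refine tendsto_integral_filter_of_dominated_convergence (fun ω => 2 * C * |ξ ω|) ?_ ?_ ?_ ?_
    · exact .of_forall fun T => ((measurable_intervalIntegral_shift hφ (measurable_const.sub hξ)
        measurable_const).sub (hξ.mul_const _)).aestronglyMeasurable
    · refine .of_forall fun T => ae_of_all _ fun ω => ?_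
      have e1 := abs_intervalIntegral_le_mul_of_bound hC (T - ξ ω) T
      rw [sub_sub_cancel] at e1
      have e2 : |ξ ω * φ T| ≤ |ξ ω| * C := by
        rw [abs_mul]; exact mul_le_mul_of_nonneg_left (hC T) (abs_nonneg _)
      refine (norm_sub_le _ _).trans ?_
      simp only [Real.norm_eq_abs]
      linarith
    · exact hi.abs.const_mul _
    · refine ae_of_all _ fun ω => ?_
      have e : ∀ T, (∫ y in (T - ξ ω)..T, φ y) - ξ ω * φ T =
          ∫ z in (0 : ℝ)..(ξ ω), (φ (T - z) - φ T) := by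
        intro T
        have hs : IntervalIntegrable (fun z => φ (T - z)) volume 0 (ξ ω) :=
          Continuous.intervalIntegrable (by fun_prop) _ _
        rw [intervalIntegral.integral_sub hs (by simp), intervalIntegral.integral_comp_sub_left (fun y => φ y)]
        simp
      simp_rw [e]
      suffices h0 : Tendsto (fun T => ∫ z in (0 : ℝ)..(ξ ω), (φ (T - z) - φ T)) atTop
          (𝓝 (∫ z in (0 : ℝ)..(ξ ω), (0 : ℝ))) by simpa using h0
      refine intervalIntegral.tendsto_integral_filter_of_dominated_convergence (fun _ => C + C) ?_ ?_ ?_ ?_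
      · exact .of_forall fun T => Continuous.aestronglyMeasurable (by fun_prop)
      · exact .of_forall fun T => ae_of_all _ fun z _ =>
          (norm_sub_le _ _).trans (add_le_add (hC _) (hC _))
      · simp
      · exact ae_of_all _ fun z _ => htr z
  have h3 : ∀ T, ∫ ω, ((∫ y in (T - ξ ω)..T, φ y) - ξ ω * φ T) ∂Q =
      (∫ t in (0 : ℝ)..T, r t) + (∫ ω, (∫ y in (-ξ ω)..0, φ y) ∂Q) - (∫ ω, ξ ω ∂Q) * φ T := by
    intro T
    rw [integral_sub (integrable_intervalIntegral_shift hφ hC hξ hi T) (hi.mul_const _), h1,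
      integral_mul_const]
  simp_rw [h3] at h2
  have h4 := (((intervalIntegral_tendsto_integral_Ioi 0 hr tendsto_id).add_const
    (∫ ω, (∫ y in (-ξ ω)..0, φ y) ∂Q)).sub h2).div_const (∫ ω, ξ ω ∂Q)
  refine ⟨_, h4.congr fun T => ?_⟩
  simp only [id]
  field_simp
  ring


/-- Boundedness makes the square of the increment uniformly continuous, so an integrable square must
tend to 0. -/
theorem tendsto_increment_of_integrableOn_sq {Ψ₁ Ψ₂ : ℝ → ℝ}
    (h₁ : UniformContinuous Ψ₁) (h₂ : UniformContinuous Ψ₂) {C : ℝ} (hC₁ : ∀ t, |Ψ₁ t| ≤ C)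
    (hC₂ : ∀ t, |Ψ₂ t| ≤ C) {b : ℝ}
    (hi : IntegrableOn (fun t => (Ψ₁ (t - b) - Ψ₂ t) ^ 2) (Set.Ioi 0)) :
    Tendsto (fun t => Ψ₁ (t - b) - Ψ₂ t) atTop (𝓝 0) := by
  have hU : UniformContinuous (fun t => Ψ₁ (t - b) - Ψ₂ t) :=
    (h₁.comp (uniformContinuous_id.sub uniformContinuous_const)).sub h₂
  have hb : ∀ t, |Ψ₁ (t - b) - Ψ₂ t| ≤ C + C := fun t =>
    (abs_sub _ _).trans (add_le_add (hC₁ _) (hC₂ _))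
  have hC0 : 0 ≤ C := (abs_nonneg _).trans (hC₁ 0)
  have hU2 : UniformContinuous (fun t => (Ψ₁ (t - b) - Ψ₂ t) ^ 2) := by
    rw [Metric.uniformContinuous_iff] at hU ⊢
    intro e he
    -- 4C bounds the sum of two increments in |a² - b²| = |a + b||a - b|; the extra 1 covers C = 0.
    obtain ⟨δ, hδ, hd⟩ := hU (e / (4 * C + 1)) (by positivity)
    refine ⟨δ, hδ, fun x y hxy => ?_⟩
    have h1 := hd hxy
    rw [Real.dist_eq, lt_div_iff₀ (by positivity)] at h1
    rw [Real.dist_eq, sq_sub_sq, abs_mul, mul_comm]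
    refine lt_of_le_of_lt (mul_le_mul_of_nonneg_left ?_ (abs_nonneg _)) h1
    exact (abs_add_le _ _).trans (by linarith [hb x, hb y])
  have h := tendsto_zero_of_uniformContinuous_of_integrableOn (fun t => sq_nonneg _) hU2 hi
  have h2 := h.sqrt
  simp only [Real.sqrt_sq_eq_abs, Real.sqrt_zero] at h2
  exact (tendsto_zero_iff_abs_tendsto_zero _).2 h2

/-- The translations under which a uniformly continuous family is asymptotically invariant form a
closed subgroup. -/
theorem exists_closed_addSubgroup_of_asymptotic_period {ι : Type*} {Ψ : ι → ℝ → ℝ}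
    (hU : ∀ g, UniformContinuous (Ψ g)) :
    ∃ Γ : AddSubgroup ℝ, IsClosed (Γ : Set ℝ) ∧
      ∀ b, b ∈ Γ ↔ ∀ g, Tendsto (fun t => Ψ g (t - b) - Ψ g t) atTop (𝓝 0) := by
  refine ⟨{ carrier := {b | ∀ g, Tendsto (fun t => Ψ g (t - b) - Ψ g t) atTop (𝓝 0)}
            zero_mem' := fun g => by simp
            add_mem' := ?_
            neg_mem' := ?_ }, ?_, fun b => Iff.rfl⟩
  · intro b c hb hc g
    have h := ((hb g).comp (tendsto_atTop_add_const_right atTop (-c) tendsto_id)).add (hc g)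
    rw [add_zero] at h
    refine h.congr fun t => ?_
    simp only [Function.comp, id]
    rw [show t + -c - b = t - (b + c) by ring, show t + -c = t - c by ring]
    ring
  · intro b hb g
    have h := ((hb g).comp (tendsto_atTop_add_const_right atTop b tendsto_id)).neg
    rw [neg_zero] at h
    refine h.congr fun t => ?_
    simp only [Function.comp, id]
    rw [show t + b - b = t by ring, show t - -b = t + b by ring]
    ring
  · rw [← isSeqClosed_iff_isClosed]
    intro u b hu hub g
    rw [Metric.tendsto_atTop]
    intro e he
    obtain ⟨δ, hδ, hd⟩ := Metric.uniformContinuous_iff.1 (hU g) (e / 2) (by positivity)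
    obtain ⟨n, hn⟩ := ((Metric.tendsto_atTop.1 hub) δ hδ)
    obtain ⟨N, hN⟩ := Metric.tendsto_atTop.1 (hu n g) (e / 2) (by positivity)
    refine ⟨N, fun t ht => ?_⟩
    have h1 := hN t ht
    have h2 := hd (a := t - b) (b := t - u n) (by
      have := hn n le_rfl
      rw [Real.dist_eq] at this ⊢
      rw [show t - b - (t - u n) = u n - b by ring]; exact this)
    rw [Real.dist_eq] at h1 h2 ⊢
    rw [sub_zero] at *
    calc |Ψ g (t - b) - Ψ g t| = |(Ψ g (t - b) - Ψ g (t - u n)) + (Ψ g (t - u n) - Ψ g t)| := by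
          ring_nf
      _ ≤ _ := abs_add_le _ _
      _ < e := by linarith

/-- A closed subgroup of ℝ is everything or cyclic. If 2ξ lay in aℤ, then ξ would lie in (a/2)ℤ, so
doubling the step is harmless for non-arithmeticity. -/
theorem addSubgroup_eq_top_of_nonarithmetic {Γ : AddSubgroup ℝ}
    (hcl : IsClosed (Γ : Set ℝ)) {ξ : Ω → ℝ} (hΓ : ∀ᵐ ω ∂Q, ξ ω + ξ ω ∈ Γ)
    (hna : ¬ ∃ h : ℝ, 0 < h ∧ ∀ᵐ ω ∂Q, ∃ n : ℤ, ξ ω = n * h) (b : ℝ) : b ∈ Γ := by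
  rcases Γ.dense_or_cyclic with hd | ⟨a, ha⟩
  · have : (Γ : Set ℝ) = Set.univ := by rw [← hcl.closure_eq]; exact hd.closure_eq
    rw [← SetLike.mem_coe, this]
    exact Set.mem_univ b
  · exfalso
    apply hna
    rcases eq_or_ne a 0 with rfl | h0
    -- For a = 0 the step vanishes almost surely, and any span would do.
    · refine ⟨1, one_pos, ?_⟩
      filter_upwards [hΓ] with ω hω
      rw [ha, AddSubgroup.mem_closure_singleton] at hω
      obtain ⟨n, hn⟩ := hω
      refine ⟨0, ?_⟩
      simp at hn ⊢
      linarith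
    · refine ⟨|a| / 2, by positivity, ?_⟩
      filter_upwards [hΓ] with ω hω
      rw [ha, AddSubgroup.mem_closure_singleton] at hω
      obtain ⟨n, hn⟩ := hω
      rw [zsmul_eq_mul] at hn
      rcases abs_choice a with h | h
      · exact ⟨n, by rw [h]; linarith⟩
      · exact ⟨-n, by rw [h]; push_cast; linarith⟩

variable {G : Type*} [CommGroup G] [Fintype G] [MeasurableSpace G] [MeasurableSingletonClass G]

theorem measurable_shift_group {Ψ : G → ℝ → ℝ} (hΨ : ∀ g, Continuous (Ψ g)) {ξ : Ω → ℝ}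
    (hξ : Measurable ξ) {ε : Ω → G} (hε : Measurable ε) (g : G) :
    Measurable (fun p : ℝ × Ω => Ψ (g * ε p.2) (p.1 - ξ p.2)) := by
  have h1 : Measurable (fun q : G × ℝ => Ψ (g * q.1) q.2) :=
    measurable_from_prod_countable_right fun x => (hΨ (g * x)).measurable
  exact h1.comp (Measurable.prodMk (hε.comp measurable_snd)
    (measurable_fst.sub (hξ.comp measurable_snd)))

/-- For a bounded solution of a renewal equation, the squared increments along almost every step
are integrable at `∞`. -/
theorem ae_integrableOn_sq_increment [IsProbabilityMeasure Q] {Ψ r : G → ℝ → ℝ}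
    (hΨ : ∀ g, Continuous (Ψ g)) {C : ℝ} (hC : ∀ g t, |Ψ g t| ≤ C) {ξ : Ω → ℝ} (hξ : Measurable ξ)
    (hi : Integrable ξ Q) {ε : Ω → G} (hε : Measurable ε)
    (hr : ∀ g, IntegrableOn (r g) (Set.Ioi 0))
    (heq : ∀ g t, Ψ g t = ∫ ω, Ψ (g * ε ω) (t - ξ ω) ∂Q + r g t) :
    ∀ᵐ ω ∂Q, ∀ g, IntegrableOn (fun t => (Ψ (g * ε ω) (t - ξ ω) - Ψ g t) ^ 2) (Set.Ioi 0) := by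
  have hC0 : 0 ≤ C := (abs_nonneg _).trans (hC 1 0)
  have hms : ∀ g, Measurable (fun p : ℝ × Ω => Ψ (g * ε p.2) (p.1 - ξ p.2)) :=
    fun g => measurable_shift_group hΨ hξ hε g
  have hΨm : ∀ g, Measurable (Ψ g) := fun g => (hΨ g).measurable
  set Δ : G → ℝ × Ω → ℝ := fun g p => (Ψ (g * ε p.2) (p.1 - ξ p.2) - Ψ g p.1) ^ 2 with hΔ
  have hΔm : ∀ g, Measurable (Δ g) := fun g =>
    ((hms g).sub ((hΨm g).comp measurable_fst)).pow_const 2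
  have hsq : ∀ g t, (Ψ g t) ^ 2 ≤ C ^ 2 := fun g t => by
    rw [← sq_abs]; exact pow_le_pow_left₀ (abs_nonneg _) (hC g t) 2
  have hΔb : ∀ g p, |Δ g p| ≤ (C + C) ^ 2 := by
    intro g p
    rw [hΔ, abs_pow]
    exact pow_le_pow_left₀ (abs_nonneg _) ((abs_sub _ _).trans (add_le_add (hC _ _) (hC _ _))) 2
  set φ : ℝ → ℝ := fun t => ∑ g, (Ψ g t) ^ 2 with hφ
  -- The sum over the whole group is invariant under right multiplication by ε, so the energy φ is
  -- shifted by ξ alone.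
  have hφc : Continuous φ := by fun_prop
  set K : ℝ := Fintype.card G * C ^ 2 with hK
  have hφb : ∀ t, |φ t| ≤ K := by
    intro t
    rw [hφ, abs_of_nonneg (Finset.sum_nonneg fun _ _ => sq_nonneg _), hK]
    refine (Finset.sum_le_sum fun g _ => hsq g t).trans ?_
    simp
  have hshift : ∀ t ω, ∑ g, (Ψ (g * ε ω) (t - ξ ω)) ^ 2 = φ (t - ξ ω) := fun t ω =>
    Fintype.sum_equiv (Equiv.mulRight (ε ω)) _ _ fun g => rfl
  have hInt : ∀ g t, Integrable (fun ω => Ψ (g * ε ω) (t - ξ ω)) Q := fun g t =>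
    Integrable.of_bound ((hms g).comp measurable_prodMk_left).aestronglyMeasurable C
      (ae_of_all _ fun ω => hC _ _)
  have hφi : ∀ t, Integrable (fun ω => φ (t - ξ ω)) Q := fun t =>
    Integrable.of_bound (hφc.measurable.comp (measurable_const.sub hξ)).aestronglyMeasurable K
      (ae_of_all _ fun ω => hφb _)
  set D : ℝ × Ω → ℝ := fun p => ∑ g, Δ g p with hD
  have hDm : Measurable D := Finset.measurable_sum _ fun g _ => hΔm g
  have hD0 : ∀ p, 0 ≤ D p := fun p => Finset.sum_nonneg fun g _ => sq_nonneg _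
  have hDb : ∀ p, |D p| ≤ Fintype.card G * (C + C) ^ 2 := fun p => by
    refine (Finset.abs_sum_le_sum_abs _ _).trans ((Finset.sum_le_sum fun g _ => hΔb g p).trans ?_)
    simp
  -- Expand the squares and use the equation for the cross term: its mean is 2 Σ Ψ (Ψ - r).
  have hDE : ∀ t, ∫ ω, D (t, ω) ∂Q =
      (∑ g, 2 * Ψ g t * r g t) - (φ t - ∫ ω, φ (t - ξ ω) ∂Q) := by
    intro t
    have e1 : ∀ ω, D (t, ω) = φ (t - ξ ω) + φ t -
        ∑ g, 2 * Ψ g t * Ψ (g * ε ω) (t - ξ ω) := by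
      intro ω
      rw [← hshift, hφ, hD, ← Finset.sum_add_distrib, ← Finset.sum_sub_distrib]
      exact Finset.sum_congr rfl fun g _ => by simp only [hΔ]; ring
    simp_rw [e1]
    have e0 : Integrable (fun ω => φ (t - ξ ω) + φ t) Q := (hφi t).add (integrable_const _)
    rw [integral_sub e0 (integrable_finsetSum _ fun g _ => (hInt g t).const_mul _),
      integral_add (hφi t) (integrable_const _), integral_finsetSum _ fun g _ => (hInt g t).const_mul _]
    simp_rw [integral_const_mul]
    have e2 : ∀ g, ∫ ω, Ψ (g * ε ω) (t - ξ ω) ∂Q = Ψ g t - r g t := fun g => by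
      linarith [heq g t]
    simp_rw [e2]
    have e3 : ∑ g, 2 * Ψ g t * (Ψ g t - r g t) = 2 * φ t - ∑ g, 2 * Ψ g t * r g t := by
      rw [hφ, Finset.mul_sum, ← Finset.sum_sub_distrib]
      exact Finset.sum_congr rfl fun g _ => by ring
    rw [e3]
    simp
    ring
  have hrΨ : IntegrableOn (fun t => ∑ g, 2 * Ψ g t * r g t) (Set.Ioi 0) := by
    refine integrable_finsetSum _ fun g _ => ?_
    refine (hr g).bdd_mul (c := 2 * C) ((hΨm g).const_mul 2).aestronglyMeasurable
      (ae_of_all _ fun t => ?_)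
    rw [norm_mul]
    simpa using hC g t
  have hEm : Measurable fun t => ∫ ω, D (t, ω) ∂Q :=
    (hDm.stronglyMeasurable.integral_prod_right).measurable
  have hEb : ∀ t, ‖∫ ω, D (t, ω) ∂Q‖ ≤ Fintype.card G * (C + C) ^ 2 := fun t => by
    have := norm_integral_le_of_norm_le_const (μ := Q) (f := fun ω => D (t, ω))
      (ae_of_all _ fun ω => hDb (t, ω))
    simpa using this
  have hE0 : ∀ t, 0 ≤ ∫ ω, D (t, ω) ∂Q := fun t => integral_nonneg fun ω => hD0 _
  have hEloc : ∀ a b : ℝ, IntegrableOn (fun t => ∫ ω, D (t, ω) ∂Q) (Set.Ioc a b) := fun a b =>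
    Integrable.of_bound hEm.aestronglyMeasurable _ (ae_of_all _ hEb)
  -- The energy difference telescopes over [0, T] to two end windows of length |ξ|, which cost at
  -- most 2K E|ξ| uniformly in T.
  have hEI : IntegrableOn (fun t => ∫ ω, D (t, ω) ∂Q) (Set.Ioi 0) := by
    refine integrableOn_Ioi_of_intervalIntegral_norm_bounded
      ((∫ t in Set.Ioi 0, ‖∑ g, 2 * Ψ g t * r g t‖) + ∫ ω, 2 * K * |ξ ω| ∂Q) 0 (fun T => hEloc 0 T)
      tendsto_id ?_
    filter_upwards [eventually_ge_atTop 0] with T hT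
    simp only [Real.norm_of_nonneg (hE0 _)]
    have hrT : IntervalIntegrable (fun t => ∑ g, 2 * Ψ g t * r g t) volume 0 T :=
      (intervalIntegrable_iff_integrableOn_Ioc_of_le hT).2 (hrΨ.mono_set Set.Ioc_subset_Ioi_self)
    have hφT : IntervalIntegrable (fun t => φ t - ∫ ω, φ (t - ξ ω) ∂Q) volume 0 T := by
      refine (intervalIntegrable_iff_integrableOn_Ioc_of_le hT).2 ?_
      have : (fun t => φ t - ∫ ω, φ (t - ξ ω) ∂Q) =
        fun t => (∑ g, 2 * Ψ g t * r g t) - ∫ ω, D (t, ω) ∂Q := by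
          ext t; rw [hDE t]; ring
      rw [this]
      exact (hrΨ.mono_set Set.Ioc_subset_Ioi_self).sub (hEloc 0 T)
    simp_rw [hDE]
    rw [intervalIntegral.integral_sub hrT hφT,
      intervalIntegral_sub_integral_shift hφc hφb hξ T, sub_eq_add_neg]
    refine add_le_add ?_ ?_
    · rw [intervalIntegral.integral_of_le hT]
      refine (Real.le_norm_self _).trans ((norm_integral_le_integral_norm _).trans ?_)
      exact setIntegral_mono_set hrΨ.norm (ae_of_all _ fun _ => norm_nonneg _)
        (Set.Ioc_subset_Ioi_self).eventuallyLE
    · refine (neg_le_abs _).trans ?_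
      rw [← Real.norm_eq_abs]
      refine norm_integral_le_of_norm_le (hi.abs.const_mul _) (ae_of_all _ fun ω => ?_)
      have e1 := abs_intervalIntegral_le_mul_of_bound hφb (T - ξ ω) T
      have e2 := abs_intervalIntegral_le_mul_of_bound hφb (-ξ ω) 0
      rw [sub_sub_cancel] at e1
      rw [zero_sub, neg_neg] at e2
      refine (norm_sub_le _ _).trans ?_
      simp only [Real.norm_eq_abs]
      linarith
  have hprod : Integrable D ((volume.restrict (Set.Ioi 0)).prod Q) := by
    rw [integrable_prod_iff hDm.aestronglyMeasurable]
    refine ⟨ae_of_all _ fun t => Integrable.of_bound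
      (hDm.comp measurable_prodMk_left).aestronglyMeasurable _ (ae_of_all _ fun ω => hDb _), ?_⟩
    simp only [Real.norm_of_nonneg (hD0 _)]
    exact hEI
  filter_upwards [hprod.prod_left_ae] with ω hω g
  refine Integrable.mono' hω ((hΔm g).comp measurable_prodMk_right).aestronglyMeasurable
    (ae_of_all _ fun t => ?_)
  rw [Real.norm_of_nonneg (sq_nonneg _)]
  exact Finset.single_le_sum (f := fun g => Δ g (t, ω)) (fun g _ => sq_nonneg _) (Finset.mem_univ g)

/-- **Renewal theorem.** A bounded uniformly continuous solution of a non-arithmetic renewal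
equation on `ℝ × G`, with integrable inhomogeneity and nonzero drift, converges at `∞`. -/
theorem tendsto_of_renewal [IsProbabilityMeasure Q] (hG : ∀ g : G, g * g = 1) {Ψ r : G → ℝ → ℝ}
    (hU : ∀ g, UniformContinuous (Ψ g)) {C : ℝ} (hC : ∀ g t, |Ψ g t| ≤ C) {ξ : Ω → ℝ}
    (hξ : Measurable ξ) (hi : Integrable ξ Q) (hm : ∫ ω, ξ ω ∂Q ≠ 0) {ε : Ω → G}
    (hε : Measurable ε) (hna : ¬ ∃ h : ℝ, 0 < h ∧ ∀ᵐ ω ∂Q, ∃ n : ℤ, ξ ω = n * h)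
    (hr : ∀ g, IntegrableOn (r g) (Set.Ioi 0))
    (heq : ∀ g t, Ψ g t = ∫ ω, Ψ (g * ε ω) (t - ξ ω) ∂Q + r g t) (g : G) :
    ∃ l, Tendsto (Ψ g) atTop (𝓝 l) := by
  classical
  have hΨ : ∀ g, Continuous (Ψ g) := fun g => (hU g).continuous
  have h1 : ∀ᵐ ω ∂Q, ∀ g, Tendsto (fun t => Ψ (g * ε ω) (t - ξ ω) - Ψ g t) atTop (𝓝 0) := by
    filter_upwards [ae_integrableOn_sq_increment hΨ hC hξ hi hε hr heq] with ω hω g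
    exact tendsto_increment_of_integrableOn_sq (hU _) (hU _) (hC _) (hC _) (hω g)
  obtain ⟨Γ, hcl, hΓ⟩ := exists_closed_addSubgroup_of_asymptotic_period hU
  -- Take the same step twice: the group part becomes ε² = 1 and only the translation by 2ξ remains.
  have h2 : ∀ᵐ ω ∂Q, ξ ω + ξ ω ∈ Γ := by
    filter_upwards [h1] with ω hω
    rw [hΓ]
    intro g
    have h := ((hω (g * ε ω)).comp (tendsto_atTop_add_const_right atTop (-ξ ω) tendsto_id)).add
      (hω g)
    rw [add_zero, mul_assoc, hG, mul_one] at h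
    refine h.congr fun t => ?_
    simp only [Function.comp, id]
    rw [show t + -ξ ω - ξ ω = t - (ξ ω + ξ ω) by ring, show t + -ξ ω = t - ξ ω by ring]
    ring
  have h3 : ∀ b g, Tendsto (fun t => Ψ g (t - b) - Ψ g t) atTop (𝓝 0) := fun b =>
    (hΓ b).1 (addSubgroup_eq_top_of_nonarithmetic hcl h2 hna b)
  -- The asymptotic periods in the group. Once all real translations are asymptotic periods, almost
  -- every ε lies here.
  let H : Subgroup G :=
    { carrier := {h | ∀ g, Tendsto (fun t => Ψ (g * h) t - Ψ g t) atTop (𝓝 0)}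
      one_mem' := fun g => by simp
      mul_mem' := fun {a b} ha hb g => by
        have h := (hb (g * a)).add (ha g)
        rw [add_zero] at h
        refine h.congr fun t => ?_
        rw [mul_assoc]; ring
      inv_mem' := fun {a} ha g => by
        have : a⁻¹ = a := inv_eq_of_mul_eq_one_right (hG a)
        rw [this]
        exact ha g }
  have hH : ∀ h ∈ H, ∀ g, Tendsto (fun t => Ψ (g * h) t - Ψ g t) atTop (𝓝 0) := fun h hh => hh
  have h4 : ∀ᵐ ω ∂Q, ε ω ∈ H := by
    filter_upwards [h1] with ω hω
    intro g
    have h := (hω g).sub (h3 (ξ ω) (g * ε ω))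
    rw [sub_zero] at h
    refine h.congr fun t => ?_
    ring
  -- Summing over the coset gH absorbs ε and leaves a scalar renewal equation; its summands are
  -- asymptotically equal, so φ is close to |H| Ψ_g.
  set φ : ℝ → ℝ := fun t => ∑ h : H, Ψ (g * h) t with hφ
  have hφc : Continuous φ := by fun_prop
  have hInt : ∀ g t, Integrable (fun ω => Ψ (g * ε ω) (t - ξ ω)) Q := fun g t =>
    Integrable.of_bound
      ((measurable_shift_group hΨ hξ hε g).comp measurable_prodMk_left).aestronglyMeasurable C
      (ae_of_all _ fun ω => hC _ _)
  obtain ⟨l, hl⟩ := tendsto_of_renewal_of_translation (Q := Q) (φ := φ)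
    (r := fun t => ∑ h : H, r (g * h) t) (C := Fintype.card H * C) hφc
    (fun t => by
      refine (Finset.abs_sum_le_sum_abs _ _).trans
        ((Finset.sum_le_sum fun (h : H) _ => hC (g * h) t).trans ?_)
      simp) hξ hi hm (integrable_finsetSum _ fun h _ => hr _)
    (fun t => by
      have e1 : ∫ ω, φ (t - ξ ω) ∂Q = ∫ ω, ∑ h : H, Ψ (g * h * ε ω) (t - ξ ω) ∂Q := by
        refine integral_congr_ae ?_
        filter_upwards [h4] with ω hω
        refine (Fintype.sum_equiv (Equiv.mulRight (⟨ε ω, hω⟩ : H)) _ _ fun h => ?_).symm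
        simp [mul_assoc]
      rw [e1, integral_finsetSum _ fun h _ => hInt _ _, ← Finset.sum_add_distrib]
      exact Finset.sum_congr rfl fun h _ => heq _ _)
    (fun b => by
      have h := tendsto_finsetSum Finset.univ fun (h : H) _ => h3 b (g * h)
      simp only [Finset.sum_const_zero] at h
      refine h.congr fun t => ?_
      rw [Finset.sum_sub_distrib])
  have h5 := tendsto_finsetSum Finset.univ fun (h : H) _ => hH h h.2 g
  simp only [Finset.sum_const_zero, Finset.sum_sub_distrib, Finset.sum_const] at h5
  have h6 := (hl.sub h5).div_const (Fintype.card H : ℝ)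
  refine ⟨_, h6.congr fun t => ?_⟩
  have hc : (Fintype.card H : ℝ) ≠ 0 := by
    exact_mod_cast Fintype.card_ne_zero
  simp only [hφ, Finset.card_univ, nsmul_eq_mul]
  field_simp
  ring

end

/-! ### The stochastic equation, moments and tails of the coordinates -/

/-- The random variable `|Z_j| ^ α_j`. -/
noncomputable def coordPow {Ω : Type*} {d : ℕ} (α : Fin d → ℝ) (Z : Ω → Fin d → ℝ) (j : Fin d)
    (ω : Ω) : ℝ := |Z ω j| ^ α j

theorem coordPow_nonneg {Ω : Type*} {d : ℕ} (α : Fin d → ℝ) (Z : Ω → Fin d → ℝ) (j : Fin d)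
    (ω : Ω) : 0 ≤ coordPow α Z j ω := Real.rpow_nonneg (abs_nonneg _) _

theorem measurable_abs_apply_rpow {d : ℕ} (j : Fin d) (p : ℝ) :
    Measurable fun x : Fin d → ℝ => |x j| ^ p :=
  (continuous_abs.comp (continuous_apply j)).measurable.pow_const _

theorem measurable_coordPow {Ω : Type*} [MeasurableSpace Ω] {d : ℕ} {α : Fin d → ℝ}
    {Z : Ω → Fin d → ℝ} (hZ : Measurable Z) (j : Fin d) : Measurable (coordPow α Z j) :=
  (measurable_abs_apply_rpow j (α j)).comp hZ

theorem coordPow_mul {Ω : Type*} {d : ℕ} (α : Fin d → ℝ) (A X : Ω → Fin d → ℝ) (j : Fin d)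
    (ω : Ω) :
    coordPow α (fun ω j => A ω j * X ω j) j ω = coordPow α A j ω * coordPow α X j ω := by
  simp only [coordPow, abs_mul]
  exact Real.mul_rpow (abs_nonneg _) (abs_nonneg _)

/-- The standing assumptions on the equation `X = A X + B` in law, in terms of the random
variables `|A_j| ^ α_j`, `|B_j| ^ α_j`. -/
structure DiagonalAffine {Ω : Type*} [MeasurableSpace Ω] (P : Measure Ω) {d : ℕ}
    (X A B : Ω → Fin d → ℝ) (α : Fin d → ℝ) : Prop where
  measX : Measurable X
  measA : Measurable A
  measB : Measurable B
  indep : IndepFun A X P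
  law : IdentDistrib X (fun ω j => A ω j * X ω j + B ω j) P P
  pos : ∀ j, 0 < α j
  nonarith : ∀ j, ¬ ∃ h : ℝ, 0 < h ∧
    ∀ᵐ ω ∂P, A ω j ≠ 0 → ∃ n : ℤ, Real.log (coordPow α A j ω) = n * h
  moment : ∀ j, ∫ ω, coordPow α A j ω ∂P = 1
  logMoment : ∀ j, Integrable (fun ω => coordPow α A j ω * Real.log (coordPow α A j ω)) P
  tailB : ∀ j, ∃ τ : ℝ, 0 < τ ∧ ∃ C : ℝ, 0 ≤ C ∧
    ∀ s : ℝ, 0 < s → P.real {ω | s < coordPow α B j ω} ≤ C * s ^ (-(1 + τ))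

/-! ### Independence, convexity of moments and splitting of sums -/

section
variable {Ω : Type*} [MeasurableSpace Ω] {P : Measure Ω}

theorem integral_indepFun {E F : Type*} [MeasurableSpace E] [MeasurableSpace F]
    [IsProbabilityMeasure P] {A : Ω → E}
    {X : Ω → F} (hA : Measurable A) (hX : Measurable X) (h : IndepFun A X P) {f : E × F → ℝ}
    (hf : Measurable f) {C : ℝ} (hC : ∀ p, |f p| ≤ C) :
    ∫ ω, f (A ω, X ω) ∂P = ∫ ω, ∫ ω', f (A ω, X ω') ∂P ∂P := by
  have := Measure.isProbabilityMeasure_map (μ := P) hA.aemeasurable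
  have := Measure.isProbabilityMeasure_map (μ := P) hX.aemeasurable
  have h1 := (indepFun_iff_map_prod_eq_prod_map_map hA.aemeasurable hX.aemeasurable).1 h
  calc ∫ ω, f (A ω, X ω) ∂P = ∫ p, f p ∂(P.map fun ω => (A ω, X ω)) :=
        (integral_map (hA.prodMk hX).aemeasurable hf.aestronglyMeasurable).symm
    _ = ∫ a, ∫ x, f (a, x) ∂(P.map X) ∂(P.map A) := by
        rw [h1, integral_prod]
        exact Integrable.of_bound hf.aestronglyMeasurable C (ae_of_all _ hC)
    _ = ∫ ω, ∫ x, f (A ω, x) ∂(P.map X) ∂P :=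
        integral_map hA.aemeasurable
          hf.stronglyMeasurable.integral_prod_right'.aestronglyMeasurable
    _ = _ := by
        refine integral_congr_ae (ae_of_all _ fun ω => ?_)
        exact integral_map hX.aemeasurable (hf.comp measurable_prodMk_left).aestronglyMeasurable

theorem measureReal_indepFun {E F : Type*} [MeasurableSpace E] [MeasurableSpace F]
    [IsProbabilityMeasure P] {A : Ω → E}
    {X : Ω → F} (hA : Measurable A) (hX : Measurable X) (h : IndepFun A X P) {S : Set (E × F)}
    (hS : MeasurableSet S) :
    P.real {ω | (A ω, X ω) ∈ S} = ∫ ω, P.real {ω' | (A ω, X ω') ∈ S} ∂P := by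
  have := integral_indepFun hA hX h (f := S.indicator 1) (measurable_one.indicator hS) (C := 1)
    (fun p => by by_cases hp : p ∈ S <;> simp [hp])
  have hS1 : MeasurableSet {ω | (A ω, X ω) ∈ S} := hA.prodMk hX hS
  have hS2 : ∀ ω, MeasurableSet {ω' | (A ω, X ω') ∈ S} := fun ω => (measurable_const.prodMk hX) hS
  have e1 : (fun ω => S.indicator (1 : E × F → ℝ) (A ω, X ω)) =
      {ω | (A ω, X ω) ∈ S}.indicator 1 := rfl
  have e2 : ∀ ω, (fun ω' => S.indicator (1 : E × F → ℝ) (A ω, X ω')) =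
      {ω' | (A ω, X ω') ∈ S}.indicator 1 := fun _ => rfl
  rw [e1, integral_indicator_one hS1] at this
  rw [this]
  refine integral_congr_ae (ae_of_all _ fun ω => ?_)
  simp only
  rw [e2, integral_indicator_one (hS2 ω)]

theorem integrable_measureReal_indep {E F : Type*} [MeasurableSpace E] [MeasurableSpace F]
    [IsProbabilityMeasure P] {A : Ω → E}
    {X : Ω → F} (hA : Measurable A) (hX : Measurable X) {S : Set (E × F)}
    (hS : MeasurableSet S) : Integrable (fun ω => P.real {ω' | (A ω, X ω') ∈ S}) P := by
  have hm : Measurable (fun ω => P.real {ω' | (A ω, X ω') ∈ S}) := by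
    have : MeasurableSet {p : Ω × Ω | (A p.1, X p.2) ∈ S} :=
      ((hA.comp measurable_fst).prodMk (hX.comp measurable_snd)) hS
    exact (measurable_measure_prodMk_left this).ennreal_toReal
  exact Integrable.of_bound hm.aestronglyMeasurable 1
    (ae_of_all _ fun ω => by rw [Real.norm_of_nonneg measureReal_nonneg]; exact measureReal_le_one)

/-- The concave power lies below its tangent at 1; the tangent has mean 1 when x is a weight of mean
1. -/
theorem rpow_le_affine {x p : ℝ} (hx : 0 ≤ x) (hp : 0 < p) (hp1 : p < 1) :
    x ^ p ≤ 1 + p * (x - 1) := by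
  have := rpow_one_add_le_one_add_mul_self (s := x - 1) (by linarith) hp.le hp1.le
  simpa using this

theorem integrable_rpow_of_lt_one [IsProbabilityMeasure P] {u : Ω → ℝ} (hu : Measurable u)
    (h0 : ∀ ω, 0 ≤ u ω) (h1 : ∫ ω, u ω ∂P = 1) {p : ℝ} (hp : 0 < p) (hp1 : p < 1) :
    Integrable (fun ω => u ω ^ p) P := by
  have hi := integrable_of_integral_eq_one h1
  refine Integrable.mono' (g := fun ω => 1 + p * (u ω - 1))
    ((integrable_const _).add ((hi.sub (integrable_const _)).const_mul _))
    (hu.pow_const p).aestronglyMeasurable (ae_of_all _ fun ω => ?_)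
  rw [Real.norm_of_nonneg (Real.rpow_nonneg (h0 ω) p)]
  exact rpow_le_affine (h0 ω) hp hp1

/-- Two ordered functions with equal integrals agree almost everywhere; here the functions are
ordered strictly off the set where `u = 1`. -/
theorem integral_lt_of_lt_of_ne_one {u f g : Ω → ℝ} (hf : Integrable f P) (hg : Integrable g P)
    (hle : ∀ ω, f ω ≤ g ω) (hlt : ∀ ω, u ω ≠ 1 → f ω < g ω) (hne : ¬ ∀ᵐ ω ∂P, u ω = 1) :
    ∫ ω, f ω ∂P < ∫ ω, g ω ∂P := by
  refine lt_of_le_of_ne (integral_mono hf hg hle) fun h => hne ?_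
  have h1 := (integral_eq_iff_of_ae_le hf hg (ae_of_all _ hle)).1 h
  filter_upwards [h1] with ω hω
  by_contra hc
  exact (hlt ω hc).ne hω

/-- Strict concavity: the tangent at 1 touches the power only at u = 1. This gives the contraction
factor below the critical exponent. -/
theorem integral_rpow_lt_one [IsProbabilityMeasure P] {u : Ω → ℝ} (hu : Measurable u)
    (h0 : ∀ ω, 0 ≤ u ω) (h1 : ∫ ω, u ω ∂P = 1) (hne : ¬ ∀ᵐ ω ∂P, u ω = 1)
    {p : ℝ} (hp : 0 < p) (hp1 : p < 1) : ∫ ω, u ω ^ p ∂P < 1 := by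
  have hi := integrable_of_integral_eq_one h1
  have hj : Integrable (fun ω => p * (u ω - 1)) P := (hi.sub (integrable_const _)).const_mul _
  have h2 : ∫ ω, (1 + p * (u ω - 1)) ∂P = 1 := by
    rw [integral_add (integrable_const _) hj, integral_const_mul,
      integral_sub hi (integrable_const _), h1]
    simp
  rw [← h2]
  refine integral_lt_of_lt_of_ne_one (u := u) (integrable_rpow_of_lt_one hu h0 h1 hp hp1)
    ((integrable_const _).add hj) (fun ω => rpow_le_affine (h0 ω) hp hp1) (fun ω hω => ?_) hne
  have := rpow_one_add_lt_one_add_mul_self (s := u ω - 1) (by linarith [h0 ω])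
    (sub_ne_zero.2 hω) hp hp1
  simpa using this

/-- Since u log u ≥ u - 1 with equality only at u = 1, and u - 1 has mean 0. This is the positive
drift of log u under the tilted law. -/
theorem integral_mul_log_pos [IsProbabilityMeasure P] {u : Ω → ℝ}
    (h0 : ∀ ω, 0 ≤ u ω) (h1 : ∫ ω, u ω ∂P = 1) (hne : ¬ ∀ᵐ ω ∂P, u ω = 1)
    (hl : Integrable (fun ω => u ω * Real.log (u ω)) P) :
    0 < ∫ ω, u ω * Real.log (u ω) ∂P := by
  have hi := integrable_of_integral_eq_one h1
  have h2 : ∫ ω, (u ω - 1) ∂P = 0 := by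
    rw [integral_sub hi (integrable_const _), h1]; simp
  have hlt : ∀ ω, u ω ≠ 1 → u ω - 1 < u ω * Real.log (u ω) := by
    intro ω hω
    rcases (h0 ω).eq_or_lt with h | h
    · rw [← h]; simp
    · have := Real.log_lt_sub_one_of_pos (inv_pos.2 h) (by simpa using hω)
      rw [Real.log_inv] at this
      have h3 := mul_lt_mul_of_pos_left this h
      rw [mul_sub, mul_inv_cancel₀ h.ne'] at h3
      linarith
  rw [← h2]
  refine integral_lt_of_lt_of_ne_one (u := u) (hi.sub (integrable_const _)) hl (fun ω => ?_) hlt hne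
  by_cases h : u ω = 1
  · simp [h]
  · exact (hlt ω h).le

/-- A tail bound for `Y` passes to `U Y` when `U` and `Y` are independent. -/
theorem tail_mul_le [IsProbabilityMeasure P] {U Y : Ω → ℝ} (hU : Measurable U) (hY : Measurable Y)
    (hUY : IndepFun U Y P) (h0 : ∀ ω, 0 ≤ U ω) {η K β : ℝ} (hη : 0 ≤ η)
    (hK : 0 ≤ K) (hUi : Integrable (fun ω => U ω ^ β) P)
    (h : ∀ s, 0 < s → P.real {ω | s < Y ω} ≤ η + K * s ^ (-β)) {s : ℝ} (hs : 0 < s) :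
    P.real {ω | s < U ω * Y ω} ≤ η + K * (∫ ω, U ω ^ β ∂P) * s ^ (-β) := by
  have hS : MeasurableSet {p : ℝ × ℝ | s < p.1 * p.2} :=
    measurableSet_lt measurable_const (measurable_fst.mul measurable_snd)
  have h1 := measureReal_indepFun hU hY hUY hS
  simp only [Set.mem_ofPred_eq] at h1
  rw [h1]
  have h2 : ∫ ω, (η + K * s ^ (-β) * U ω ^ β) ∂P = η + K * (∫ ω, U ω ^ β ∂P) * s ^ (-β) := by
    rw [integral_add (integrable_const _) (hUi.const_mul _), integral_const_mul]
    simp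
    ring
  rw [← h2]
  refine integral_mono (integrable_measureReal_indep hU hY hS)
    ((integrable_const _).add (hUi.const_mul _)) fun ω => ?_
  simp only
  rcases (h0 ω).eq_or_lt with hz | hp
  · have : {ω' | s < U ω * Y ω'} = ∅ := by
      ext ω'; simp [← hz, hs.le]
    rw [this]
    simp only [measureReal_empty]
    have := Real.rpow_nonneg hs.le (-β)
    have := Real.rpow_nonneg (h0 ω) β
    positivity
  · have : {ω' | s < U ω * Y ω'} = {ω' | s / U ω < Y ω'} := by
      ext ω'; simp [div_lt_iff₀' hp]
    rw [this]
    refine (h _ (div_pos hs hp)).trans (le_of_eq ?_)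
    rw [Real.div_rpow hs.le hp.le, Real.rpow_neg hp.le, div_inv_eq_mul, mul_assoc]

theorem exists_tail_le [IsProbabilityMeasure P] {Y : Ω → ℝ} (hY : Measurable Y) {η : ℝ}
    (hη : 0 < η) : ∃ s, 0 < s ∧ P.real {ω | s < Y ω} ≤ η := by
  have := Measure.isProbabilityMeasure_map (μ := P) hY.aemeasurable
  have h := tendsto_cdf_atTop (P.map Y)
  have h2 := (h.eventually (le_mem_nhds (show 1 - η < 1 by linarith))).and (eventually_gt_atTop 0)
  obtain ⟨s, hs, hs0⟩ := h2.exists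
  refine ⟨s, hs0, ?_⟩
  rw [cdf_eq_real, map_measureReal_apply hY measurableSet_Iic] at hs
  have h3 := probReal_add_probReal_compl (μ := P) (hY (measurableSet_Iic (a := s)))
  have h4 : (Y ⁻¹' Set.Iic s)ᶜ = {ω | s < Y ω} := by ext ω; simp
  rw [h4] at h3
  linarith

/-- Split s^{1/p} into the shares 1 - c and c. A small c costs the first summand, later AX, only a
factor near 1. -/
theorem lt_rpow_abs_add {a b c p s : ℝ} (hc : 0 < c) (hc1 : c < 1) (hp : 0 < p) (hs : 0 < s)
    (h : s < |a + b| ^ p) : (1 - c) ^ p * s < |a| ^ p ∨ c ^ p * s < |b| ^ p := by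
  have hsp : (s ^ p⁻¹) ^ p = s := Real.rpow_inv_rpow hs.le hp.ne'
  have h0 : 0 ≤ s ^ p⁻¹ := Real.rpow_nonneg hs.le _
  have h1 : s ^ p⁻¹ < |a + b| := by
    rw [← hsp] at h
    exact (Real.rpow_lt_rpow_iff h0 (abs_nonneg _) hp).1 h
  by_contra! hcon
  obtain ⟨ha, hb⟩ := hcon
  have hc' : 0 ≤ 1 - c := by linarith
  have e1 : (1 - c) ^ p * s = ((1 - c) * s ^ p⁻¹) ^ p := by rw [Real.mul_rpow hc' h0, hsp]
  have e2 : c ^ p * s = (c * s ^ p⁻¹) ^ p := by rw [Real.mul_rpow hc.le h0, hsp]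
  rw [e1, Real.rpow_le_rpow_iff (abs_nonneg _) (by positivity) hp] at ha
  rw [e2, Real.rpow_le_rpow_iff (abs_nonneg _) (by positivity) hp] at hb
  have := abs_add_le a b
  linarith

end

/-! ### Tails of the coordinates below the critical exponent -/

namespace DiagonalAffine

variable {Ω : Type*} [MeasurableSpace Ω] {P : Measure Ω} {d : ℕ} {X A B : Ω → Fin d → ℝ}
  {α : Fin d → ℝ}

/-- A multiplier of modulus 1 has logarithm 0, which is arithmetic. This makes the convexity
inequalities strict. -/
theorem not_ae_eq_one (h : DiagonalAffine P X A B α) (j : Fin d) :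
    ¬ ∀ᵐ ω ∂P, coordPow α A j ω = 1 := fun hc => by
  refine h.nonarith j ⟨1, one_pos, ?_⟩
  filter_upwards [hc] with ω hω _
  exact ⟨0, by simp [hω]⟩

theorem indep_coordPow (h : DiagonalAffine P X A B α) (i j : Fin d) :
    IndepFun (coordPow α A i) (coordPow α X j) P :=
  h.indep.comp (φ := fun a : Fin d → ℝ => |a i| ^ α i) (ψ := fun x : Fin d → ℝ => |x j| ^ α j)
    (measurable_abs_apply_rpow i _) (measurable_abs_apply_rpow j _)

theorem measAX (h : DiagonalAffine P X A B α) : Measurable (fun ω j => A ω j * X ω j) := by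
  refine measurable_pi_lambda _ fun j => ?_
  exact ((measurable_pi_apply j).comp h.measA).mul ((measurable_pi_apply j).comp h.measX)

theorem measX' (h : DiagonalAffine P X A B α) :
    Measurable (fun ω j => A ω j * X ω j + B ω j) := by
  refine measurable_pi_lambda _ fun j => ?_
  exact (((measurable_pi_apply j).comp h.measA).mul ((measurable_pi_apply j).comp h.measX)).add
    ((measurable_pi_apply j).comp h.measB)

theorem measureReal_law (h : DiagonalAffine P X A B α) {S : Set (Fin d → ℝ)}
    (hS : MeasurableSet S) :
    P.real {ω | X ω ∈ S} = P.real {ω | (fun j => A ω j * X ω j + B ω j) ∈ S} :=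
  congrArg ENNReal.toReal (h.law.measure_mem_eq hS)

theorem integral_law (h : DiagonalAffine P X A B α) {f : (Fin d → ℝ) → ℝ}
    (hf : Measurable f) :
    ∫ ω, f (X ω) ∂P = ∫ ω, f (fun j => A ω j * X ω j + B ω j) ∂P :=
  (h.law.comp hf).integral_eq

variable [IsProbabilityMeasure P]

theorem tail_recursion (h : DiagonalAffine P X A B α) (j : Fin d) {c s : ℝ} (hc : 0 < c)
    (hc1 : c < 1) (hs : 0 < s) :
    P.real {ω | s < coordPow α X j ω} ≤
      P.real {ω | (1 - c) ^ α j * s < coordPow α A j ω * coordPow α X j ω} +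
      P.real {ω | c ^ α j * s < coordPow α B j ω} := by
  have hS : MeasurableSet {x : Fin d → ℝ | s < |x j| ^ α j} := measurableSet_lt measurable_const (measurable_abs_apply_rpow j _)
  have h1 := h.measureReal_law hS
  simp only [Set.mem_ofPred_eq] at h1
  change P.real {ω | s < |X ω j| ^ α j} ≤ _
  rw [h1]
  refine (measureReal_mono ?_).trans (measureReal_union_le _ _)
  intro ω hω
  simp only [Set.mem_ofPred_eq] at hω
  rcases lt_rpow_abs_add hc hc1 (h.pos j) hs hω with h2 | h2
  · left
    rw [abs_mul, Real.mul_rpow (abs_nonneg _) (abs_nonneg _)] at h2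
    exact h2
  · right
    exact h2

theorem tailB_of_lt_one (h : DiagonalAffine P X A B α) (j : Fin d) {β : ℝ} (hβ : 0 < β)
    (hβ1 : β < 1) : ∃ C : ℝ, 0 ≤ C ∧
      ∀ s : ℝ, 0 < s → P.real {ω | s < coordPow α B j ω} ≤ C * s ^ (-β) := by
  obtain ⟨τ, hτ, C, hC, hb⟩ := h.tailB j
  refine ⟨C + 1, by positivity, fun s hs => ?_⟩
  have hsβ := Real.rpow_nonneg hs.le (-β)
  rcases le_total 1 s with h1 | h1
  · refine (hb s hs).trans ?_
    have : s ^ (-(1 + τ)) ≤ s ^ (-β) := Real.rpow_le_rpow_of_exponent_le h1 (by linarith)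
    nlinarith [mul_le_mul_of_nonneg_left this hC]
  · have : 1 ≤ s ^ (-β) := Real.one_le_rpow_of_pos_of_le_one_of_nonpos hs h1 (by linarith)
    refine measureReal_le_one.trans ?_
    nlinarith

/-- The tails of the coordinates of `X`, below the critical exponent. -/
theorem tail_of_lt_one (h : DiagonalAffine P X A B α) (j : Fin d) {β : ℝ} (hβ : 0 < β)
    (hβ1 : β < 1) : ∃ C : ℝ, 0 ≤ C ∧
      ∀ s : ℝ, 0 < s → P.real {ω | s < coordPow α X j ω} ≤ C * s ^ (-β) := by
  obtain ⟨CB, hCB, hB⟩ := h.tailB_of_lt_one j hβ hβ1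
  have hum := measurable_coordPow (α := α) h.measA j
  have hYm := measurable_coordPow (α := α) h.measX j
  have hu0 := coordPow_nonneg α A j
  have hui := integrable_rpow_of_lt_one hum hu0 (h.moment j) hβ hβ1
  set ρ₀ := ∫ ω, coordPow α A j ω ^ β ∂P with hρ₀
  have hρ₀1 : ρ₀ < 1 := integral_rpow_lt_one hum hu0 (h.moment j) (h.not_ae_eq_one j) hβ hβ1
  have hρ₀0 : 0 ≤ ρ₀ := integral_nonneg fun ω => Real.rpow_nonneg (hu0 ω) _
  -- E u^β < 1 leaves room for the loss caused by splitting off B, provided c is small.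
  obtain ⟨c, hc, hc1, hρ1⟩ : ∃ c : ℝ, 0 < c ∧ c < 1 ∧ ρ₀ * ((1 - c) ^ α j) ^ (-β) < 1 := by
    have h1 : Tendsto (fun c : ℝ => ρ₀ * ((1 - c) ^ α j) ^ (-β)) (𝓝 0) (𝓝 (ρ₀ * ((1 - 0) ^ α j) ^ (-β))) := by
      refine Tendsto.const_mul _ ?_
      refine Tendsto.rpow_const ?_ (Or.inl (by simp))
      exact Tendsto.rpow_const (tendsto_const_nhds.sub tendsto_id) (Or.inl (by simp))
    simp only [sub_zero, Real.one_rpow, mul_one] at h1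
    have h2 := (h1.mono_left (nhdsWithin_le_nhds (s := Set.Ioi 0))).eventually (gt_mem_nhds hρ₀1)
    have h3 : ∀ᶠ c : ℝ in 𝓝[>] 0, c ∈ Set.Ioo (0 : ℝ) 1 := Ioo_mem_nhdsGT one_pos
    obtain ⟨c, hc, hc'⟩ := (h2.and h3).exists
    exact ⟨c, hc'.1, hc'.2, hc⟩
  set ρ := ρ₀ * ((1 - c) ^ α j) ^ (-β) with hρ
  have hl : 0 < (1 - c) ^ α j := Real.rpow_pos_of_pos (by linarith) _
  have hlc : 0 < c ^ α j := Real.rpow_pos_of_pos hc _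
  have hρ0 : 0 ≤ ρ := mul_nonneg hρ₀0 (Real.rpow_nonneg hl.le _)
  set C := CB * (c ^ α j) ^ (-β) with hC
  have hC0 : 0 ≤ C := mul_nonneg hCB (Real.rpow_nonneg hlc.le _)
  -- One use of the equation sends K to Kρ + C, with fixed point C / (1 - ρ), and keeps the additive
  -- η.
  have step : ∀ η K : ℝ, 0 ≤ η → 0 ≤ K →
      (∀ s, 0 < s → P.real {ω | s < coordPow α X j ω} ≤ η + K * s ^ (-β)) →
      (∀ s, 0 < s → P.real {ω | s < coordPow α X j ω} ≤ η + (K * ρ + C) * s ^ (-β)) := by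
    intro η K hη hK hk s hs
    refine (h.tail_recursion j hc hc1 hs).trans ?_
    have e1 := tail_mul_le hum hYm (h.indep_coordPow j j) hu0 hη hK hui hk
      (s := (1 - c) ^ α j * s) (by positivity)
    have e2 := hB (c ^ α j * s) (by positivity)
    rw [Real.mul_rpow hl.le hs.le] at e1
    rw [Real.mul_rpow hlc.le hs.le] at e2
    refine (add_le_add e1 e2).trans (le_of_eq ?_)
    rw [hC, hρ]
    ring
  have h1ρ : 0 < 1 - ρ := by linarith
  -- No power bound is known at the start. The slack η provides one: beyond s₀ the tail is at most
  -- η, and below s₀ the term (s₀/s)^β is at least 1. Let n → ∞ first, then η → 0.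
  have iter : ∀ η, 0 < η → ∃ K, 0 ≤ K ∧ ∀ n : ℕ, ∀ s, 0 < s →
      P.real {ω | s < coordPow α X j ω} ≤ η + (K * ρ ^ n + C / (1 - ρ)) * s ^ (-β) := by
    intro η hη
    obtain ⟨s₀, hs₀, hs₁⟩ := exists_tail_le (P := P) hYm hη
    have hK0 : 0 ≤ s₀ ^ β := Real.rpow_nonneg hs₀.le _
    have hq : 0 ≤ C / (1 - ρ) := by positivity
    refine ⟨s₀ ^ β, hK0, fun n => ?_⟩
    induction n with
    | zero =>
      intro s hs
      have hsβ := Real.rpow_nonneg hs.le (-β)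
      have hqs : 0 ≤ C / (1 - ρ) * s ^ (-β) := by positivity
      rw [pow_zero, mul_one, add_mul]
      rcases le_total s s₀ with hle | hle
      · have : 1 ≤ s₀ ^ β * s ^ (-β) := by
          rw [Real.rpow_neg hs.le, ← div_eq_mul_inv, one_le_div (Real.rpow_pos_of_pos hs _)]
          exact Real.rpow_le_rpow hs.le hle hβ.le
        have := measureReal_le_one (μ := P) (s := {ω | s < coordPow α X j ω})
        linarith
      · have : P.real {ω | s < coordPow α X j ω} ≤ P.real {ω | s₀ < coordPow α X j ω} :=
          measureReal_mono fun ω hω => lt_of_le_of_lt hle hω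
        have : 0 ≤ s₀ ^ β * s ^ (-β) := by positivity
        linarith
    | succ n ih =>
      intro s hs
      refine (step η _ hη.le (by positivity) ih s hs).trans (le_of_eq ?_)
      congr 2
      field_simp
      ring
  refine ⟨C / (1 - ρ), by positivity, fun s hs => ?_⟩
  refine le_of_forall_pos_le_add fun η hη => ?_
  obtain ⟨K, hK, hk⟩ := iter η hη
  have hlim : Tendsto (fun n : ℕ => η + (K * ρ ^ n + C / (1 - ρ)) * s ^ (-β)) atTop
      (𝓝 (η + (K * 0 + C / (1 - ρ)) * s ^ (-β))) :=
    ((((tendsto_pow_atTop_nhds_zero_of_lt_one hρ0 hρ1).const_mul K).add_const _).mul_const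
      _).const_add η
  have := ge_of_tendsto' hlim fun n => hk n s hs
  simp only [mul_zero, zero_add] at this
  linarith

theorem tail_mul_of_lt_one (h : DiagonalAffine P X A B α) (j : Fin d) {β : ℝ} (hβ : 0 < β)
    (hβ1 : β < 1) : ∃ C : ℝ, 0 ≤ C ∧ ∀ s : ℝ, 0 < s →
      P.real {ω | s < coordPow α A j ω * coordPow α X j ω} ≤ C * s ^ (-β) := by
  obtain ⟨C, hC, ht⟩ := h.tail_of_lt_one j hβ hβ1
  have hum := measurable_coordPow (α := α) h.measA j
  have hu0 := coordPow_nonneg α A j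
  refine ⟨C * ∫ ω, coordPow α A j ω ^ β ∂P,
    mul_nonneg hC (integral_nonneg fun ω => Real.rpow_nonneg (hu0 ω) _), fun s hs => ?_⟩
  have := tail_mul_le hum (measurable_coordPow (α := α) h.measX j) (h.indep_coordPow j j) hu0
    le_rfl hC (integrable_rpow_of_lt_one hum hu0 (h.moment j) hβ hβ1)
    (fun s hs => by rw [zero_add]; exact ht s hs) hs
  simpa using this

end DiagonalAffine

/-! ### Boundedness of subsolutions of renewal equations -/

section
variable {Ω : Type*} [MeasurableSpace Ω] {Q : Measure Ω} [IsProbabilityMeasure Q]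

/-- For a walk with an exponential moment `ρ < 1` of its negative steps, there is a bounded
function whose defect in the renewal equation dominates a two-sided exponential. -/
theorem exists_supersolution {ξ : Ω → ℝ} (hξ : Measurable ξ) {θ η : ℝ} (hη : 0 < η)
    (hi : Integrable (fun ω => Real.exp (-θ * ξ ω)) Q)
    (hθ : 0 < θ) (hρ : ∫ ω, Real.exp (-θ * ξ ω) ∂Q < 1) :
    ∃ W : ℝ → ℝ, ∃ M c : ℝ, Measurable W ∧ (∀ t, 0 ≤ W t) ∧ (∀ t, W t ≤ M) ∧ 0 < c ∧
      (∀ t, 0 ≤ t → ∫ ω, W (t - ξ ω) ∂Q + c * Real.exp (-η * t) ≤ W t) ∧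
      (∀ t, t ≤ 0 → ∫ ω, W (t - ξ ω) ∂Q + c * Real.exp (θ * t) ≤ W t) := by
  set ρ := ∫ ω, Real.exp (-θ * ξ ω) ∂Q with hρd
  have h1ρ : 0 < 1 - ρ := by linarith
  -- Minimum of two supersolutions: the constant 1 has defect 0, while e^{θt} is multiplied by ρ <
  -- 1. The defect of V is nonnegative, and at least (1 - ρ)e^{θt} for t ≤ 0.
  set V : ℝ → ℝ := fun t => min 1 (Real.exp (θ * t)) with hV
  have hVc : Continuous V := by fun_prop
  have hV0 : ∀ t, 0 ≤ V t := fun t => le_min zero_le_one (Real.exp_pos _).le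
  have hV1 : ∀ t, V t ≤ 1 := fun t => min_le_left _ _
  have hVi : ∀ t, Integrable (fun ω => V (t - ξ ω)) Q := fun t =>
    Integrable.of_bound (hVc.measurable.comp (measurable_const.sub hξ)).aestronglyMeasurable 1
      (ae_of_all _ fun ω => by rw [Real.norm_of_nonneg (hV0 _)]; exact hV1 _)
  have hVQ1 : ∀ t, ∫ ω, V (t - ξ ω) ∂Q ≤ 1 := fun t => by
    have := integral_mono (hVi t) (integrable_const (1 : ℝ)) fun ω => hV1 (t - ξ ω)
    simpa using this
  have hVQ2 : ∀ t, ∫ ω, V (t - ξ ω) ∂Q ≤ ρ * Real.exp (θ * t) := fun t => by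
    have := integral_mono (hVi t) (hi.mul_const (Real.exp (θ * t))) fun ω => by
      refine (min_le_right _ _).trans (le_of_eq ?_)
      rw [← Real.exp_add]; congr 1; ring
    rwa [integral_mul_const] at this
  have hVQ3 : ∀ t, t ≤ 0 → (1 - ρ) * Real.exp (θ * t) ≤ V t - ∫ ω, V (t - ξ ω) ∂Q := by
    intro t ht
    have : V t = Real.exp (θ * t) :=
      min_eq_right (Real.exp_le_one_iff.2 (mul_nonpos_of_nonneg_of_nonpos hθ.le ht))
    linarith [hVQ2 t]
  have hVQ0 : ∀ t, 0 ≤ V t - ∫ ω, V (t - ξ ω) ∂Q := by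
    intro t
    rcases le_total t 0 with ht | ht
    · exact (by positivity : 0 ≤ (1 - ρ) * Real.exp (θ * t)).trans (hVQ3 t ht)
    · have : V t = 1 := min_eq_left (Real.one_le_exp (by positivity))
      linarith [hVQ1 t]
  -- Translates of V by k with weights e^{-ηk} spread the defect over t ≥ 0 at rate e^{-ηt}, while
  -- the sum stays bounded.
  set q := Real.exp (-η) with hq
  have hq0 : 0 < q := Real.exp_pos _
  have hq1 : q < 1 := Real.exp_lt_one_iff.2 (by linarith)
  have hgs : Summable fun k : ℕ => q ^ k := summable_geometric_of_lt_one hq0.le hq1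
  have hs : ∀ t, Summable fun k : ℕ => q ^ k * V (t - k) := fun t =>
    Summable.of_nonneg_of_le (fun k => mul_nonneg (by positivity) (hV0 _))
      (fun k => mul_le_of_le_one_right (by positivity) (hV1 _)) hgs
  have hInt : ∀ t, HasSum (fun k : ℕ => q ^ k * ∫ ω, V (t - k - ξ ω) ∂Q)
      (∫ ω, ∑' k : ℕ, q ^ k * V (t - ξ ω - k) ∂Q) := by
    intro t
    have e : ∀ (k : ℕ) ω, q ^ k * V (t - ξ ω - k) = q ^ k * V (t - k - ξ ω) := fun k ω => by
      congr 2; ring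
    simp_rw [e]
    have h1 := hasSum_integral_of_summable_integral_norm (μ := Q)
      (F := fun (k : ℕ) ω => q ^ k * V (t - k - ξ ω)) (fun k => (hVi _).const_mul _) (by
        refine Summable.of_nonneg_of_le (fun k => integral_nonneg fun ω => norm_nonneg _)
          (fun k => ?_) hgs
        have e2 : ∀ ω, ‖q ^ k * V (t - k - ξ ω)‖ = q ^ k * V (t - k - ξ ω) := fun ω =>
          Real.norm_of_nonneg (mul_nonneg (by positivity) (hV0 _))
        simp_rw [e2, integral_const_mul]
        exact mul_le_of_le_one_right (by positivity) (hVQ1 _))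
    simpa only [integral_const_mul] using h1
  have hdef : ∀ (t : ℝ) (k : ℕ), q ^ k * (V (t - k) - ∫ ω, V (t - k - ξ ω) ∂Q) ≤
      (∑' k : ℕ, q ^ k * V (t - k)) - ∫ ω, ∑' k : ℕ, q ^ k * V (t - ξ ω - k) ∂Q := by
    intro t k
    have h1 := (hs t).hasSum.sub (hInt t)
    simp_rw [← mul_sub] at h1
    exact le_hasSum h1 k fun j _ => mul_nonneg (by positivity) (hVQ0 _)
  refine ⟨fun t => ∑' k : ℕ, q ^ k * V (t - k), ∑' k : ℕ, q ^ k, (1 - ρ) * Real.exp (-θ - η), ?_,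
    fun t => tsum_nonneg fun k => mul_nonneg (by positivity) (hV0 _), fun t => ?_, by positivity,
    fun t ht => ?_, fun t ht => ?_⟩
  · refine (continuous_tsum (fun k => by fun_prop) hgs fun k t => ?_).measurable
    rw [Real.norm_of_nonneg (mul_nonneg (by positivity) (hV0 _))]
    exact mul_le_of_le_one_right (by positivity) (hV1 _)
  · exact (hs t).tsum_le_tsum (fun k => mul_le_of_le_one_right (by positivity) (hV1 _)) hgs
  -- The translate by ⌈t⌉ is evaluated in (-1, 0], where its defect is at least (1 - ρ)e^{-θ}; its
  -- weight exceeds e^{-η(t+1)}. Hence the constant (1 - ρ)e^{-θ-η}.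
  · have h1 := hdef t ⌈t⌉₊
    have h2 : t - ⌈t⌉₊ ≤ 0 := by linarith [Nat.le_ceil t]
    have h3 : -1 ≤ t - ⌈t⌉₊ := by linarith [Nat.ceil_lt_add_one ht]
    have h4 := hVQ3 _ h2
    have h5 : Real.exp (-η * (t + 1)) ≤ q ^ ⌈t⌉₊ := by
      rw [hq, ← Real.exp_nat_mul, Real.exp_le_exp]
      nlinarith [Nat.ceil_lt_add_one ht]
    have h6 : (1 - ρ) * Real.exp (-θ) ≤ V (t - ⌈t⌉₊) - ∫ ω, V (t - ⌈t⌉₊ - ξ ω) ∂Q := by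
      refine le_trans (mul_le_mul_of_nonneg_left ?_ h1ρ.le) h4
      rw [Real.exp_le_exp]; nlinarith
    have h7 : (1 - ρ) * Real.exp (-θ - η) * Real.exp (-η * t) =
        Real.exp (-η * (t + 1)) * ((1 - ρ) * Real.exp (-θ)) := by
      have : Real.exp (-θ - η) * Real.exp (-η * t) = Real.exp (-η * (t + 1)) * Real.exp (-θ) := by
        rw [← Real.exp_add, ← Real.exp_add]; congr 1; ring
      linear_combination (1 - ρ) * this
    have h8 := mul_le_mul h5 h6 (by positivity) (by positivity)
    linarith
  · have h1 := hdef t 0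
    simp only [pow_zero, one_mul, Nat.cast_zero, sub_zero] at h1
    have h2 := hVQ3 t ht
    have h3 : (1 - ρ) * Real.exp (-θ - η) * Real.exp (θ * t) ≤ (1 - ρ) * Real.exp (θ * t) := by
      refine mul_le_mul_of_nonneg_right ?_ (Real.exp_pos _).le
      exact mul_le_of_le_one_right h1ρ.le (Real.exp_le_one_iff.2 (by linarith))
    linarith

/-- Subtracting C/c times the supersolution absorbs the inhomogeneity. The difference is at most its
own average shift and at most K e^{θt}; each iteration gains a factor ρ < 1, so it is nonpositive.
-/
theorem bounded_of_renewal_le {ψ : ℝ → ℝ} (hψ : Measurable ψ) (h0 : ∀ t, 0 ≤ ψ t) {ξ : Ω → ℝ}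
    (hξ : Measurable ξ) {θ η K C : ℝ} (hη : 0 < η) (hC : 0 ≤ C)
    (hi : Integrable (fun ω => Real.exp (-θ * ξ ω)) Q)
    (hθ : 0 < θ) (hρ : ∫ ω, Real.exp (-θ * ξ ω) ∂Q < 1)
    (hK : ∀ t, ψ t ≤ K * Real.exp (θ * t))
    (hpos : ∀ t, 0 ≤ t → ψ t ≤ ∫ ω, ψ (t - ξ ω) ∂Q + C * Real.exp (-η * t))
    (hneg : ∀ t, t ≤ 0 → ψ t ≤ ∫ ω, ψ (t - ξ ω) ∂Q + C * Real.exp (θ * t)) :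
    ∃ M, ∀ t, ψ t ≤ M := by
  obtain ⟨W, M, c, hWm, hW0, hWM, hc, hWp, hWn⟩ := exists_supersolution (Q := Q) hξ hη hi hθ hρ
  have hK0 : 0 ≤ K := by
    have := (h0 0).trans (hK 0)
    simpa using this
  have hWi : ∀ t, Integrable (fun ω => W (t - ξ ω)) Q := fun t =>
    Integrable.of_bound (hWm.comp (measurable_const.sub hξ)).aestronglyMeasurable M
      (ae_of_all _ fun ω => by rw [Real.norm_of_nonneg (hW0 _)]; exact hWM _)
  have hexp : ∀ t ω, Real.exp (θ * (t - ξ ω)) = Real.exp (θ * t) * Real.exp (-θ * ξ ω) :=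
    fun t ω => by rw [← Real.exp_add]; congr 1; ring
  have hψi : ∀ t, Integrable (fun ω => ψ (t - ξ ω)) Q := fun t => by
    refine Integrable.mono' ((hi.const_mul (Real.exp (θ * t))).const_mul K)
      (hψ.comp (measurable_const.sub hξ)).aestronglyMeasurable (ae_of_all _ fun ω => ?_)
    rw [Real.norm_of_nonneg (h0 _), ← hexp]
    exact hK _
  set D : ℝ → ℝ := fun t => ψ t - C / c * W t with hD
  have hDi : ∀ t, Integrable (fun ω => D (t - ξ ω)) Q := fun t => (hψi t).sub ((hWi t).const_mul _)
  have hDQ : ∀ t, D t ≤ ∫ ω, D (t - ξ ω) ∂Q := by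
    intro t
    have e : ∫ ω, D (t - ξ ω) ∂Q = ∫ ω, ψ (t - ξ ω) ∂Q - C / c * ∫ ω, W (t - ξ ω) ∂Q := by
      rw [hD, integral_sub (hψi t) ((hWi t).const_mul _), integral_const_mul]
    rw [e, hD]
    have hcc : C / c * c = C := div_mul_cancel₀ _ hc.ne'
    have hC' : 0 ≤ C / c := by positivity
    rcases le_total 0 t with ht | ht
    · have h1 := mul_le_mul_of_nonneg_left (hWp t ht) hC'
      rw [mul_add, ← mul_assoc (C / c) c, hcc] at h1
      linarith [hpos t ht]
    · have h1 := mul_le_mul_of_nonneg_left (hWn t ht) hC'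
      rw [mul_add, ← mul_assoc (C / c) c, hcc] at h1
      linarith [hneg t ht]
  have hDn : ∀ n : ℕ, ∀ t, D t ≤ K * (∫ ω, Real.exp (-θ * ξ ω) ∂Q) ^ n * Real.exp (θ * t) := by
    intro n
    induction n with
    | zero =>
      intro t
      rw [pow_zero, mul_one]
      refine le_trans ?_ (hK t)
      have : 0 ≤ C / c * W t := mul_nonneg (by positivity) (hW0 t)
      simp only [hD]
      linarith
    | succ n ih =>
      intro t
      refine (hDQ t).trans ?_
      have h1 := integral_mono (hDi t) ((hi.const_mul (Real.exp (θ * t))).const_mul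
        (K * (∫ ω, Real.exp (-θ * ξ ω) ∂Q) ^ n)) fun ω => by
          simp only; rw [← hexp]; exact ih (t - ξ ω)
      refine h1.trans (le_of_eq ?_)
      rw [integral_const_mul, integral_const_mul]
      ring
  refine ⟨C / c * M, fun t => ?_⟩
  have hlim : Tendsto (fun n : ℕ => K * (∫ ω, Real.exp (-θ * ξ ω) ∂Q) ^ n * Real.exp (θ * t)) atTop
      (𝓝 (K * 0 * Real.exp (θ * t))) :=
    ((tendsto_pow_atTop_nhds_zero_of_lt_one (integral_nonneg fun ω => (Real.exp_pos _).le)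
      hρ).const_mul K).mul_const _
  have h1 := ge_of_tendsto' hlim fun n => hDn n t
  have h2 : C / c * W t ≤ C / c * M := mul_le_mul_of_nonneg_left (hWM t) (by positivity)
  simp only [hD] at h1
  linarith

end

/-! ### Test functions and the inhomogeneity -/

/-- Bounded Lipschitz functions on `ℝ^d` that vanish near the origin. -/
structure TailTest {d : ℕ} (f : (Fin d → ℝ) → ℝ) : Prop where
  lip : ∃ L : NNReal, LipschitzWith L f
  bdd : ∃ F : ℝ, ∀ x, |f x| ≤ F
  van : ∃ δ : ℝ, 0 < δ ∧ ∀ x, ‖x‖ ≤ δ → f x = 0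

theorem lt_abs_dilation_iff {d : ℕ} {α : Fin d → ℝ} {j : Fin d} (hα : 0 < α j) {c : ℝ}
    (hc : 0 ≤ c) (t : ℝ) (x : Fin d → ℝ) :
    c < |dilation α (Real.exp (-t)) x j| ↔ c ^ α j * Real.exp t < |x j| ^ α j := by
  have h1 : Real.exp (-t) ^ (1 / α j) = (Real.exp (t / α j))⁻¹ := by
    rw [← Real.exp_mul, ← Real.exp_neg]; congr 1; ring
  have h2 : c ^ α j * Real.exp t = (c * Real.exp (t / α j)) ^ α j := by
    rw [Real.mul_rpow hc (Real.exp_pos _).le, ← Real.exp_mul, div_mul_cancel₀ _ hα.ne']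
  rw [dilation, h1, h2, Real.rpow_lt_rpow_iff (by positivity) (abs_nonneg _) hα, abs_mul,
    abs_of_pos (by positivity), lt_inv_mul_iff₀ (Real.exp_pos _), mul_comm]

theorem continuous_dilation {d : ℕ} (α : Fin d → ℝ) (t : ℝ) : Continuous (dilation α t) := by
  unfold dilation; fun_prop

theorem dilation_add {d : ℕ} (α : Fin d → ℝ) (t : ℝ) (x y : Fin d → ℝ) :
    dilation α t (x + y) = dilation α t x + dilation α t y := by
  ext j; simp [dilation, mul_add]

theorem TailTest.continuous {d : ℕ} {f : (Fin d → ℝ) → ℝ} (hf : TailTest f) :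
    Continuous f := hf.lip.choose_spec.continuous

theorem exists_lt_abs_of_lt_norm {d : ℕ} {x : Fin d → ℝ} {c : ℝ} (hc : 0 ≤ c) (h : c < ‖x‖) :
    ∃ j, c < |x j| := by
  by_contra! hcon
  exact absurd ((pi_norm_le_iff_of_nonneg hc).2 hcon) (not_le.2 h)

/-- Some |b_j| exceeds ε and the trivial bound 2F is used, or b is small. In the latter case f
vanishes at both points when ‖y‖ ≤ δ/2, and otherwise the Lipschitz bound applies. Here y and b will
be the scaled AX and B. -/
theorem test_increment_le {d : ℕ} {f : (Fin d → ℝ) → ℝ} {L : NNReal} (hL : LipschitzWith L f) {F : ℝ}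
    (hF : ∀ x, |f x| ≤ F) {δ : ℝ} (hf0 : ∀ x, ‖x‖ ≤ δ → f x = 0) {ε : ℝ} (hε : 0 < ε)
    (hεδ : ε ≤ δ / 2) (y b : Fin d → ℝ) :
    |f (y + b) - f y| ≤ 2 * F * ∑ j, (if ε < |b j| then (1 : ℝ) else 0) +
      L * ε * ∑ j, (if δ / 2 < |y j| then (1 : ℝ) else 0) := by
  have hF0 : 0 ≤ F := (abs_nonneg _).trans (hF 0)
  have n1 : ∀ j, (0 : ℝ) ≤ if ε < |b j| then (1 : ℝ) else 0 := fun j => by split_ifs <;> norm_num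
  have n2 : ∀ j, (0 : ℝ) ≤ if δ / 2 < |y j| then (1 : ℝ) else 0 := fun j => by
    split_ifs <;> norm_num
  have s1 : (0 : ℝ) ≤ ∑ j, if ε < |b j| then (1 : ℝ) else 0 := Finset.sum_nonneg fun j _ => n1 j
  have s2 : (0 : ℝ) ≤ ∑ j, if δ / 2 < |y j| then (1 : ℝ) else 0 :=
    Finset.sum_nonneg fun j _ => n2 j
  have p1 : 0 ≤ 2 * F * ∑ j, (if ε < |b j| then (1 : ℝ) else 0) := by positivity
  have p2 : 0 ≤ L * ε * ∑ j, (if δ / 2 < |y j| then (1 : ℝ) else 0) := by positivity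
  by_cases hb : ∃ j, ε < |b j|
  · obtain ⟨j, hj⟩ := hb
    have h1 : (1 : ℝ) ≤ ∑ j, if ε < |b j| then (1 : ℝ) else 0 := by
      have := Finset.single_le_sum (f := fun j => if ε < |b j| then (1 : ℝ) else 0)
        (fun j _ => n1 j) (Finset.mem_univ j)
      simpa [hj] using this
    have h2 : |f (y + b) - f y| ≤ 2 * F := (abs_sub _ _).trans (by linarith [hF (y + b), hF y])
    nlinarith
  · push Not at hb
    have hbn : ‖b‖ ≤ ε := (pi_norm_le_iff_of_nonneg hε.le).2 hb
    by_cases hy : ‖y‖ ≤ δ / 2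
    · rw [hf0 y (by linarith), hf0 (y + b) ((norm_add_le _ _).trans (by linarith))]
      simp only [sub_self, abs_zero]
      linarith
    · obtain ⟨j, hj⟩ := exists_lt_abs_of_lt_norm (by linarith) (not_le.1 hy)
      have h1 : (1 : ℝ) ≤ ∑ j, if δ / 2 < |y j| then (1 : ℝ) else 0 := by
        have := Finset.single_le_sum (f := fun j => if δ / 2 < |y j| then (1 : ℝ) else 0)
          (fun j _ => n2 j) (Finset.mem_univ j)
        simpa [hj] using this
      have h2 : |f (y + b) - f y| ≤ L * ε := by
        have := hL.dist_le_mul (y + b) y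
        rw [Real.dist_eq, dist_eq_norm, add_sub_cancel_left] at this
        exact this.trans (mul_le_mul_of_nonneg_left hbn L.2)
      have : (L : ℝ) * ε * 1 ≤ L * ε * ∑ j, (if δ / 2 < |y j| then (1 : ℝ) else 0) :=
        mul_le_mul_of_nonneg_left h1 (by positivity)
      linarith

namespace DiagonalAffine

variable {Ω : Type*} [MeasurableSpace Ω] {P : Measure Ω} {d : ℕ} {X A B : Ω → Fin d → ℝ}
  {α : Fin d → ℝ} [IsProbabilityMeasure P]


theorem integrable_test {f : (Fin d → ℝ) → ℝ} (hf : TailTest f) {Z : Ω → Fin d → ℝ}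
    (hZ : Measurable Z) (t : ℝ) : Integrable (fun ω => f (dilation α t (Z ω))) P := by
  obtain ⟨F, hF⟩ := hf.bdd
  exact Integrable.of_bound
    ((hf.continuous.comp (continuous_dilation α t)).measurable.comp hZ).aestronglyMeasurable F
    (ae_of_all _ fun ω => hF _)

theorem measurableSet_lt_coordPow {Z : Ω → Fin d → ℝ} (hZ : Measurable Z) (j : Fin d) (s : ℝ) :
    MeasurableSet {ω | s < coordPow α Z j ω} :=
  measurableSet_lt measurable_const (measurable_coordPow hZ j)

theorem integral_ite_lt_dilation (hα : ∀ j, 0 < α j) {Z : Ω → Fin d → ℝ} (hZ : Measurable Z)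
    {c : ℝ} (hc : 0 ≤ c) (t : ℝ) :
    Integrable (fun ω => ∑ j, if c < |dilation α (Real.exp (-t)) (Z ω) j| then (1 : ℝ) else 0) P ∧
    ∫ ω, (∑ j, if c < |dilation α (Real.exp (-t)) (Z ω) j| then (1 : ℝ) else 0) ∂P =
      ∑ j, P.real {ω | c ^ α j * Real.exp t < coordPow α Z j ω} := by
  have e : ∀ j, (fun ω => if c < |dilation α (Real.exp (-t)) (Z ω) j| then (1 : ℝ) else 0) =
      {ω | c ^ α j * Real.exp t < coordPow α Z j ω}.indicator 1 := by
    intro j; ext ω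
    simp only [Set.indicator, Set.mem_ofPred_eq, coordPow, lt_abs_dilation_iff (hα j) hc,
      Pi.one_apply]
    congr
  have hi : ∀ j, Integrable
      (fun ω => if c < |dilation α (Real.exp (-t)) (Z ω) j| then (1 : ℝ) else 0) P := fun j => by
    rw [e j]
    exact (integrable_const (1 : ℝ)).indicator (measurableSet_lt_coordPow hZ j _)
  refine ⟨integrable_finsetSum _ fun j _ => hi j, ?_⟩
  rw [integral_finsetSum _ fun j _ => hi j]
  refine Finset.sum_congr rfl fun j _ => ?_
  rw [e j, integral_indicator_one (measurableSet_lt_coordPow hZ j _)]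

/-- The inhomogeneity of the renewal equation satisfied by `t ↦ e^t E f(δ_{e^{-t}} X)`. -/
noncomputable def inhom (P : Measure Ω) (X A : Ω → Fin d → ℝ) (α : Fin d → ℝ)
    (f : (Fin d → ℝ) → ℝ) (t : ℝ) : ℝ :=
  Real.exp t * (∫ ω, f (dilation α (Real.exp (-t)) (X ω)) ∂P -
    ∫ ω, f (dilation α (Real.exp (-t)) (fun j => A ω j * X ω j)) ∂P)

theorem abs_inhom_le_sum (h : DiagonalAffine P X A B α) {f : (Fin d → ℝ) → ℝ} (hf : TailTest f)
    {L : NNReal} (hL : LipschitzWith L f) {F : ℝ}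
    (hF : ∀ x, |f x| ≤ F) {δ : ℝ} (hf0 : ∀ x, ‖x‖ ≤ δ → f x = 0) {ε : ℝ} (hε : 0 < ε)
    (hεδ : ε ≤ δ / 2) (t : ℝ) :
    |inhom P X A α f t| ≤ Real.exp t *
      (2 * F * ∑ j, P.real {ω | ε ^ α j * Real.exp t < coordPow α B j ω} +
      L * ε * ∑ j, P.real {ω | (δ / 2) ^ α j * Real.exp t <
        coordPow α A j ω * coordPow α X j ω}) := by
  rw [inhom, abs_mul, abs_of_pos (Real.exp_pos t)]
  refine mul_le_mul_of_nonneg_left ?_ (Real.exp_pos t).le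
  have h1 := h.integral_law (hf.continuous.comp (continuous_dilation α (Real.exp (-t)))).measurable
  simp only [Function.comp] at h1
  rw [h1, ← integral_sub (integrable_test hf h.measX' _) (integrable_test hf h.measAX _)]
  obtain ⟨i1, e1⟩ := integral_ite_lt_dilation (P := P) h.pos h.measB hε.le t
  obtain ⟨i2, e2⟩ := integral_ite_lt_dilation (P := P) h.pos h.measAX
    (show 0 ≤ δ / 2 by linarith) t
  simp only [coordPow_mul] at e2
  rw [← e1, ← e2, ← integral_const_mul, ← integral_const_mul,
    ← integral_add (i1.const_mul _) (i2.const_mul _), ← Real.norm_eq_abs]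
  refine norm_integral_le_of_norm_le ((i1.const_mul _).add (i2.const_mul _))
    (ae_of_all _ fun ω => ?_)
  have e3 : dilation α (Real.exp (-t)) (fun j => A ω j * X ω j + B ω j) =
      dilation α (Real.exp (-t)) (fun j => A ω j * X ω j) + dilation α (Real.exp (-t)) (B ω) := by
    rw [← dilation_add]; rfl
  rw [e3]
  exact test_increment_le hL hF hf0 hε hεδ _ _

/-- κ is the rate at which the threshold for B will shrink. The first bound makes the shrinkage cost
at most half of the gain τ_j from the extra moment; the second makes the remaining τ_j/2 at least
κ/2. -/
theorem exists_uniform_exponent (α τ : Fin d → ℝ) (hτ : ∀ j, 0 < τ j) :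
    ∃ κ : ℝ, 0 < κ ∧ κ < 1 ∧ ∀ j, κ * α j * (1 + τ j) ≤ τ j / 2 ∧ κ ≤ τ j := by
  have h1 : ∀ j, ∀ᶠ κ : ℝ in 𝓝[>] 0, κ * α j * (1 + τ j) ≤ τ j / 2 ∧ κ ≤ τ j := by
    intro j
    have t1 : Tendsto (fun κ : ℝ => κ * α j * (1 + τ j)) (𝓝[>] 0) (𝓝 (0 * α j * (1 + τ j))) :=
      ((tendsto_id.mul_const _).mul_const _).mono_left nhdsWithin_le_nhds
    have t2 : Tendsto (fun κ : ℝ => κ) (𝓝[>] 0) (𝓝 0) := tendsto_id.mono_left nhdsWithin_le_nhds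
    have := hτ j
    exact (t1.eventually (ge_mem_nhds (by simp; linarith))).and (t2.eventually (ge_mem_nhds this))
  have h2 : ∀ᶠ κ : ℝ in 𝓝[>] 0, κ ∈ Set.Ioo (0 : ℝ) 1 := Ioo_mem_nhdsGT one_pos
  obtain ⟨κ, hκ, hκ'⟩ := ((eventually_all.2 h1).and h2).exists
  exact ⟨κ, hκ'.1, hκ'.2, hκ⟩

/-- The inhomogeneity decays exponentially at both ends. -/
theorem inhom_bound (h : DiagonalAffine P X A B α) {f : (Fin d → ℝ) → ℝ} (hf : TailTest f) :
    ∃ η : ℝ, 0 < η ∧ ∃ C : ℝ, 0 ≤ C ∧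
      (∀ t, 0 ≤ t → |inhom P X A α f t| ≤ C * Real.exp (-η * t)) ∧
      ∀ t, |inhom P X A α f t| ≤ C * Real.exp t := by
  obtain ⟨L, hL⟩ := hf.lip
  obtain ⟨F, hF⟩ := hf.bdd
  obtain ⟨δ, hδ, hf0⟩ := hf.van
  have hF0 : 0 ≤ F := (abs_nonneg _).trans (hF 0)
  choose τ hτ CB hCB hB using h.tailB
  obtain ⟨κ, hκ, hκ1, hκτ⟩ := exists_uniform_exponent α τ hτ
  -- The subcritical tail of AX at exponent 1 - κ/2 loses e^{κt/2}, which the factor e^{-κt} in ε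
  -- outweighs.
  have hβ : 0 < 1 - κ / 2 := by linarith
  have hβ1 : 1 - κ / 2 < 1 := by linarith
  choose CA hCA hA using fun j => h.tail_mul_of_lt_one j hβ hβ1
  have hδ2 : 0 < δ / 2 := by linarith
  set K1 := ∑ j, CB j * ((δ / 2) ^ α j) ^ (-(1 + τ j)) with hK1
  set K2 := ∑ j, CA j * ((δ / 2) ^ α j) ^ (-(1 - κ / 2)) with hK2
  have hp : ∀ j, 0 < (δ / 2) ^ α j := fun j => Real.rpow_pos_of_pos hδ2 _
  have hK10 : 0 ≤ K1 := Finset.sum_nonneg fun j _ =>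
    mul_nonneg (hCB j) (Real.rpow_nonneg (hp j).le _)
  have hK20 : 0 ≤ K2 := Finset.sum_nonneg fun j _ =>
    mul_nonneg (hCA j) (Real.rpow_nonneg (hp j).le _)
  refine ⟨κ / 2, by positivity, 2 * F * K1 + L * (δ / 2) * K2 + 2 * F, by positivity,
    fun t ht => ?_, fun t => ?_⟩
  · set ε := δ / 2 * Real.exp (-κ * t) with hε
    have hε0 : 0 < ε := by positivity
    have hεδ : ε ≤ δ / 2 :=
      mul_le_of_le_one_right hδ2.le (Real.exp_le_one_iff.2 (by nlinarith))
    refine (h.abs_inhom_le_sum hf hL hF hf0 hε0 hεδ t).trans ?_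
    have b1 : Real.exp t * ∑ j, P.real {ω | ε ^ α j * Real.exp t < coordPow α B j ω} ≤
        K1 * Real.exp (-(κ / 2) * t) := by
      rw [Finset.mul_sum, hK1, Finset.sum_mul]
      refine Finset.sum_le_sum fun j _ => ?_
      have e1 : ε ^ α j * Real.exp t = (δ / 2) ^ α j * Real.exp ((1 - κ * α j) * t) := by
        rw [hε, Real.mul_rpow hδ2.le (Real.exp_pos _).le, ← Real.exp_mul, mul_assoc,
          ← Real.exp_add]
        congr 2; ring
      rw [e1]
      refine (mul_le_mul_of_nonneg_left (hB j _ (mul_pos (hp j) (Real.exp_pos _)))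
        (Real.exp_pos t).le).trans ?_
      rw [Real.mul_rpow (hp j).le (Real.exp_pos _).le, ← Real.exp_mul]
      have e2 : Real.exp t * Real.exp ((1 - κ * α j) * t * -(1 + τ j)) ≤
          Real.exp (-(κ / 2) * t) := by
        rw [← Real.exp_add, Real.exp_le_exp]
        have := (hκτ j).1
        have := (hκτ j).2
        nlinarith
      calc Real.exp t * (CB j * (((δ / 2) ^ α j) ^ (-(1 + τ j)) *
            Real.exp ((1 - κ * α j) * t * -(1 + τ j)))) =
          CB j * ((δ / 2) ^ α j) ^ (-(1 + τ j)) *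
            (Real.exp t * Real.exp ((1 - κ * α j) * t * -(1 + τ j))) := by ring
        _ ≤ _ := mul_le_mul_of_nonneg_left e2
          (mul_nonneg (hCB j) (Real.rpow_nonneg (hp j).le _))
    have b2 : Real.exp t * (L * ε * ∑ j, P.real {ω | (δ / 2) ^ α j * Real.exp t <
        coordPow α A j ω * coordPow α X j ω}) ≤ L * (δ / 2) * K2 * Real.exp (-(κ / 2) * t) := by
      have b3 : ∑ j, P.real {ω | (δ / 2) ^ α j * Real.exp t <
          coordPow α A j ω * coordPow α X j ω} ≤ K2 * Real.exp (-(1 - κ / 2) * t) := by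
        rw [hK2, Finset.sum_mul]
        refine Finset.sum_le_sum fun j _ => ?_
        refine (hA j _ (mul_pos (hp j) (Real.exp_pos _))).trans (le_of_eq ?_)
        rw [Real.mul_rpow (hp j).le (Real.exp_pos _).le, ← Real.exp_mul, mul_assoc]
        congr 3; ring
      calc Real.exp t * (L * ε * ∑ j, P.real {ω | (δ / 2) ^ α j * Real.exp t <
            coordPow α A j ω * coordPow α X j ω})
          ≤ Real.exp t * (L * ε * (K2 * Real.exp (-(1 - κ / 2) * t))) := by gcongr
        _ = L * (δ / 2) * K2 * (Real.exp t * Real.exp (-κ * t) * Real.exp (-(1 - κ / 2) * t)) := by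
            rw [hε]; ring
        _ = _ := by
            rw [← Real.exp_add, ← Real.exp_add]; congr 2; ring
    have e4 : 0 ≤ 2 * F * Real.exp (-(κ / 2) * t) := by positivity
    have b1' := mul_le_mul_of_nonneg_left b1 (show 0 ≤ 2 * F by positivity)
    calc _ = 2 * F * (Real.exp t * ∑ j, P.real {ω | ε ^ α j * Real.exp t < coordPow α B j ω}) +
          Real.exp t * (L * ε * ∑ j, P.real {ω | (δ / 2) ^ α j * Real.exp t <
            coordPow α A j ω * coordPow α X j ω}) := by ring
      _ ≤ 2 * F * (K1 * Real.exp (-(κ / 2) * t)) + L * (δ / 2) * K2 * Real.exp (-(κ / 2) * t) :=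
          add_le_add b1' b2
      _ ≤ _ := by linarith
  · have i1 : ∀ Z : Ω → Fin d → ℝ, |∫ ω, f (dilation α (Real.exp (-t)) (Z ω)) ∂P| ≤ F := by
      intro Z
      have := norm_integral_le_of_norm_le_const (μ := P)
        (f := fun ω => f (dilation α (Real.exp (-t)) (Z ω))) (ae_of_all _ fun ω => hF _)
      simpa using this
    rw [inhom, abs_mul, abs_of_pos (Real.exp_pos t), mul_comm]
    refine mul_le_mul_of_nonneg_right ?_ (Real.exp_pos t).le
    have := abs_sub (∫ ω, f (dilation α (Real.exp (-t)) (X ω)) ∂P)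
      (∫ ω, f (dilation α (Real.exp (-t)) (fun j => A ω j * X ω j)) ∂P)
    have := i1 X
    have := i1 (fun ω j => A ω j * X ω j)
    have : 0 ≤ 2 * F * K1 + L * (δ / 2) * K2 := by positivity
    linarith

end DiagonalAffine

/-! ### The renewal equation for scaled expectations -/

/-- Coordinatewise multiplication by signs. -/
def signMul {d : ℕ} (g : Fin d → ℤˣ) (x : Fin d → ℝ) : Fin d → ℝ := fun j => ((g j : ℤ) : ℝ) * x j

open Classical in
/-- The signs of the coordinates, with `0` counted as positive. -/
noncomputable def signOf {d : ℕ} (a : Fin d → ℝ) : Fin d → ℤˣ := fun j => if a j < 0 then -1 else 1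

/-- The function `t ↦ e^t E f(δ_{e^{-t}} X)`. -/
noncomputable def scaledMean {Ω : Type*} [MeasurableSpace Ω] (P : Measure Ω) {d : ℕ}
    (X : Ω → Fin d → ℝ) (α : Fin d → ℝ) (f : (Fin d → ℝ) → ℝ) (t : ℝ) : ℝ :=
  Real.exp t * ∫ ω, f (dilation α (Real.exp (-t)) (X ω)) ∂P

/-- The measure with density `u` with respect to `P`. -/
noncomputable def tilt {Ω : Type*} [MeasurableSpace Ω] (P : Measure Ω) (u : Ω → ℝ) : Measure Ω :=
  P.withDensity fun ω => ENNReal.ofReal (u ω)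

section
variable {Ω : Type*} [MeasurableSpace Ω] {P : Measure Ω} {u : Ω → ℝ}

theorem isProbabilityMeasure_tilt (h0 : ∀ ω, 0 ≤ u ω) (h1 : ∫ ω, u ω ∂P = 1) :
    IsProbabilityMeasure (tilt P u) := by
  refine ⟨?_⟩
  rw [tilt, withDensity_apply _ MeasurableSet.univ, Measure.restrict_univ,
    ← ofReal_integral_eq_lintegral_ofReal (integrable_of_integral_eq_one h1) (ae_of_all _ h0), h1]
  simp

theorem integral_tilt (hu : Measurable u) (h0 : ∀ ω, 0 ≤ u ω) (g : Ω → ℝ) :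
    ∫ ω, g ω ∂(tilt P u) = ∫ ω, u ω * g ω ∂P := by
  rw [tilt, integral_withDensity_eq_integral_toReal_smul hu.ennreal_ofReal
    (ae_of_all _ fun _ => ENNReal.ofReal_lt_top)]
  simp [ENNReal.toReal_ofReal (h0 _)]

theorem integrable_tilt (hu : Measurable u) (h0 : ∀ ω, 0 ≤ u ω) (g : Ω → ℝ) :
    Integrable g (tilt P u) ↔ Integrable (fun ω => u ω * g ω) P := by
  rw [tilt, integrable_withDensity_iff_integrable_smul' hu.ennreal_ofReal
    (ae_of_all _ fun _ => ENNReal.ofReal_lt_top)]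
  simp [ENNReal.toReal_ofReal (h0 _)]

/-- The tilted law ignores {u = 0}, that is, a vanishing multiplier; this matches the conditioning
on A_j ≠ 0 in the non-arithmeticity assumption. -/
theorem ae_tilt (hu : Measurable u) (h0 : ∀ ω, 0 ≤ u ω) {p : Ω → Prop} :
    (∀ᵐ ω ∂(tilt P u), p ω) ↔ ∀ᵐ ω ∂P, u ω ≠ 0 → p ω := by
  rw [tilt, ae_withDensity_iff hu.ennreal_ofReal]
  simp only [ne_eq, ENNReal.ofReal_eq_zero]
  refine eventually_congr (ae_of_all _ fun ω => ?_)
  rw [show u ω ≤ 0 ↔ u ω = 0 from ⟨fun h => le_antisymm h (h0 ω), fun h => h.le⟩]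

end

section
variable {d : ℕ}

theorem abs_signMul (g : Fin d → ℤˣ) (x : Fin d → ℝ) (j : Fin d) : |signMul g x j| = |x j| := by
  rcases Int.units_eq_one_or (g j) with h | h <;> simp [signMul, h]

theorem norm_signMul (g : Fin d → ℤˣ) (x : Fin d → ℝ) : ‖signMul g x‖ = ‖x‖ := by
  refine le_antisymm ?_ ?_ <;> refine (pi_norm_le_iff_of_nonneg (norm_nonneg _)).2 fun j => ?_
  · rw [Real.norm_eq_abs, abs_signMul]; exact norm_le_pi_norm x j
  · rw [Real.norm_eq_abs, ← abs_signMul g]; exact norm_le_pi_norm (signMul g x) j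

theorem signMul_sub (g : Fin d → ℤˣ) (x y : Fin d → ℝ) :
    signMul g x - signMul g y = signMul g (x - y) := by
  ext j; simp [signMul, mul_sub]

theorem TailTest.comp_signMul {f : (Fin d → ℝ) → ℝ} (hf : TailTest f) (g : Fin d → ℤˣ) :
    TailTest (fun x => f (signMul g x)) := by
  obtain ⟨L, hL⟩ := hf.lip
  obtain ⟨F, hF⟩ := hf.bdd
  obtain ⟨δ, hδ, hf0⟩ := hf.van
  refine ⟨⟨L, LipschitzWith.of_dist_le_mul fun x y => ?_⟩, ⟨F, fun x => hF _⟩, δ, hδ,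
    fun x hx => hf0 _ (by rwa [norm_signMul])⟩
  refine (hL.dist_le_mul _ _).trans (le_of_eq ?_)
  rw [dist_eq_norm, dist_eq_norm, signMul_sub, norm_signMul]

theorem signOf_mul_abs (a : Fin d → ℝ) (j : Fin d) : ((signOf a j : ℤ) : ℝ) * |a j| = a j := by
  unfold signOf
  split_ifs with h
  · simp [abs_of_neg h]
  · simp [abs_of_nonneg (not_lt.1 h)]

theorem continuous_dilation_exp (α : Fin d → ℝ) (x : Fin d → ℝ) :
    Continuous fun t => dilation α (Real.exp (-t)) x := by
  unfold dilation
  refine continuous_pi fun j => ?_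
  refine Continuous.mul ?_ continuous_const
  exact Continuous.rpow_const (by fun_prop) fun t => Or.inl (Real.exp_pos _).ne'

end

namespace DiagonalAffine

variable {Ω : Type*} [MeasurableSpace Ω] {P : Measure Ω} {d : ℕ} {X A B : Ω → Fin d → ℝ}
  {α : Fin d → ℝ}

theorem inhom_eq (f : (Fin d → ℝ) → ℝ) (t : ℝ) : inhom P X A α f t =
    scaledMean P X α f t - scaledMean P (fun ω j => A ω j * X ω j) α f t := by
  rw [inhom, scaledMean, scaledMean, mul_sub]

variable [IsProbabilityMeasure P]

theorem continuous_scaledMean {f : (Fin d → ℝ) → ℝ} (hf : TailTest f) {Z : Ω → Fin d → ℝ}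
    (hZ : Measurable Z) : Continuous (scaledMean P Z α f) := by
  obtain ⟨F, hF⟩ := hf.bdd
  refine Real.continuous_exp.mul (continuous_of_dominated (bound := fun _ => F) (fun t => ?_)
    (fun t => ae_of_all _ fun ω => hF _) (integrable_const _) (ae_of_all _ fun ω => ?_))
  · exact (integrable_test hf hZ _).aestronglyMeasurable
  · exact hf.continuous.comp (continuous_dilation_exp α _)

theorem integrableOn_inhom (h : DiagonalAffine P X A B α) {f : (Fin d → ℝ) → ℝ}
    (hf : TailTest f) : IntegrableOn (inhom P X A α f) (Set.Ioi 0) := by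
  obtain ⟨η, hη, C, hC, hb, -⟩ := h.inhom_bound hf
  have hc : Continuous (inhom P X A α f) := by
    have : inhom P X A α f = fun t =>
        scaledMean P X α f t - scaledMean P (fun ω j => A ω j * X ω j) α f t :=
      funext fun t => inhom_eq f t
    rw [this]
    exact (continuous_scaledMean hf h.measX).sub (continuous_scaledMean hf h.measAX)
  refine Integrable.mono' ((exp_neg_integrableOn_Ioi 0 hη).const_mul C) hc.aestronglyMeasurable ?_
  filter_upwards [ae_restrict_mem measurableSet_Ioi] with t ht
  exact hb t (le_of_lt ht)

/-- On a block of coordinates with equal `|A_j| ^ α_j`, the matrix `A` acts as a dilation composed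
with a change of signs. -/
theorem test_dilation_mul (hα : ∀ j, 0 < α j) {f : (Fin d → ℝ) → ℝ} {b : Finset (Fin d)}
    (hdep : ∀ x y, (∀ j ∈ b, x j = y j) → f x = f y) (g : Fin d → ℤˣ) {a : Fin d → ℝ} {u : ℝ}
    (hu : 0 < u) (hau : ∀ j ∈ b, |a j| ^ α j = u) (t : ℝ) (x : Fin d → ℝ) :
    f (signMul g (dilation α (Real.exp (-t)) fun j => a j * x j)) =
      f (signMul (g * signOf a) (dilation α (Real.exp (-(t - Real.log u))) x)) := by
  refine hdep _ _ fun j hj => ?_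
  have h1 : |a j| = u ^ (1 / α j) := by
    rw [← hau j hj, ← Real.rpow_mul (abs_nonneg _), mul_one_div_cancel (hα j).ne', Real.rpow_one]
  have h2 : Real.exp (-(t - Real.log u)) = Real.exp (-t) * u := by
    rw [show -(t - Real.log u) = -t + Real.log u by ring, Real.exp_add, Real.exp_log hu]
  simp only [signMul, dilation, Pi.mul_apply, Units.val_mul, Int.cast_mul]
  rw [h2, Real.mul_rpow (Real.exp_pos _).le hu.le, ← h1]
  nth_rewrite 1 [← signOf_mul_abs a j]
  ring

/-- Condition on A: on the block, multiplication by A is a dilation by u with signs, which shifts t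
by log u. Writing e^t = u e^{t - log u} produces the density u of the tilted law. -/
theorem renewal_equation (h : DiagonalAffine P X A B α) {f : (Fin d → ℝ) → ℝ} (hf : TailTest f)
    {b : Finset (Fin d)} (hdep : ∀ x y, (∀ j ∈ b, x j = y j) → f x = f y) {i : Fin d}
    (hb : ∀ j ∈ b, ∀ᵐ ω ∂P, coordPow α A j ω = coordPow α A i ω) (g : Fin d → ℤˣ) (t : ℝ) :
    scaledMean P X α (fun x => f (signMul g x)) t =
      ∫ ω, scaledMean P X α (fun x => f (signMul (g * signOf (A ω)) x))
        (t - Real.log (coordPow α A i ω)) ∂(tilt P (coordPow α A i)) +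
      inhom P X A α (fun x => f (signMul g x)) t := by
  have hfg := hf.comp_signMul g
  obtain ⟨F, hF⟩ := hf.bdd
  obtain ⟨δ, hδ, hf0⟩ := hf.van
  rw [inhom_eq, integral_tilt (measurable_coordPow h.measA i) (coordPow_nonneg α A i)]
  suffices hs : scaledMean P (fun ω j => A ω j * X ω j) α (fun x => f (signMul g x)) t =
      ∫ ω, coordPow α A i ω * scaledMean P X α (fun x => f (signMul (g * signOf (A ω)) x))
        (t - Real.log (coordPow α A i ω)) ∂P by
    rw [hs]; ring
  have hm : Measurable fun p : (Fin d → ℝ) × (Fin d → ℝ) =>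
      f (signMul g (dilation α (Real.exp (-t)) fun j => p.1 j * p.2 j)) := by
    refine (hfg.continuous.comp (continuous_dilation α _)).measurable.comp ?_
    exact Continuous.measurable (by fun_prop)
  have h1 := integral_indepFun h.measA h.measX h.indep hm (C := F) fun p => hF _
  simp only [scaledMean]
  rw [h1, ← integral_const_mul]
  refine integral_congr_ae ?_
  have hb' : ∀ᵐ ω ∂P, ∀ j ∈ b, coordPow α A j ω = coordPow α A i ω :=
    (ae_ball_iff b.countable_toSet).2 hb
  filter_upwards [hb'] with ω hω
  rcases (coordPow_nonneg α A i ω).eq_or_lt with hz | hp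
  -- If u = 0, all block coordinates of AX vanish, so f takes its value f(0) = 0 and both sides are
  -- 0.
  · rw [← hz, zero_mul]
    have : ∀ ω', f (signMul g (dilation α (Real.exp (-t)) fun j => A ω j * X ω' j)) = 0 := by
      intro ω'
      rw [← hf0 0 (by simpa using hδ.le)]
      refine hdep _ _ fun j hj => ?_
      have h2 := hω j hj
      rw [← hz, coordPow, Real.rpow_eq_zero (abs_nonneg _) (h.pos j).ne', abs_eq_zero] at h2
      simp [signMul, dilation, h2]
    simp [this]
  · have h2 : ∀ ω', f (signMul g (dilation α (Real.exp (-t)) fun j => A ω j * X ω' j)) =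
        f (signMul (g * signOf (A ω))
          (dilation α (Real.exp (-(t - Real.log (coordPow α A i ω)))) (X ω'))) := fun ω' =>
      test_dilation_mul h.pos hdep g hp hω t (X ω')
    simp_rw [h2]
    rw [Real.exp_sub, Real.exp_log hp]
    field_simp

/-! ### The critical tail bound -/

theorem tailTest_ramp (j : Fin d) : TailTest (fun x : Fin d → ℝ => min 1 (max 0 (|x j| - 1))) := by
  refine ⟨⟨1, ?_⟩, ⟨1, fun x => ?_⟩, 1, one_pos, fun x hx => ?_⟩
  · have h1 : LipschitzWith 1 fun x : Fin d → ℝ => |x j| - 1 := by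
      refine LipschitzWith.of_dist_le_mul fun x y => ?_
      rw [Real.dist_eq, NNReal.coe_one, one_mul, sub_sub_sub_cancel_right]
      refine (abs_abs_sub_abs_le _ _).trans ?_
      exact dist_le_pi_dist x y j
    exact (h1.const_max 0).const_min 1
  · rw [abs_of_nonneg (le_min zero_le_one (le_max_left _ _))]
    exact min_le_left _ _
  · have : |x j| ≤ 1 := (norm_le_pi_norm x j).trans hx
    rw [max_eq_left (by linarith)]
    simp

/-- Negative exponential moments of log u under the tilted law are subcritical moments of u under
the original one. The restriction on θ makes both sides vanish at u = 0. -/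
theorem exp_mul_rpow_log {u θ : ℝ} (hu : 0 ≤ u) (hθ : θ < 1) :
    u * Real.exp (-θ * Real.log u) = u ^ (1 - θ) := by
  rcases hu.eq_or_lt with rfl | hp
  · rw [zero_mul, Real.zero_rpow (by linarith)]
  · rw [Real.rpow_sub hp, Real.rpow_one, Real.rpow_def_of_pos hp, neg_mul, Real.exp_neg,
      mul_comm θ]
    rfl

/-- The tails of the coordinates at the critical exponent. -/
theorem tail_critical (h : DiagonalAffine P X A B α) (j : Fin d) : ∃ M : ℝ, 0 ≤ M ∧
    ∀ s : ℝ, 0 < s → s * P.real {ω | s < coordPow α X j ω} ≤ M := by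
  set f : (Fin d → ℝ) → ℝ := fun x => min 1 (max 0 (|x j| - 1)) with hfdef
  have hf : TailTest f := tailTest_ramp j
  have hf0 : ∀ x, 0 ≤ f x := fun x => le_min zero_le_one (le_max_left _ _)
  -- The ramp sees only |x_j|, so the signs disappear and the renewal equation is scalar.
  have hsign : ∀ g, (fun x => f (signMul g x)) = f := fun g => by
    ext x; simp only [hfdef, abs_signMul]
  have hum := measurable_coordPow (α := α) h.measA j
  have hu0 := coordPow_nonneg α A j
  have := isProbabilityMeasure_tilt hu0 (h.moment j)
  have hren : ∀ t, scaledMean P X α f t = ∫ ω, scaledMean P X α f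
      (t - Real.log (coordPow α A j ω)) ∂(tilt P (coordPow α A j)) + inhom P X A α f t := by
    intro t
    have := h.renewal_equation hf (b := {j}) (i := j)
      (fun x y hxy => by simp only [hfdef, hxy j (Finset.mem_singleton_self j)])
      (fun k hk => by rw [Finset.mem_singleton.1 hk]; simp) 1 t
    simpa only [hsign] using this
  obtain ⟨η, hη, C, hC, hbp, hbn⟩ := h.inhom_bound hf
  obtain ⟨K, hK, hKt⟩ := h.tail_of_lt_one j (β := 1 / 2) (by norm_num) (by norm_num)
  have hexp : ∀ ω, coordPow α A j ω * Real.exp (-(1 / 2) * Real.log (coordPow α A j ω)) =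
      coordPow α A j ω ^ (1 / 2 : ℝ) := fun ω => by
    rw [exp_mul_rpow_log (hu0 ω) (by norm_num)]; norm_num
  have hms : ∀ c, MeasurableSet {ω | c < coordPow α X j ω} := fun c =>
    measurableSet_lt_coordPow h.measX j c
  -- The tail exponent 1/2 and θ = 1/2 match: a tail O(s^{-1/2}) gives the a priori growth e^t
  -- e^{-t/2} = e^{θt}, and the negative moment is E u^{1/2} < 1.
  obtain ⟨M, hM⟩ := bounded_of_renewal_le (Q := tilt P (coordPow α A j)) (ψ := scaledMean P X α f)
    (θ := 1 / 2) (η := η) (K := K) (C := C) (ξ := fun ω => Real.log (coordPow α A j ω))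
    (continuous_scaledMean hf h.measX).measurable
    (fun t => mul_nonneg (Real.exp_pos _).le (integral_nonneg fun ω => hf0 _))
    (Real.measurable_log.comp hum) hη hC
    (by
      rw [integrable_tilt hum hu0]
      simp_rw [hexp]
      exact integrable_rpow_of_lt_one hum hu0 (h.moment j) (by norm_num) (by norm_num))
    (by norm_num)
    (by
      rw [integral_tilt hum hu0]
      simp_rw [hexp]
      exact integral_rpow_lt_one hum hu0 (h.moment j) (h.not_ae_eq_one j) (by norm_num)
        (by norm_num))
    (fun t => by
      have h1 : ∫ ω, f (dilation α (Real.exp (-t)) (X ω)) ∂P ≤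
          P.real {ω | Real.exp t < coordPow α X j ω} := by
        rw [← integral_indicator_one (hms _)]
        refine integral_mono (integrable_test hf h.measX _)
          ((integrable_const (1 : ℝ)).indicator (hms _)) fun ω => ?_
        by_cases hω : ω ∈ {ω | Real.exp t < coordPow α X j ω}
        · rw [Set.indicator_of_mem hω]; exact min_le_left _ _
        · rw [Set.indicator_of_notMem hω]
          have h2 : ¬ (1 < |dilation α (Real.exp (-t)) (X ω) j|) := by
            rw [lt_abs_dilation_iff (h.pos j) zero_le_one, Real.one_rpow, one_mul]; exact hω
          simp only [hfdef]
          rw [max_eq_left (by linarith)]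
          simp
      have h2 := h1.trans (hKt _ (Real.exp_pos t))
      have h3 := mul_le_mul_of_nonneg_left h2 (Real.exp_pos t).le
      refine h3.trans (le_of_eq ?_)
      rw [← Real.exp_mul, mul_left_comm, ← Real.exp_add]
      congr 2; ring)
    (fun t ht => by
      rw [hren t]
      linarith [le_abs_self (inhom P X A α f t), hbp t ht])
    (fun t ht => by
      have : Real.exp t ≤ Real.exp (1 / 2 * t) := Real.exp_le_exp.2 (by linarith)
      rw [hren t]
      linarith [le_abs_self (inhom P X A α f t), hbn t, mul_le_mul_of_nonneg_left this hC])
  have hp2 : 0 < (2 : ℝ) ^ α j := Real.rpow_pos_of_pos two_pos _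
  -- The ramp equals 1 where |x_j| > 2, which accounts for the factor 2^{α_j}.
  have hlow : ∀ t, Real.exp t * P.real {ω | 2 ^ α j * Real.exp t < coordPow α X j ω} ≤ M := by
    intro t
    refine le_trans (mul_le_mul_of_nonneg_left ?_ (Real.exp_pos t).le) (hM t)
    rw [← integral_indicator_one (hms _)]
    refine integral_mono ((integrable_const (1 : ℝ)).indicator (hms _))
      (integrable_test hf h.measX _) fun ω => ?_
    by_cases hω : ω ∈ {ω | 2 ^ α j * Real.exp t < coordPow α X j ω}
    · rw [Set.indicator_of_mem hω]
      have h2 : 2 < |dilation α (Real.exp (-t)) (X ω) j| := by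
        rw [lt_abs_dilation_iff (h.pos j) zero_le_two]; exact hω
      simp only [hfdef, Pi.one_apply]
      exact le_min le_rfl (le_max_of_le_right (by linarith))
    · rw [Set.indicator_of_notMem hω]
      exact hf0 _
  refine ⟨2 ^ α j * max M 0, by positivity, fun s hs => ?_⟩
  have h1 := hlow (Real.log (s / 2 ^ α j))
  rw [Real.exp_log (by positivity), mul_div_cancel₀ _ hp2.ne', div_mul_eq_mul_div,
    div_le_iff₀ hp2] at h1
  nlinarith [le_max_left M 0]

end DiagonalAffine

/-! ### Convergence for test functions depending on one block of coordinates -/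

/-- The displacement of y is at most ρ‖y‖, so the Lipschitz bound serves only for ‖y‖ ≤ R; beyond R
use 2F. For ‖y‖ ≤ δ/2 the condition ρ ≤ 1 keeps the rescaled point where f vanishes. -/
theorem test_scaling_le {d : ℕ} {f : (Fin d → ℝ) → ℝ} {L : NNReal} (hL : LipschitzWith L f) {F : ℝ}
    (hF : ∀ x, |f x| ≤ F) {δ : ℝ} (hδ : 0 < δ) (hf0 : ∀ x, ‖x‖ ≤ δ → f x = 0) {ρ R : ℝ}
    (hρ : 0 ≤ ρ) (hρ1 : ρ ≤ 1) (hR : 0 ≤ R) {a : Fin d → ℝ} (ha : ∀ j, |a j - 1| ≤ ρ)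
    (y : Fin d → ℝ) :
    |f (fun j => a j * y j) - f y| ≤ L * ρ * R * ∑ j, (if δ / 2 < |y j| then (1 : ℝ) else 0) +
      2 * F * ∑ j, (if R < |y j| then (1 : ℝ) else 0) := by
  have hF0 : 0 ≤ F := (abs_nonneg _).trans (hF 0)
  have n : ∀ (c : ℝ) j, (0 : ℝ) ≤ if c < |y j| then (1 : ℝ) else 0 := fun c j => by
    split_ifs <;> norm_num
  have s : ∀ c : ℝ, (0 : ℝ) ≤ ∑ j, if c < |y j| then (1 : ℝ) else 0 := fun c =>
    Finset.sum_nonneg fun j _ => n c j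
  have one : ∀ c : ℝ, 0 ≤ c → c < ‖y‖ → (1 : ℝ) ≤ ∑ j, if c < |y j| then (1 : ℝ) else 0 := by
    intro c hc hy
    obtain ⟨j, hj⟩ := exists_lt_abs_of_lt_norm hc hy
    have := Finset.single_le_sum (f := fun j => if c < |y j| then (1 : ℝ) else 0)
      (fun j _ => n c j) (Finset.mem_univ j)
    simpa [hj] using this
  have p1 : 0 ≤ L * ρ * R * ∑ j, (if δ / 2 < |y j| then (1 : ℝ) else 0) :=
    mul_nonneg (by positivity) (s _)
  have p2 : 0 ≤ 2 * F * ∑ j, (if R < |y j| then (1 : ℝ) else 0) := mul_nonneg (by positivity) (s _)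
  have hdist : ‖(fun j => a j * y j) - y‖ ≤ ρ * ‖y‖ := by
    refine (pi_norm_le_iff_of_nonneg (by positivity)).2 fun j => ?_
    rw [Pi.sub_apply, show a j * y j - y j = (a j - 1) * y j by ring, norm_mul]
    exact mul_le_mul (ha j) (norm_le_pi_norm y j) (norm_nonneg _) hρ
  rcases le_or_gt ‖y‖ (δ / 2) with hy | hy
  · have h1 : ‖(fun j => a j * y j)‖ ≤ δ := by
      have := norm_le_norm_add_norm_sub' (fun j => a j * y j) y
      nlinarith [norm_nonneg y]
    rw [hf0 _ h1, hf0 y (by linarith)]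
    simp only [sub_self, abs_zero]
    linarith
  · rcases le_or_gt ‖y‖ R with hyR | hyR
    · have h1 := one _ (by linarith) hy
      have h2 : |f (fun j => a j * y j) - f y| ≤ L * ρ * R := by
        have := hL.dist_le_mul (fun j => a j * y j) y
        rw [Real.dist_eq, dist_eq_norm] at this
        refine this.trans ?_
        rw [mul_assoc]
        refine mul_le_mul_of_nonneg_left (hdist.trans ?_) L.2
        exact mul_le_mul_of_nonneg_left hyR hρ
      have h3 := mul_le_mul_of_nonneg_left h1 (show 0 ≤ L * ρ * R by positivity)
      linarith
    · have h1 := one _ hR hyR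
      have h2 : |f (fun j => a j * y j) - f y| ≤ 2 * F :=
        (abs_sub _ _).trans (by linarith [hF y, hF (fun j => a j * y j)])
      nlinarith

namespace DiagonalAffine

variable {Ω : Type*} [MeasurableSpace Ω] {P : Measure Ω} {d : ℕ} {X A B : Ω → Fin d → ℝ}
  {α : Fin d → ℝ} [IsProbabilityMeasure P]

/-- Uniform bounds for the scaled tails, with decay in the level. -/
theorem exists_tail_sum_bound (h : DiagonalAffine P X A B α) : ∃ T : ℝ → ℝ,
    Tendsto T atTop (𝓝 0) ∧ ∀ c, 0 < c → 0 ≤ T c ∧ ∀ t,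
      Real.exp t * ∑ j, P.real {ω | c ^ α j * Real.exp t < coordPow α X j ω} ≤ T c := by
  choose M hM hMt using h.tail_critical
  refine ⟨fun c => ∑ j, M j * c ^ (-α j), ?_, fun c hc => ⟨?_, fun t => ?_⟩⟩
  · have := tendsto_finsetSum (Finset.univ : Finset (Fin d)) fun j _ =>
      (tendsto_rpow_neg_atTop (h.pos j)).const_mul (M j)
    simpa using this
  · exact Finset.sum_nonneg fun j _ => mul_nonneg (hM j) (Real.rpow_nonneg hc.le _)
  · rw [Finset.mul_sum]
    refine Finset.sum_le_sum fun j _ => ?_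
    have hp : 0 < c ^ α j := Real.rpow_pos_of_pos hc _
    have h1 := hMt j (c ^ α j * Real.exp t) (by positivity)
    rw [Real.rpow_neg hc.le, ← div_eq_mul_inv, le_div_iff₀ hp]
    linarith

theorem abs_scaledMean_le (h : DiagonalAffine P X A B α) {f : (Fin d → ℝ) → ℝ}
    (hf : TailTest f) : ∃ K, ∀ t, |scaledMean P X α f t| ≤ K := by
  obtain ⟨F, hF⟩ := hf.bdd
  obtain ⟨δ, hδ, hf0⟩ := hf.van
  have hF0 : 0 ≤ F := (abs_nonneg _).trans (hF 0)
  obtain ⟨T, -, hT⟩ := h.exists_tail_sum_bound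
  refine ⟨F * T δ, fun t => ?_⟩
  obtain ⟨i1, e1⟩ := integral_ite_lt_dilation (P := P) h.pos h.measX hδ.le t
  have h1 : |∫ ω, f (dilation α (Real.exp (-t)) (X ω)) ∂P| ≤
      F * ∑ j, P.real {ω | δ ^ α j * Real.exp t < coordPow α X j ω} := by
    rw [← e1, ← integral_const_mul, ← Real.norm_eq_abs]
    refine norm_integral_le_of_norm_le (i1.const_mul _) (ae_of_all _ fun ω => ?_)
    have n : ∀ j, (0 : ℝ) ≤ if δ < |dilation α (Real.exp (-t)) (X ω) j| then (1 : ℝ) else 0 :=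
      fun j => by split_ifs <;> norm_num
    rcases le_or_gt ‖dilation α (Real.exp (-t)) (X ω)‖ δ with hy | hy
    · rw [hf0 _ hy, norm_zero]
      exact mul_nonneg hF0 (Finset.sum_nonneg fun j _ => n j)
    · obtain ⟨j, hj⟩ := exists_lt_abs_of_lt_norm hδ.le hy
      have h2 := Finset.single_le_sum
        (f := fun j => if δ < |dilation α (Real.exp (-t)) (X ω) j| then (1 : ℝ) else 0)
        (fun j _ => n j) (Finset.mem_univ j)
      simp only [hj, if_true] at h2
      refine (hF _).trans ?_
      nlinarith
  rw [scaledMean, abs_mul, abs_of_pos (Real.exp_pos t)]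
  have h3 := mul_le_mul_of_nonneg_left h1 (Real.exp_pos t).le
  have h4 := mul_le_mul_of_nonneg_left ((hT δ hδ).2 t) hF0
  linarith

theorem dilation_exp_shift (t t' : ℝ) (x : Fin d → ℝ) :
    dilation α (Real.exp (-t)) x =
      fun j => Real.exp ((t' - t) / α j) * dilation α (Real.exp (-t')) x j := by
  ext j
  simp only [dilation, ← Real.exp_mul]
  rw [← mul_assoc, ← Real.exp_add]
  congr 2; ring

/-- A shift of t changes the prefactor e^t and rescales each coordinate by a factor near 1. The
critical tail bounds control both effects uniformly in t: first R makes the far tail small, then ρ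
is chosen. -/
theorem uniformContinuous_scaledMean (h : DiagonalAffine P X A B α) {f : (Fin d → ℝ) → ℝ}
    (hf : TailTest f) : UniformContinuous (scaledMean P X α f) := by
  obtain ⟨L, hL⟩ := hf.lip
  obtain ⟨F, hF⟩ := hf.bdd
  obtain ⟨δ, hδ, hf0⟩ := hf.van
  have hF0 : 0 ≤ F := (abs_nonneg _).trans (hF 0)
  obtain ⟨T, hT0, hT⟩ := h.exists_tail_sum_bound
  obtain ⟨K, hK⟩ := h.abs_scaledMean_le hf
  have hK0 : 0 ≤ K := (abs_nonneg _).trans (hK 0)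
  rw [Metric.uniformContinuous_iff]
  intro e he
  obtain ⟨R, hR1, hR⟩ : ∃ R, 0 < R ∧ 2 * F * T R < e / 3 := by
    have h1 := hT0.const_mul (2 * F)
    rw [mul_zero] at h1
    obtain ⟨R, h2, h3⟩ := ((h1.eventually (gt_mem_nhds (show 0 < e / 3 by positivity))).and
      (eventually_gt_atTop 0)).exists
    exact ⟨R, h3, h2⟩
  have hTd := (hT (δ / 2) (by linarith)).1
  obtain ⟨ρ, hρ0, hρ1, hρ⟩ : ∃ ρ : ℝ, 0 < ρ ∧ ρ ≤ 1 ∧ L * ρ * R * T (δ / 2) < e / 3 := by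
    set Z := (L : ℝ) * R * T (δ / 2) + 1 with hZ
    have hZ0 : 0 < Z := by positivity
    refine ⟨min 1 (e / 3 / Z), by positivity, min_le_left _ _, ?_⟩
    have h1 : min 1 (e / 3 / Z) * Z ≤ e / 3 := by
      rw [← le_div_iff₀ hZ0]; exact min_le_right _ _
    have h2 : 0 < min 1 (e / 3 / Z) := by positivity
    have h3 : min 1 (e / 3 / Z) * Z =
      L * min 1 (e / 3 / Z) * R * T (δ / 2) + min 1 (e / 3 / Z) := by rw [hZ]; ring
    linarith
  have c1 : ∀ᶠ x : ℝ in 𝓝 0, |1 - Real.exp x| * K < e / 3 := by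
    have : Tendsto (fun x : ℝ => |1 - Real.exp x| * K) (𝓝 0) (𝓝 (|1 - Real.exp 0| * K)) :=
      Continuous.tendsto (by fun_prop) 0
    refine this.eventually (gt_mem_nhds ?_)
    simp; positivity
  have c2 : ∀ᶠ x : ℝ in 𝓝 0, ∀ j, |Real.exp (x / α j) - 1| ≤ ρ := by
    refine eventually_all.2 fun j => ?_
    have : Tendsto (fun x : ℝ => |Real.exp (x / α j) - 1|) (𝓝 0) (𝓝 (|Real.exp (0 / α j) - 1|)) :=
      Continuous.tendsto (by fun_prop) 0
    refine this.eventually (ge_mem_nhds ?_)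
    simpa using hρ0
  obtain ⟨η, hη, hη'⟩ := Metric.eventually_nhds_iff.1 (c1.and c2)
  refine ⟨η, hη, fun {t t'} htt => ?_⟩
  have hx := hη' (y := t' - t) (by rw [Real.dist_eq, sub_zero, abs_sub_comm]; exact htt)
  obtain ⟨i1, e1⟩ := integral_ite_lt_dilation (P := P) h.pos h.measX
    (show 0 ≤ δ / 2 by linarith) t'
  obtain ⟨i2, e2⟩ := integral_ite_lt_dilation (P := P) h.pos h.measX hR1.le t'
  have h1 : |∫ ω, f (dilation α (Real.exp (-t)) (X ω)) ∂P -
      ∫ ω, f (dilation α (Real.exp (-t')) (X ω)) ∂P| ≤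
      L * ρ * R * ∑ j, P.real {ω | (δ / 2) ^ α j * Real.exp t' < coordPow α X j ω} +
      2 * F * ∑ j, P.real {ω | R ^ α j * Real.exp t' < coordPow α X j ω} := by
    rw [← e1, ← e2, ← integral_const_mul, ← integral_const_mul,
      ← integral_add (i1.const_mul _) (i2.const_mul _), ← integral_sub
      (integrable_test hf h.measX _) (integrable_test hf h.measX _), ← Real.norm_eq_abs]
    refine norm_integral_le_of_norm_le ((i1.const_mul _).add (i2.const_mul _))
      (ae_of_all _ fun ω => ?_)
    rw [dilation_exp_shift t t']
    exact test_scaling_le hL hF hδ hf0 hρ0.le hρ1 hR1.le hx.2 _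
  have h2 : scaledMean P X α f t - scaledMean P X α f t' =
      (1 - Real.exp (t' - t)) * scaledMean P X α f t +
      Real.exp t' * (∫ ω, f (dilation α (Real.exp (-t)) (X ω)) ∂P -
      ∫ ω, f (dilation α (Real.exp (-t')) (X ω)) ∂P) := by
    have : Real.exp t' = Real.exp (t' - t) * Real.exp t := by rw [← Real.exp_add]; congr 1; ring
    simp only [scaledMean]
    rw [this]; ring
  rw [Real.dist_eq, h2]
  refine (abs_add_le _ _).trans_lt ?_
  rw [abs_mul, abs_mul, abs_of_pos (Real.exp_pos t')]
  have h3 := mul_le_mul_of_nonneg_left (hK t) (abs_nonneg (1 - Real.exp (t' - t)))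
  have h4 := mul_le_mul_of_nonneg_left h1 (Real.exp_pos t').le
  have h5 := mul_le_mul_of_nonneg_left ((hT (δ / 2) (by linarith)).2 t')
    (show 0 ≤ L * ρ * R by positivity)
  have h6 := mul_le_mul_of_nonneg_left ((hT R hR1).2 t') (show 0 ≤ 2 * F by positivity)
  have := hx.1
  linarith

theorem measurable_signOf_comp (hA : Measurable A) :
    @Measurable Ω (Fin d → ℤˣ) _ ⊤ (fun ω => signOf (A ω)) := by
  have h1 : ∀ g : Fin d → ℤˣ, MeasurableSet {ω | signOf (A ω) = g} := by
    intro g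
    have : {ω | signOf (A ω) = g} = ⋂ j, {ω | signOf (A ω) j = g j} := by
      ext ω; simp [funext_iff]
    rw [this]
    refine MeasurableSet.iInter fun j => ?_
    have hm : MeasurableSet {ω | A ω j < 0} :=
      measurableSet_lt ((measurable_pi_apply j).comp hA) measurable_const
    by_cases hg : g j = -1
    · have : {ω | signOf (A ω) j = g j} = {ω | A ω j < 0} := by
        ext ω
        simp only [signOf, hg, Set.mem_ofPred_eq]
        split_ifs with hlt <;> simp [hlt]
      rw [this]; exact hm
    · have hg1 : g j = 1 := (Int.units_eq_one_or (g j)).resolve_right hg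
      have : {ω | signOf (A ω) j = g j} = {ω | A ω j < 0}ᶜ := by
        ext ω
        simp only [signOf, hg1, Set.mem_ofPred_eq, Set.mem_compl_iff]
        split_ifs with hlt <;> simp [hlt]
      rw [this]; exact hm.compl
  intro S _
  have : (fun ω => signOf (A ω)) ⁻¹' S = ⋃ g ∈ S, {ω | signOf (A ω) = g} := by
    ext ω; simp
  rw [this]
  exact MeasurableSet.biUnion S.to_countable fun g _ => h1 g

/-- Scaled expectations of a test function that depends only on a block of coordinates converge. -/
theorem tendsto_scaledMean_of_block (h : DiagonalAffine P X A B α) {f : (Fin d → ℝ) → ℝ}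
    (hf : TailTest f) {b : Finset (Fin d)} (hdep : ∀ x y, (∀ j ∈ b, x j = y j) → f x = f y)
    {i : Fin d} (hb : ∀ j ∈ b, ∀ᵐ ω ∂P, coordPow α A j ω = coordPow α A i ω) :
    ∃ l, Tendsto (scaledMean P X α f) atTop (𝓝 l) := by
  let _ : MeasurableSpace (Fin d → ℤˣ) := ⊤
  have hum := measurable_coordPow (α := α) h.measA i
  have hu0 := coordPow_nonneg α A i
  have := isProbabilityMeasure_tilt hu0 (h.moment i)
  choose K hK using fun g => h.abs_scaledMean_le (hf.comp_signMul g)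
  -- All sign changes of f are treated as one vector-valued solution; the component at the identity
  -- is the desired one.
  have h1 := tendsto_of_renewal (Q := tilt P (coordPow α A i)) (G := Fin d → ℤˣ)
    (Ψ := fun g => scaledMean P X α fun x => f (signMul g x))
    (r := fun g => inhom P X A α fun x => f (signMul g x))
    (C := ∑ g, |K g|)
    (ξ := fun ω => Real.log (coordPow α A i ω)) (ε := fun ω => signOf (A ω))
    (fun g => funext fun j => Int.units_mul_self (g j))
    (fun g => h.uniformContinuous_scaledMean (hf.comp_signMul g))
    (fun g t => ((hK g t).trans (le_abs_self _)).trans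
      (Finset.single_le_sum (f := fun g => |K g|) (fun g _ => abs_nonneg _) (Finset.mem_univ g)))
    (Real.measurable_log.comp hum)
    ((integrable_tilt hum hu0 _).2 (h.logMoment i))
    (by
      rw [integral_tilt hum hu0]
      exact (integral_mul_log_pos hu0 (h.moment i) (h.not_ae_eq_one i) (h.logMoment i)).ne')
    (measurable_signOf_comp h.measA)
    (fun ⟨c, hc, hae⟩ => h.nonarith i ⟨c, hc, by
      rw [ae_tilt hum hu0] at hae
      filter_upwards [hae] with ω hω hA
      refine hω ?_
      simpa [coordPow, Real.rpow_eq_zero (abs_nonneg _) (h.pos i).ne'] using hA⟩)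
    (fun g => h.integrableOn_inhom (hf.comp_signMul g))
    (fun g t => h.renewal_equation hf hdep hb g t) 1
  have h2 : (fun x => f (signMul 1 x)) = f := by
    ext x; congr 1; ext j; simp [signMul]
  rwa [h2] at h1

end DiagonalAffine

/-! ### Asymptotic independence of different blocks -/

section
variable {Ω : Type*} [MeasurableSpace Ω] {P : Measure Ω}

/-- The mean of the geometric mean of two normalized weights is strictly smaller than
`1` unless they coincide. -/
theorem integral_sqrt_mul_lt_one {u v : Ω → ℝ} (hu : Measurable u) (hv : Measurable v)
    (hu0 : ∀ ω, 0 ≤ u ω) (hv0 : ∀ ω, 0 ≤ v ω) (hu1 : ∫ ω, u ω ∂P = 1) (hv1 : ∫ ω, v ω ∂P = 1)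
    (hne : ¬ ∀ᵐ ω ∂P, u ω = v ω) :
    Integrable (fun ω => Real.sqrt (u ω * v ω)) P ∧ ∫ ω, Real.sqrt (u ω * v ω) ∂P < 1 := by
  have hui := integrable_of_integral_eq_one hu1
  have hvi := integrable_of_integral_eq_one hv1
  have hgi : Integrable (fun ω => (u ω + v ω) / 2) P := (hui.add hvi).div_const 2
  have hle : ∀ ω, Real.sqrt (u ω * v ω) ≤ (u ω + v ω) / 2 := fun ω => by
    rw [Real.sqrt_mul (hu0 ω)]
    nlinarith [sq_nonneg (Real.sqrt (u ω) - Real.sqrt (v ω)), Real.sq_sqrt (hu0 ω),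
      Real.sq_sqrt (hv0 ω)]
  have hsi : Integrable (fun ω => Real.sqrt (u ω * v ω)) P := by
    refine hgi.mono' (Real.continuous_sqrt.measurable.comp (hu.mul hv)).aestronglyMeasurable
      (ae_of_all _ fun ω => ?_)
    rw [Real.norm_of_nonneg (Real.sqrt_nonneg _)]
    exact hle ω
  refine ⟨hsi, ?_⟩
  have h1 : ∫ ω, (u ω + v ω) / 2 ∂P = 1 := by
    rw [integral_div, integral_add hui hvi, hu1, hv1]; norm_num
  rw [← h1]
  refine lt_of_le_of_ne (integral_mono hsi hgi hle) fun he => hne ?_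
  filter_upwards [(integral_eq_iff_of_ae_le hsi hgi (ae_of_all _ hle)).1 he] with ω hω
  have h2 : (u ω + v ω) ^ 2 = 4 * (u ω * v ω) := by
    have := Real.sq_sqrt (mul_nonneg (hu0 ω) (hv0 ω))
    rw [hω] at this
    linarith
  have h3 : (u ω - v ω) ^ 2 = 0 := by linarith
  exact sub_eq_zero.1 (pow_eq_zero_iff two_ne_zero |>.1 h3)

/-- The minimum of two numbers is at most their geometric mean. -/
theorem measureReal_and_le_sqrt [IsProbabilityMeasure P] (p q : Ω → Prop) :
    P.real {ω | p ω ∧ q ω} ≤ Real.sqrt (P.real {ω | p ω}) * Real.sqrt (P.real {ω | q ω}) := by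
  have h1 : P.real {ω | p ω ∧ q ω} ≤ P.real {ω | p ω} := measureReal_mono fun ω hω => hω.1
  have h2 : P.real {ω | p ω ∧ q ω} ≤ P.real {ω | q ω} := measureReal_mono fun ω hω => hω.2
  rw [← Real.sqrt_mul measureReal_nonneg]
  refine Real.le_sqrt_of_sq_le ?_
  rw [sq]
  exact mul_le_mul h1 h2 measureReal_nonneg measureReal_nonneg

end

namespace DiagonalAffine

variable {Ω : Type*} [MeasurableSpace Ω] {P : Measure Ω} {d : ℕ} {X A B : Ω → Fin d → ℝ}
  {α : Fin d → ℝ}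

/-- The normalized joint tail of two coordinates. -/
noncomputable def jointTail (P : Measure Ω) (X : Ω → Fin d → ℝ) (α : Fin d → ℝ) (i j : Fin d)
    (p : ℝ × ℝ) : ℝ :=
  Real.sqrt (p.1 * p.2) * P.real {ω | p.1 < coordPow α X i ω ∧ p.2 < coordPow α X j ω}

theorem jointTail_nonneg (i j : Fin d) (p : ℝ × ℝ) : 0 ≤ jointTail P X α i j p :=
  mul_nonneg (Real.sqrt_nonneg _) measureReal_nonneg

theorem tendsto_sqrt_tailB (h : DiagonalAffine P X A B α) (j : Fin d) {c : ℝ} (hc : 0 < c) :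
    Tendsto (fun x : ℝ => Real.sqrt (x * P.real {ω | c * x < coordPow α B j ω})) atTop (𝓝 0) := by
  obtain ⟨τ, hτ, C, hC, hB⟩ := h.tailB j
  have h1 : Tendsto (fun x : ℝ => C * c ^ (-(1 + τ)) * x ^ (-τ)) atTop
      (𝓝 (C * c ^ (-(1 + τ)) * 0)) := (tendsto_rpow_neg_atTop hτ).const_mul _
  rw [mul_zero] at h1
  have h2 : Tendsto (fun x : ℝ => x * P.real {ω | c * x < coordPow α B j ω}) atTop (𝓝 0) := by
    refine tendsto_of_tendsto_of_tendsto_of_le_of_le' tendsto_const_nhds h1 ?_ ?_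
    · filter_upwards [eventually_gt_atTop 0] with x hx
      exact mul_nonneg hx.le measureReal_nonneg
    · filter_upwards [eventually_gt_atTop 0] with x hx
      refine (mul_le_mul_of_nonneg_left (hB _ (mul_pos hc hx)) hx.le).trans (le_of_eq ?_)
      rw [Real.mul_rpow hc.le hx.le, show -τ = 1 + -(1 + τ) by ring, Real.rpow_add hx,
        Real.rpow_one]
      ring
  simpa using h2.sqrt

variable [IsProbabilityMeasure P]

theorem measurable_jointTail (hX : Measurable X) (i j : Fin d) :
    Measurable (jointTail P X α i j) := by
  refine (Real.continuous_sqrt.measurable.comp (measurable_fst.mul measurable_snd)).mul ?_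
  have hm : MeasurableSet {q : (ℝ × ℝ) × Ω |
      q.1.1 < coordPow α X i q.2 ∧ q.1.2 < coordPow α X j q.2} :=
    (measurableSet_lt (measurable_fst.comp measurable_fst)
      ((measurable_coordPow hX i).comp measurable_snd)).inter
    (measurableSet_lt (measurable_snd.comp measurable_fst)
      ((measurable_coordPow hX j).comp measurable_snd))
  exact (measurable_measure_prodMk_left hm).ennreal_toReal

/-- Each normalized marginal tail is bounded at the critical exponent. Zero arguments are included
because division by a vanishing multiplier returns 0; K is positive so that the contraction can
start from it. -/
theorem jointTail_le (h : DiagonalAffine P X A B α) (i j : Fin d) :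
    ∃ K : ℝ, 0 < K ∧ ∀ p : ℝ × ℝ, 0 ≤ p.1 → 0 ≤ p.2 → jointTail P X α i j p ≤ K := by
  obtain ⟨M, hM, hMt⟩ := h.tail_critical i
  obtain ⟨M', hM', hMt'⟩ := h.tail_critical j
  have key : ∀ p : ℝ × ℝ, 0 < p.1 → 0 < p.2 →
      jointTail P X α i j p ≤ Real.sqrt M * Real.sqrt M' := by
    intro p h1 h2
    have e1 := measureReal_and_le_sqrt (P := P) (fun ω => p.1 < coordPow α X i ω)
      (fun ω => p.2 < coordPow α X j ω)
    rw [jointTail, Real.sqrt_mul h1.le]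
    have e2 := Real.sqrt_le_sqrt (hMt p.1 h1)
    have e3 := Real.sqrt_le_sqrt (hMt' p.2 h2)
    rw [Real.sqrt_mul h1.le] at e2
    rw [Real.sqrt_mul h2.le] at e3
    calc _ ≤ Real.sqrt p.1 * Real.sqrt p.2 * (Real.sqrt (P.real {ω | p.1 < coordPow α X i ω}) *
          Real.sqrt (P.real {ω | p.2 < coordPow α X j ω})) :=
            mul_le_mul_of_nonneg_left e1 (by positivity)
      _ = (Real.sqrt p.1 * Real.sqrt (P.real {ω | p.1 < coordPow α X i ω})) *
          (Real.sqrt p.2 * Real.sqrt (P.real {ω | p.2 < coordPow α X j ω})) := by ring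
      _ ≤ _ := mul_le_mul e2 e3 (by positivity) (by positivity)
  have hK : 0 < Real.sqrt M * Real.sqrt M' + 1 := by positivity
  refine ⟨Real.sqrt M * Real.sqrt M' + 1, hK, fun p h1 h2 => ?_⟩
  rcases h1.eq_or_lt with h0 | h1
  · rw [jointTail, ← h0, zero_mul, Real.sqrt_zero, zero_mul]; exact hK.le
  rcases h2.eq_or_lt with h0 | h2
  · rw [jointTail, ← h0, mul_zero, Real.sqrt_zero, zero_mul]; exact hK.le
  linarith [key p h1 h2]

theorem sqrt_mul_and_le {x y : ℝ} (hx : 0 ≤ x) (hy : 0 ≤ y) (p q : Ω → Prop) :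
    Real.sqrt (x * y) * P.real {ω | p ω ∧ q ω} ≤
      Real.sqrt (x * P.real {ω | p ω}) * Real.sqrt (y * P.real {ω | q ω}) := by
  rw [Real.sqrt_mul hx, Real.sqrt_mul hx, Real.sqrt_mul hy]
  refine (mul_le_mul_of_nonneg_left (measureReal_and_le_sqrt p q) (by positivity)).trans
    (le_of_eq ?_)
  ring

/-- A joint exceedance of AX + B comes from a joint exceedance of AX at slightly lower levels or
from a large entry of B. The geometric mean bound splits the latter into a vanishing factor for B
and a bounded tail. -/
theorem jointTail_recursion (h : DiagonalAffine P X A B α) (i j : Fin d) {c : ℝ} (hc : 0 < c)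
    (hc1 : c < 1) {x y : ℝ} (hx : 0 < x) (hy : 0 < y) :
    jointTail P X α i j (x, y) ≤
      Real.sqrt (x * y) * P.real {ω |
        (1 - c) ^ α i * x < coordPow α A i ω * coordPow α X i ω ∧
        (1 - c) ^ α j * y < coordPow α A j ω * coordPow α X j ω} +
      Real.sqrt (x * P.real {ω | c ^ α i * x < coordPow α B i ω}) *
        Real.sqrt (y * P.real {ω | y < coordPow α X j ω}) +
      Real.sqrt (x * P.real {ω | x < coordPow α X i ω}) *
        Real.sqrt (y * P.real {ω | c ^ α j * y < coordPow α B j ω}) := by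
  have hS : ∀ k s, MeasurableSet {z : Fin d → ℝ | s < |z k| ^ α k} := fun k s =>
    measurableSet_lt measurable_const (measurable_abs_apply_rpow k _)
  have l1 := h.measureReal_law ((hS i x).inter (hS j y))
  have l2 := h.measureReal_law (hS i x)
  have l3 := h.measureReal_law (hS j y)
  simp only [Set.mem_inter_iff, Set.mem_ofPred_eq] at l1 l2 l3
  change Real.sqrt (x * y) * P.real {ω | x < |X ω i| ^ α i ∧ y < |X ω j| ^ α j} ≤ _ +
    _ * Real.sqrt (y * P.real {ω | y < |X ω j| ^ α j}) +
    Real.sqrt (x * P.real {ω | x < |X ω i| ^ α i}) * _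
  rw [l1, l2, l3]
  set q1 : Ω → Prop := fun ω => (1 - c) ^ α i * x < coordPow α A i ω * coordPow α X i ω ∧
        (1 - c) ^ α j * y < coordPow α A j ω * coordPow α X j ω
  have hsub : P.real {ω | x < |A ω i * X ω i + B ω i| ^ α i ∧
      y < |A ω j * X ω j + B ω j| ^ α j} ≤ P.real {ω | q1 ω} +
      P.real {ω | c ^ α i * x < coordPow α B i ω ∧ y < |A ω j * X ω j + B ω j| ^ α j} +
      P.real {ω | x < |A ω i * X ω i + B ω i| ^ α i ∧ c ^ α j * y < coordPow α B j ω} := by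
    refine (measureReal_mono ?_).trans ((measureReal_union_le _ _).trans
      (add_le_add_left (measureReal_union_le _ _) _))
    rintro ω ⟨h1, h2⟩
    rcases lt_rpow_abs_add hc hc1 (h.pos i) hx h1 with h3 | h3
    · rcases lt_rpow_abs_add hc hc1 (h.pos j) hy h2 with h4 | h4
      · refine Or.inl (Or.inl ⟨?_, ?_⟩)
        · rwa [abs_mul, Real.mul_rpow (abs_nonneg _) (abs_nonneg _)] at h3
        · rwa [abs_mul, Real.mul_rpow (abs_nonneg _) (abs_nonneg _)] at h4
      · exact Or.inr ⟨h1, h4⟩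
    · exact Or.inl (Or.inr ⟨h3, h2⟩)
  refine (mul_le_mul_of_nonneg_left hsub (Real.sqrt_nonneg _)).trans ?_
  rw [mul_add, mul_add]
  exact add_le_add (add_le_add le_rfl (sqrt_mul_and_le hx.le hy.le _ _))
    (sqrt_mul_and_le hx.le hy.le _ _)

/-- Conditioning on A divides the two thresholds by u_i and u_j, and renormalizing √(xy) accordingly
leaves the weight √(u_i u_j). When a multiplier is 0 both sides vanish. -/
theorem integral_jointTail (h : DiagonalAffine P X A B α) (i j : Fin d) {a b : ℝ} (ha : 0 < a)
    (hb : 0 < b) {x y : ℝ} (hx : 0 < x) (hy : 0 < y) :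
    Real.sqrt (x * y) * P.real {ω | a * x < coordPow α A i ω * coordPow α X i ω ∧
        b * y < coordPow α A j ω * coordPow α X j ω} =
      (Real.sqrt (a * b))⁻¹ * ∫ ω, Real.sqrt (coordPow α A i ω * coordPow α A j ω) *
        jointTail P X α i j (a * x / coordPow α A i ω, b * y / coordPow α A j ω) ∂P := by
  have hS : MeasurableSet {p : (Fin d → ℝ) × (Fin d → ℝ) |
      a * x < |p.1 i| ^ α i * |p.2 i| ^ α i ∧ b * y < |p.1 j| ^ α j * |p.2 j| ^ α j} :=
    (measurableSet_lt measurable_const (((measurable_abs_apply_rpow i _).comp measurable_fst).mul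
      ((measurable_abs_apply_rpow i _).comp measurable_snd))).inter
    (measurableSet_lt measurable_const (((measurable_abs_apply_rpow j _).comp measurable_fst).mul
      ((measurable_abs_apply_rpow j _).comp measurable_snd)))
  have h1 := measureReal_indepFun h.measA h.measX h.indep hS
  simp only [Set.mem_ofPred_eq] at h1
  have h2 : P.real {ω | a * x < coordPow α A i ω * coordPow α X i ω ∧
      b * y < coordPow α A j ω * coordPow α X j ω} = _ := h1
  rw [h2, ← integral_const_mul, ← integral_const_mul]
  refine integral_congr_ae (ae_of_all _ fun ω => ?_)
  change Real.sqrt (x * y) * P.real {ω' | a * x < coordPow α A i ω * coordPow α X i ω' ∧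
      b * y < coordPow α A j ω * coordPow α X j ω'} =
    (Real.sqrt (a * b))⁻¹ * (Real.sqrt (coordPow α A i ω * coordPow α A j ω) *
      jointTail P X α i j (a * x / coordPow α A i ω, b * y / coordPow α A j ω))
  have hui := coordPow_nonneg α A i ω
  have huj := coordPow_nonneg α A j ω
  generalize coordPow α A i ω = u at *
  generalize coordPow α A j ω = v at *
  rcases hui.eq_or_lt with rfl | hu
  · have : {ω' | a * x < 0 * coordPow α X i ω' ∧ b * y < v * coordPow α X j ω'} = ∅ := by
      ext ω'
      simp only [zero_mul, Set.mem_ofPred_eq, Set.mem_empty_iff_false, iff_false, not_and]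
      intro h3
      exact absurd h3 (by have := mul_pos ha hx; linarith)
    rw [this]; simp
  rcases huj.eq_or_lt with rfl | hv
  · have : {ω' | a * x < u * coordPow α X i ω' ∧ b * y < 0 * coordPow α X j ω'} = ∅ := by
      ext ω'
      simp only [zero_mul, Set.mem_ofPred_eq, Set.mem_empty_iff_false, iff_false, not_and]
      intro _ h3
      exact absurd h3 (by have := mul_pos hb hy; linarith)
    rw [this]; simp
  have h3 : {ω' | a * x < u * coordPow α X i ω' ∧ b * y < v * coordPow α X j ω'} =
      {ω' | a * x / u < coordPow α X i ω' ∧ b * y / v < coordPow α X j ω'} := by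
    ext ω'; simp [div_lt_iff₀' hu, div_lt_iff₀' hv]
  rw [h3, jointTail]
  have h4 : Real.sqrt (x * y) = (Real.sqrt (a * b))⁻¹ * (Real.sqrt (u * v) *
      Real.sqrt (a * x / u * (b * y / v))) := by
    rw [← Real.sqrt_mul (by positivity), ← Real.sqrt_inv, ← Real.sqrt_mul (by positivity)]
    congr 1
    field_simp
  rw [h4]
  ring

/-- One contraction step for the joint tail. -/
theorem eventually_jointTail_le (h : DiagonalAffine P X A B α) (i j : Fin d)
    (hne : ¬ ∀ᵐ ω ∂P, coordPow α A i ω = coordPow α A j ω) :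
    ∃ q : ℝ, 0 ≤ q ∧ q < 1 ∧ ∀ s : ℝ, 0 < s →
      (∀ᶠ p in (atTop : Filter ℝ) ×ˢ (atTop : Filter ℝ), jointTail P X α i j p ≤ s) →
      ∀ᶠ p in (atTop : Filter ℝ) ×ˢ (atTop : Filter ℝ), jointTail P X α i j p ≤ q * s := by
  have hmi := measurable_coordPow (α := α) h.measA i
  have hmj := measurable_coordPow (α := α) h.measA j
  obtain ⟨hsi, hκ1⟩ := integral_sqrt_mul_lt_one hmi hmj (coordPow_nonneg α A i)
    (coordPow_nonneg α A j) (h.moment i) (h.moment j) hne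
  set w : Ω → ℝ := fun ω => Real.sqrt (coordPow α A i ω * coordPow α A j ω) with hw
  have hw0 : ∀ ω, 0 ≤ w ω := fun ω => Real.sqrt_nonneg _
  set κ := ∫ ω, w ω ∂P with hκ
  have hκ0 : 0 ≤ κ := integral_nonneg hw0
  -- κ = E √(u_i u_j) < 1 tolerates the loss from splitting off B when c is small.
  obtain ⟨c, hc, hc1, hq⟩ : ∃ c : ℝ, 0 < c ∧ c < 1 ∧
      (Real.sqrt ((1 - c) ^ α i * (1 - c) ^ α j))⁻¹ * κ < 1 := by
    have h1 : Tendsto (fun c : ℝ => (Real.sqrt ((1 - c) ^ α i * (1 - c) ^ α j))⁻¹ * κ) (𝓝 0)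
        (𝓝 ((Real.sqrt ((1 - 0) ^ α i * (1 - 0) ^ α j))⁻¹ * κ)) := by
      refine Tendsto.mul_const _ (Tendsto.inv₀ (Tendsto.sqrt (Tendsto.mul ?_ ?_)) (by simp))
      · exact Tendsto.rpow_const (tendsto_const_nhds.sub tendsto_id) (Or.inl (by simp))
      · exact Tendsto.rpow_const (tendsto_const_nhds.sub tendsto_id) (Or.inl (by simp))
    simp only [sub_zero, Real.one_rpow, mul_one, Real.sqrt_one, inv_one, one_mul] at h1
    have h2 := (h1.mono_left (nhdsWithin_le_nhds (s := Set.Ioi 0))).eventually (gt_mem_nhds hκ1)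
    have h3 : ∀ᶠ c : ℝ in 𝓝[>] 0, c ∈ Set.Ioo (0 : ℝ) 1 := Ioo_mem_nhdsGT one_pos
    obtain ⟨c, hc, hc'⟩ := (h2.and h3).exists
    exact ⟨c, hc'.1, hc'.2, hc⟩
  set a := (1 - c) ^ α i with ha
  set b := (1 - c) ^ α j with hb
  have ha0 : 0 < a := Real.rpow_pos_of_pos (by linarith) _
  have hb0 : 0 < b := Real.rpow_pos_of_pos (by linarith) _
  set z := (Real.sqrt (a * b))⁻¹ with hz
  have hz0 : 0 ≤ z := by positivity
  obtain ⟨K, hK0, hK⟩ := h.jointTail_le i j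
  obtain ⟨Mi, hMi, hMti⟩ := h.tail_critical i
  obtain ⟨Mj, hMj, hMtj⟩ := h.tail_critical j
  -- The midpoint of zκ and 1: the gap (1 - zκ)/2 · s absorbs all vanishing errors.
  refine ⟨(z * κ + 1) / 2, by positivity, by linarith, fun s hs hev => ?_⟩
  set J : ℝ × ℝ → Ω → ℝ := fun p ω => jointTail P X α i j
    (a * p.1 / coordPow α A i ω, b * p.2 / coordPow α A j ω) with hJ
  have hJm : ∀ p, Measurable (J p) := fun p => (measurable_jointTail h.measX i j).comp
    ((measurable_const.div hmi).prodMk (measurable_const.div hmj))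
  have hJ0 : ∀ p ω, 0 ≤ J p ω := fun p ω => jointTail_nonneg i j _
  have hJK : ∀ p : ℝ × ℝ, 0 < p.1 → 0 < p.2 → ∀ ω, J p ω ≤ K := fun p h1 h2 ω =>
    hK _ (div_nonneg (by positivity) (coordPow_nonneg α A i ω))
      (div_nonneg (by positivity) (coordPow_nonneg α A j ω))
  have hpos : ∀ᶠ p : ℝ × ℝ in (atTop : Filter ℝ) ×ˢ (atTop : Filter ℝ), 0 < p.1 ∧ 0 < p.2 :=
    (eventually_gt_atTop (0 : ℝ)).prod_mk (eventually_gt_atTop (0 : ℝ))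
  -- The thresholds are divided by different multipliers, so the bound is needed as both levels tend
  -- to infinity independently; the product filter expresses this.
  have hJev : ∀ ω, ∀ᶠ p in (atTop : Filter ℝ) ×ˢ (atTop : Filter ℝ), J p ω ≤ s := by
    intro ω
    rcases (coordPow_nonneg α A i ω).eq_or_lt with h0 | hu
    · refine .of_forall fun p => ?_
      simp only [hJ, jointTail]
      rw [← h0, div_zero, zero_mul, Real.sqrt_zero, zero_mul]
      exact hs.le
    rcases (coordPow_nonneg α A j ω).eq_or_lt with h0 | hv
    · refine .of_forall fun p => ?_
      simp only [hJ, jointTail]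
      rw [← h0, div_zero, mul_zero, Real.sqrt_zero, zero_mul]
      exact hs.le
    have t1 : Tendsto (fun p : ℝ × ℝ => a * p.1 / coordPow α A i ω)
        ((atTop : Filter ℝ) ×ˢ (atTop : Filter ℝ)) atTop :=
      ((tendsto_id.const_mul_atTop ha0).atTop_div_const hu).comp tendsto_fst
    have t2 : Tendsto (fun p : ℝ × ℝ => b * p.2 / coordPow α A j ω)
        ((atTop : Filter ℝ) ×ˢ (atTop : Filter ℝ)) atTop :=
      ((tendsto_id.const_mul_atTop hb0).atTop_div_const hv).comp tendsto_snd
    exact (t1.prodMk t2).eventually hev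
  -- The excess over s vanishes eventually for each ω, and wK dominates it.
  have hlim : Tendsto (fun p => ∫ ω, w ω * (max (J p ω) s - s) ∂P)
      ((atTop : Filter ℝ) ×ˢ (atTop : Filter ℝ)) (𝓝 0) := by
    have e0 : (0 : ℝ) = ∫ ω : Ω, (0 : ℝ) ∂P := by simp
    rw [e0]
    refine tendsto_integral_filter_of_dominated_convergence (fun ω => w ω * K) ?_ ?_
      (hsi.mul_const K) ?_
    · exact .of_forall fun p => (hsi.1.mul
        (((hJm p).max measurable_const).sub measurable_const).aestronglyMeasurable)
    · filter_upwards [hpos] with p hp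
      refine ae_of_all _ fun ω => ?_
      rw [Real.norm_of_nonneg (mul_nonneg (hw0 ω) (sub_nonneg.2 (le_max_right _ _)))]
      refine mul_le_mul_of_nonneg_left ?_ (hw0 ω)
      rw [sub_le_iff_le_add]
      exact max_le (by linarith [hJK p hp.1 hp.2 ω]) (by linarith)
    · refine ae_of_all _ fun ω => ?_
      refine tendsto_const_nhds.congr' ?_
      filter_upwards [hJev ω] with p hp
      rw [max_eq_right hp, sub_self, mul_zero]
  have hBi := (h.tendsto_sqrt_tailB i (Real.rpow_pos_of_pos hc (α i))).comp
    (tendsto_fst (f := (atTop : Filter ℝ)) (g := (atTop : Filter ℝ)))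
  have hBj := (h.tendsto_sqrt_tailB j (Real.rpow_pos_of_pos hc (α j))).comp
    (tendsto_snd (f := (atTop : Filter ℝ)) (g := (atTop : Filter ℝ)))
  have hsum := ((hlim.const_mul z).add (hBi.mul_const (Real.sqrt Mj))).add
    (hBj.const_mul (Real.sqrt Mi))
  simp only [mul_zero, zero_mul, add_zero] at hsum
  have hgap : 0 < (1 - z * κ) / 2 * s := mul_pos (by linarith) hs
  filter_upwards [hsum.eventually (ge_mem_nhds hgap), hpos] with p hp hp0
  obtain ⟨x, y⟩ := p
  simp only [Function.comp] at hp hp0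
  refine (h.jointTail_recursion i j hc hc1 hp0.1 hp0.2).trans ?_
  rw [h.integral_jointTail i j ha0 hb0 hp0.1 hp0.2]
  have i1 : Integrable (fun ω => w ω * J (x, y) ω) P := by
    refine (hsi.mul_const K).mono' (hsi.1.mul (hJm _).aestronglyMeasurable)
      (ae_of_all _ fun ω => ?_)
    rw [Real.norm_of_nonneg (mul_nonneg (hw0 ω) (hJ0 _ ω))]
    exact mul_le_mul_of_nonneg_left (hJK _ hp0.1 hp0.2 ω) (hw0 ω)
  have i2 : Integrable (fun ω => w ω * (max (J (x, y) ω) s - s)) P := by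
    refine (hsi.mul_const K).mono' (hsi.1.mul
        (((hJm _).max measurable_const).sub measurable_const).aestronglyMeasurable)
      (ae_of_all _ fun ω => ?_)
    rw [Real.norm_of_nonneg (mul_nonneg (hw0 ω) (sub_nonneg.2 (le_max_right _ _)))]
    refine mul_le_mul_of_nonneg_left ?_ (hw0 ω)
    rw [sub_le_iff_le_add]
    exact max_le (by linarith [hJK (x, y) hp0.1 hp0.2 ω]) (by linarith)
  have e1 : ∫ ω, w ω * J (x, y) ω ∂P ≤ κ * s + ∫ ω, w ω * (max (J (x, y) ω) s - s) ∂P := by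
    rw [hκ, ← integral_mul_const, ← integral_add (hsi.mul_const s) i2]
    refine integral_mono i1 ((hsi.mul_const s).add i2) fun ω => ?_
    have := mul_le_mul_of_nonneg_left (le_max_left (J (x, y) ω) s) (hw0 ω)
    linarith
  have e2 := mul_le_mul_of_nonneg_left e1 hz0
  have e3 := mul_le_mul_of_nonneg_left (Real.sqrt_le_sqrt (hMtj y hp0.2))
    (Real.sqrt_nonneg (x * P.real {ω | c ^ α i * x < coordPow α B i ω}))
  have e4 := mul_le_mul_of_nonneg_right (Real.sqrt_le_sqrt (hMti x hp0.1))
    (Real.sqrt_nonneg (y * P.real {ω | c ^ α j * y < coordPow α B j ω}))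
  linarith

/-- Coordinates with different multipliers are asymptotically independent. -/
theorem tendsto_joint_tail (h : DiagonalAffine P X A B α) {i j : Fin d}
    (hne : ¬ ∀ᵐ ω ∂P, coordPow α A i ω = coordPow α A j ω) :
    Tendsto (fun s => s * P.real {ω | s < coordPow α X i ω ∧ s < coordPow α X j ω}) atTop
      (𝓝 0) := by
  obtain ⟨q, hq0, hq1, hq⟩ := h.eventually_jointTail_le i j hne
  obtain ⟨K, hK0, hK⟩ := h.jointTail_le i j
  have hpos : ∀ᶠ p : ℝ × ℝ in (atTop : Filter ℝ) ×ˢ (atTop : Filter ℝ), 0 < p.1 ∧ 0 < p.2 :=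
    (eventually_gt_atTop (0 : ℝ)).prod_mk (eventually_gt_atTop (0 : ℝ))
  have hq' : 0 < (q + 1) / 2 := by linarith
  have hev : ∀ n : ℕ, ∀ᶠ p in (atTop : Filter ℝ) ×ˢ (atTop : Filter ℝ),
      jointTail P X α i j p ≤ ((q + 1) / 2) ^ n * K := by
    intro n
    induction n with
    | zero =>
      filter_upwards [hpos] with p hp
      simpa using hK p hp.1.le hp.2.le
    | succ n ih =>
      filter_upwards [hq _ (by positivity) ih] with p hp
      refine hp.trans ?_
      rw [pow_succ', mul_assoc]
      exact mul_le_mul_of_nonneg_right (by linarith) (by positivity)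
  rw [Metric.tendsto_nhds]
  intro e he
  have h1 : Tendsto (fun n : ℕ => ((q + 1) / 2) ^ n * K) atTop (𝓝 (0 * K)) :=
    (tendsto_pow_atTop_nhds_zero_of_lt_one hq'.le (by linarith)).mul_const K
  rw [zero_mul] at h1
  obtain ⟨n, hn⟩ := (h1.eventually (gt_mem_nhds he)).exists
  -- On the diagonal x = y = s the normalization √(xy) is s.
  have h2 := (tendsto_id.prodMk tendsto_id).eventually (hev n)
  filter_upwards [h2, eventually_gt_atTop 0] with s hs hs0
  simp only [jointTail, id, Real.sqrt_mul_self hs0.le] at hs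
  rw [Real.dist_eq, sub_zero, abs_of_nonneg (mul_nonneg hs0.le measureReal_nonneg)]
  linarith

end DiagonalAffine

/-! ### Decomposition of test functions into blocks -/

section
variable {d : ℕ}

open Classical in
/-- Set the coordinates outside `b` to `0`. -/
noncomputable def restrictCoord (b : Finset (Fin d)) (x : Fin d → ℝ) : Fin d → ℝ :=
  fun j => if j ∈ b then x j else 0

theorem restrictCoord_sub (b : Finset (Fin d)) (x y : Fin d → ℝ) :
    restrictCoord b x - restrictCoord b y = restrictCoord b (x - y) := by
  ext j
  simp only [restrictCoord, Pi.sub_apply]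
  split_ifs <;> simp

theorem norm_restrictCoord_le (b : Finset (Fin d)) (x : Fin d → ℝ) :
    ‖restrictCoord b x‖ ≤ ‖x‖ := by
  refine (pi_norm_le_iff_of_nonneg (norm_nonneg _)).2 fun j => ?_
  simp only [restrictCoord]
  split_ifs
  · exact norm_le_pi_norm x j
  · simp

theorem TailTest.comp_restrictCoord {f : (Fin d → ℝ) → ℝ} (hf : TailTest f)
    (b : Finset (Fin d)) : TailTest (fun x => f (restrictCoord b x)) := by
  obtain ⟨L, hL⟩ := hf.lip
  obtain ⟨F, hF⟩ := hf.bdd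
  obtain ⟨δ, hδ, hf0⟩ := hf.van
  refine ⟨⟨L, LipschitzWith.of_dist_le_mul fun x y => ?_⟩, ⟨F, fun x => hF _⟩, δ, hδ,
    fun x hx => hf0 _ ((norm_restrictCoord_le b x).trans hx)⟩
  refine (hL.dist_le_mul _ _).trans (mul_le_mul_of_nonneg_left ?_ L.2)
  rw [dist_eq_norm, dist_eq_norm, restrictCoord_sub]
  exact norm_restrictCoord_le _ _

open Classical in
/-- The class of `i` under an equivalence relation, as a finite set. -/
noncomputable def block (r : Setoid (Fin d)) (i : Fin d) : Finset (Fin d) :=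
  Finset.univ.filter fun j => r j i

open Classical in
/-- The classes of an equivalence relation. -/
noncomputable def blocks (r : Setoid (Fin d)) : Finset (Finset (Fin d)) :=
  Finset.univ.image (block r)

theorem mem_block {r : Setoid (Fin d)} {i j : Fin d} : j ∈ block r i ↔ r j i := by
  simp [block]

theorem not_rel_of_mem_blocks {r : Setoid (Fin d)} {b : Finset (Fin d)} (hb : b ∈ blocks r)
    {i j : Fin d} (hne : b ≠ block r i) (hj : j ∈ b) : ¬ r j i := by
  classical
  obtain ⟨k, -, rfl⟩ := Finset.mem_image.1 hb
  intro hji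
  apply hne
  rw [mem_block] at hj
  ext l
  rw [mem_block, mem_block]
  have hki : r k i := r.trans (r.symm hj) hji
  exact ⟨fun h => r.trans h hki, fun h => r.trans h (r.symm hki)⟩

-- Two inequivalent coordinates exceed ε, or all terms vanish because ‖z‖ ≤ δ, or a single block
-- carries a coordinate above δ. In the last case every coordinate outside that block is at most ε:
-- the other restrictions give 0 and deleting those coordinates costs Lε.
open Classical in
theorem test_sub_sum_blocks_le (r : Setoid (Fin d)) {f : (Fin d → ℝ) → ℝ} {L : NNReal}
    (hL : LipschitzWith L f) {F : ℝ} (hF : ∀ x, |f x| ≤ F) {δ : ℝ}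
    (hf0 : ∀ x, ‖x‖ ≤ δ → f x = 0) {ε : ℝ} (hε : 0 < ε) (hεδ : ε ≤ δ) (z : Fin d → ℝ) :
    |f z - ∑ b ∈ blocks r, f (restrictCoord b z)| ≤
      (1 + (blocks r).card) * F * ∑ q : Fin d × Fin d,
        (if ¬ r q.1 q.2 ∧ ε < |z q.1| ∧ ε < |z q.2| then (1 : ℝ) else 0) +
      L * ε * ∑ j, (if δ < |z j| then (1 : ℝ) else 0) := by
  have hF0 : 0 ≤ F := (abs_nonneg _).trans (hF 0)
  have n1 : ∀ q : Fin d × Fin d,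
      (0 : ℝ) ≤ if ¬ r q.1 q.2 ∧ ε < |z q.1| ∧ ε < |z q.2| then (1 : ℝ) else 0 := fun q => by
    split_ifs <;> norm_num
  have n2 : ∀ j, (0 : ℝ) ≤ if δ < |z j| then (1 : ℝ) else 0 := fun j => by
    split_ifs <;> norm_num
  have p1 : 0 ≤ (1 + (blocks r).card) * F * ∑ q : Fin d × Fin d,
      (if ¬ r q.1 q.2 ∧ ε < |z q.1| ∧ ε < |z q.2| then (1 : ℝ) else 0) :=
    mul_nonneg (by positivity) (Finset.sum_nonneg fun q _ => n1 q)
  have p2 : 0 ≤ L * ε * ∑ j, (if δ < |z j| then (1 : ℝ) else 0) :=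
    mul_nonneg (by positivity) (Finset.sum_nonneg fun j _ => n2 j)
  by_cases hq : ∃ q : Fin d × Fin d, ¬ r q.1 q.2 ∧ ε < |z q.1| ∧ ε < |z q.2|
  · obtain ⟨q, hq⟩ := hq
    have h1 := Finset.single_le_sum
      (f := fun q : Fin d × Fin d =>
        if ¬ r q.1 q.2 ∧ ε < |z q.1| ∧ ε < |z q.2| then (1 : ℝ) else 0)
      (fun q _ => n1 q) (Finset.mem_univ q)
    simp only [if_pos hq] at h1
    have h2 : |f z - ∑ b ∈ blocks r, f (restrictCoord b z)| ≤ (1 + (blocks r).card) * F := by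
      refine (abs_sub _ _).trans ?_
      have h3 : |∑ b ∈ blocks r, f (restrictCoord b z)| ≤ (blocks r).card * F := by
        refine (Finset.abs_sum_le_sum_abs _ _).trans
          ((Finset.sum_le_sum fun b _ => hF _).trans ?_)
        simp
      linarith [hF z]
    have h4 := mul_le_mul_of_nonneg_left h1 (show 0 ≤ (1 + ((blocks r).card : ℝ)) * F by positivity)
    linarith
  · push Not at hq
    rcases le_or_gt ‖z‖ δ with hz | hz
    · have h1 : ∑ b ∈ blocks r, f (restrictCoord b z) = 0 :=
        Finset.sum_eq_zero fun b _ => hf0 _ ((norm_restrictCoord_le b z).trans hz)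
      rw [h1, hf0 z hz]
      simp only [sub_zero, abs_zero]
      linarith
    · obtain ⟨i, hi⟩ := exists_lt_abs_of_lt_norm (hε.le.trans hεδ) hz
      have hsmall : ∀ j, ¬ r j i → |z j| ≤ ε := fun j hj => by
        by_contra! hc
        exact absurd (hq (j, i) hj hc) (not_le.2 (hεδ.trans_lt hi))
      have h1 : ∑ b ∈ blocks r, f (restrictCoord b z) = f (restrictCoord (block r i) z) := by
        refine Finset.sum_eq_single_of_mem (block r i)
          (Finset.mem_image_of_mem _ (Finset.mem_univ i)) fun b hb hne => ?_
        refine hf0 _ ((pi_norm_le_iff_of_nonneg (hε.le.trans hεδ)).2 fun j => ?_)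
        simp only [restrictCoord]
        split_ifs with hj
        · exact (hsmall j (not_rel_of_mem_blocks hb hne hj)).trans hεδ
        · simpa using hε.le.trans hεδ
      have h2 : |f z - f (restrictCoord (block r i) z)| ≤ L * ε := by
        have h3 := hL.dist_le_mul z (restrictCoord (block r i) z)
        rw [Real.dist_eq, dist_eq_norm] at h3
        refine h3.trans (mul_le_mul_of_nonneg_left ?_ L.2)
        refine (pi_norm_le_iff_of_nonneg hε.le).2 fun j => ?_
        simp only [restrictCoord, Pi.sub_apply]
        split_ifs with hj
        · simpa using hε.le
        · rw [mem_block] at hj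
          simpa using hsmall j hj
      have h3 := Finset.single_le_sum (f := fun j => if δ < |z j| then (1 : ℝ) else 0)
        (fun j _ => n2 j) (Finset.mem_univ i)
      simp only [if_pos hi] at h3
      rw [h1]
      have h4 := mul_le_mul_of_nonneg_left h3 (show 0 ≤ L * ε by positivity)
      linarith

end

namespace DiagonalAffine

variable {Ω : Type*} [MeasurableSpace Ω] {P : Measure Ω} {d : ℕ} {X A B : Ω → Fin d → ℝ}
  {α : Fin d → ℝ}

/-- Coordinates are equivalent when their normalized multipliers agree almost surely. -/
def multiplierSetoid (P : Measure Ω) (A : Ω → Fin d → ℝ) (α : Fin d → ℝ) : Setoid (Fin d) where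
  r i j := ∀ᵐ ω ∂P, coordPow α A i ω = coordPow α A j ω
  iseqv :=
    { refl := fun i => ae_of_all _ fun _ => rfl
      symm := fun h => by filter_upwards [h] with ω hω using hω.symm
      trans := fun h h' => by filter_upwards [h, h'] with ω hω hω' using hω.trans hω' }

variable [IsProbabilityMeasure P]

theorem tendsto_exp_joint_tail (h : DiagonalAffine P X A B α) {i j : Fin d}
    (hne : ¬ ∀ᵐ ω ∂P, coordPow α A i ω = coordPow α A j ω) {ε : ℝ} (hε : 0 < ε) :
    Tendsto (fun t => Real.exp t * P.real {ω | ε < |dilation α (Real.exp (-t)) (X ω) i| ∧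
      ε < |dilation α (Real.exp (-t)) (X ω) j|}) atTop (𝓝 0) := by
  set m := min (ε ^ α i) (ε ^ α j) with hm
  have hm0 : 0 < m := lt_min (Real.rpow_pos_of_pos hε _) (Real.rpow_pos_of_pos hε _)
  have h1 := ((h.tendsto_joint_tail hne).comp (Real.tendsto_exp_atTop.const_mul_atTop hm0)).const_mul
    m⁻¹
  rw [mul_zero] at h1
  refine tendsto_of_tendsto_of_tendsto_of_le_of_le tendsto_const_nhds h1
    (fun t => mul_nonneg (Real.exp_pos t).le measureReal_nonneg) fun t => ?_
  simp only [Function.comp]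
  rw [mul_assoc, inv_mul_cancel_left₀ hm0.ne']
  refine mul_le_mul_of_nonneg_left (measureReal_mono fun ω hω => ?_) (Real.exp_pos t).le
  have h2 := (lt_abs_dilation_iff (h.pos i) hε.le t (X ω)).1 hω.1
  have h3 := (lt_abs_dilation_iff (h.pos j) hε.le t (X ω)).1 hω.2
  exact ⟨(mul_le_mul_of_nonneg_right (min_le_left _ _) (Real.exp_pos t).le).trans_lt h2,
    (mul_le_mul_of_nonneg_right (min_le_right _ _) (Real.exp_pos t).le).trans_lt h3⟩

open Classical in
theorem tendsto_scaledMean_sub_blocks (h : DiagonalAffine P X A B α) {f : (Fin d → ℝ) → ℝ}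
    (hf : TailTest f) :
    Tendsto (fun t => scaledMean P X α f t - ∑ b ∈ blocks (multiplierSetoid P A α),
      scaledMean P X α (fun x => f (restrictCoord b x)) t) atTop (𝓝 0) := by
  set r := multiplierSetoid P A α with hr
  obtain ⟨L, hL⟩ := hf.lip
  obtain ⟨F, hF⟩ := hf.bdd
  obtain ⟨δ, hδ, hf0⟩ := hf.van
  have hF0 : 0 ≤ F := (abs_nonneg _).trans (hF 0)
  obtain ⟨T, -, hT⟩ := h.exists_tail_sum_bound
  have hTd := (hT δ hδ).1
  rw [Metric.tendsto_nhds]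
  intro e he
  -- The Lipschitz error is made small uniformly in t first; with ε fixed, the joint exceedances
  -- vanish as t → ∞.
  obtain ⟨ε, hε, hεδ, hεe⟩ : ∃ ε : ℝ, 0 < ε ∧ ε ≤ δ ∧ L * ε * T δ < e / 2 := by
    have h1 : Tendsto (fun ε : ℝ => L * ε * T δ) (𝓝[>] 0) (𝓝 (L * 0 * T δ)) :=
      (Continuous.tendsto (by fun_prop) 0).mono_left nhdsWithin_le_nhds
    have h2 := h1.eventually (gt_mem_nhds (show L * 0 * T δ < e / 2 by simp; positivity))
    have h3 : ∀ᶠ ε : ℝ in 𝓝[>] 0, ε ∈ Set.Ioo (0 : ℝ) δ := Ioo_mem_nhdsGT hδ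
    obtain ⟨ε, h4, h5⟩ := (h2.and h3).exists
    exact ⟨ε, h5.1, h5.2.le, h4⟩
  set S : ℝ → Fin d × Fin d → Set Ω := fun t q => {ω | ¬ r q.1 q.2 ∧
    ε < |dilation α (Real.exp (-t)) (X ω) q.1| ∧ ε < |dilation α (Real.exp (-t)) (X ω) q.2|}
    with hS
  have hSm : ∀ t q, MeasurableSet (S t q) := by
    intro t q
    have hm : ∀ k, MeasurableSet {ω | ε < |dilation α (Real.exp (-t)) (X ω) k|} := fun k => by
      refine measurableSet_lt measurable_const ?_
      exact ((continuous_abs.comp ((continuous_apply k).comp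
        (continuous_dilation α _))).measurable).comp h.measX
    exact (MeasurableSet.const _).inter ((hm _).inter (hm _))
  have hSt : ∀ q, Tendsto (fun t => Real.exp t * P.real (S t q)) atTop (𝓝 0) := by
    intro q
    by_cases hq : r q.1 q.2
    · have : ∀ t, S t q = ∅ := fun t => by ext ω; simp [hS, hq]
      simp [this]
    · have : ∀ t, S t q = {ω | ε < |dilation α (Real.exp (-t)) (X ω) q.1| ∧
          ε < |dilation α (Real.exp (-t)) (X ω) q.2|} := fun t => by ext ω; simp [hS, hq]
      simp_rw [this]
      exact h.tendsto_exp_joint_tail hq hε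
  have hsum : Tendsto (fun t => (1 + (blocks r).card) * F * ∑ q, Real.exp t * P.real (S t q)) atTop
      (𝓝 0) := by
    have := (tendsto_finsetSum Finset.univ fun q _ => hSt q).const_mul ((1 + (blocks r).card) * F)
    simpa using this
  filter_upwards [hsum.eventually (gt_mem_nhds (show 0 < e / 2 by positivity))] with t ht
  have hInt : ∀ b, Integrable (fun ω => f (restrictCoord b (dilation α (Real.exp (-t)) (X ω)))) P :=
    fun b => integrable_test (hf.comp_restrictCoord b) h.measX _
  have e0 : scaledMean P X α f t - ∑ b ∈ blocks r,
      scaledMean P X α (fun x => f (restrictCoord b x)) t =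
      Real.exp t * ∫ ω, (f (dilation α (Real.exp (-t)) (X ω)) - ∑ b ∈ blocks r,
        f (restrictCoord b (dilation α (Real.exp (-t)) (X ω)))) ∂P := by
    rw [integral_sub (integrable_test hf h.measX _) (integrable_finsetSum _ fun b _ => hInt b),
      integral_finsetSum _ fun b _ => hInt b, mul_sub, Finset.mul_sum]
    rfl
  obtain ⟨i2, e2⟩ := integral_ite_lt_dilation (P := P) h.pos h.measX hδ.le t
  have hind : ∀ q, (fun ω => if ¬ r q.1 q.2 ∧ ε < |dilation α (Real.exp (-t)) (X ω) q.1| ∧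
      ε < |dilation α (Real.exp (-t)) (X ω) q.2| then (1 : ℝ) else 0) = (S t q).indicator 1 := by
    intro q; ext ω; simp only [Set.indicator, hS, Set.mem_ofPred_eq, Pi.one_apply]
  have i1' : ∀ q : Fin d × Fin d, Integrable (fun ω => if ¬ r q.1 q.2 ∧
      ε < |dilation α (Real.exp (-t)) (X ω) q.1| ∧
      ε < |dilation α (Real.exp (-t)) (X ω) q.2| then (1 : ℝ) else 0) P := fun q => by
    rw [hind q]; exact (integrable_const (1 : ℝ)).indicator (hSm t q)
  have i1 := integrable_finsetSum Finset.univ fun q _ => i1' q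
  have e1 : ∫ ω, (∑ q : Fin d × Fin d, if ¬ r q.1 q.2 ∧
      ε < |dilation α (Real.exp (-t)) (X ω) q.1| ∧
      ε < |dilation α (Real.exp (-t)) (X ω) q.2| then (1 : ℝ) else 0) ∂P =
      ∑ q, P.real (S t q) := by
    rw [integral_finsetSum _ fun q _ => i1' q]
    refine Finset.sum_congr rfl fun q _ => ?_
    rw [hind q, integral_indicator_one (hSm t q)]
  have h1 : |∫ ω, (f (dilation α (Real.exp (-t)) (X ω)) - ∑ b ∈ blocks r,
        f (restrictCoord b (dilation α (Real.exp (-t)) (X ω)))) ∂P| ≤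
      (1 + (blocks r).card) * F * ∑ q, P.real (S t q) +
      L * ε * ∑ j, P.real {ω | δ ^ α j * Real.exp t < coordPow α X j ω} := by
    rw [← e1, ← e2, ← integral_const_mul, ← integral_const_mul,
      ← integral_add (i1.const_mul _) (i2.const_mul _), ← Real.norm_eq_abs]
    refine norm_integral_le_of_norm_le ((i1.const_mul _).add (i2.const_mul _))
      (ae_of_all _ fun ω => ?_)
    exact test_sub_sum_blocks_le r hL hF hf0 hε hεδ _
  rw [Real.dist_eq, sub_zero, e0, abs_mul, abs_of_pos (Real.exp_pos t)]
  have h2 := mul_le_mul_of_nonneg_left h1 (Real.exp_pos t).le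
  have h3 := mul_le_mul_of_nonneg_left ((hT δ hδ).2 t) (show 0 ≤ L * ε by positivity)
  rw [← Finset.mul_sum] at ht
  linarith

/-- Scaled expectations of every test function converge. -/
theorem tendsto_scaledMean (h : DiagonalAffine P X A B α) {f : (Fin d → ℝ) → ℝ}
    (hf : TailTest f) : ∃ l, Tendsto (scaledMean P X α f) atTop (𝓝 l) := by
  classical
  have h1 : ∀ b ∈ blocks (multiplierSetoid P A α), ∃ l,
      Tendsto (scaledMean P X α fun x => f (restrictCoord b x)) atTop (𝓝 l) := by
    intro b hb
    obtain ⟨i, -, rfl⟩ := Finset.mem_image.1 hb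
    refine h.tendsto_scaledMean_of_block (hf.comp_restrictCoord _)
      (b := block (multiplierSetoid P A α) i) (i := i) (fun x y hxy => ?_)
      fun j hj => mem_block.1 hj
    congr 1
    ext j
    simp only [restrictCoord]
    split_ifs with hj
    · exact hxy j hj
    · rfl
  choose! l hl using h1
  have h2 := (h.tendsto_scaledMean_sub_blocks hf).add (tendsto_finsetSum _ hl)
  exact ⟨_, h2.congr fun t => by ring⟩

end DiagonalAffine

/-! ### The norm `|x|_α` and polar coordinates -/

section
variable {d : ℕ} {α : Fin d → ℝ}

theorem lt_alphaNorm_iff {t : ℝ} (ht : 0 ≤ t) (x : Fin d → ℝ) :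
    t < alphaNorm α x ↔ ∃ j, t < |x j| ^ α j := by
  unfold alphaNorm
  -- Without coordinates the supremum takes its default value 0, so neither side holds.
  rcases isEmpty_or_nonempty (Fin d) with hd | hd
  · simp [Real.iSup_of_isEmpty, not_lt.2 ht]
  · exact lt_ciSup_iff (Set.finite_range _).bddAbove

theorem alphaNorm_nonneg (α : Fin d → ℝ) (x : Fin d → ℝ) : 0 ≤ alphaNorm α x :=
  Real.iSup_nonneg fun _ => Real.rpow_nonneg (abs_nonneg _) _

theorem continuous_alphaNorm (hα : ∀ j, 0 < α j) : Continuous (alphaNorm α) := by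
  unfold alphaNorm
  rcases isEmpty_or_nonempty (Fin d) with hd | hd
  · simp only [Real.iSup_of_isEmpty]; exact continuous_const
  · simp_rw [← Finset.sup'_univ_eq_ciSup]
    refine Continuous.finset_sup'_apply _ fun j _ => ?_
    exact (continuous_abs.comp (continuous_apply j)).rpow_const fun x => Or.inr (hα j).le

theorem alphaNorm_dilation (hα : ∀ j, 0 < α j) {c : ℝ} (hc : 0 ≤ c) (x : Fin d → ℝ) :
    alphaNorm α (dilation α c x) = c * alphaNorm α x := by
  unfold alphaNorm
  rw [Real.mul_iSup_of_nonneg hc]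
  congr 1
  ext j
  have h0 : 0 ≤ c ^ (1 / α j) := Real.rpow_nonneg hc _
  rw [dilation, abs_mul, abs_of_nonneg h0, Real.mul_rpow h0 (abs_nonneg _), ← Real.rpow_mul hc,
    one_div_mul_cancel (hα j).ne', Real.rpow_one]

theorem dilation_dilation {a b : ℝ} (ha : 0 ≤ a) (hb : 0 ≤ b) (x : Fin d → ℝ) :
    dilation α a (dilation α b x) = dilation α (a * b) x := by
  ext j
  simp only [dilation]
  rw [Real.mul_rpow ha hb, mul_assoc]

theorem isCompact_alphaSphere (hα : ∀ j, 0 < α j) : IsCompact (alphaSphere α) := by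
  refine Metric.isCompact_of_isClosed_isBounded ?_ ?_
  · exact isClosed_eq (continuous_alphaNorm hα) continuous_const
  · refine (Metric.isBounded_closedBall (x := (0 : Fin d → ℝ)) (r := 1)).subset fun x hx => ?_
    rw [mem_closedBall_zero_iff]
    refine (pi_norm_le_iff_of_nonneg zero_le_one).2 fun j => ?_
    rw [Real.norm_eq_abs]
    by_contra! hc
    have h1 : (1 : ℝ) < alphaNorm α x :=
      (lt_alphaNorm_iff zero_le_one x).2 ⟨j, Real.one_lt_rpow hc (hα j)⟩
    exact h1.ne' hx

/-- The angular part `δ_{|x|_α^{-1}} x`. -/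
noncomputable def angle (α : Fin d → ℝ) (x : Fin d → ℝ) : Fin d → ℝ :=
  dilation α (alphaNorm α x)⁻¹ x

theorem measurable_angle (hα : ∀ j, 0 < α j) : Measurable (angle α) := by
  refine measurable_pi_lambda _ fun j => ?_
  exact (((continuous_alphaNorm hα).measurable.inv).pow_const _).mul (measurable_pi_apply j)

theorem angle_mem (hα : ∀ j, 0 < α j) {x : Fin d → ℝ} (hx : 0 < alphaNorm α x) :
    angle α x ∈ alphaSphere α := by
  change alphaNorm α (dilation α _ x) = 1
  rw [alphaNorm_dilation hα (by positivity), inv_mul_cancel₀ hx.ne']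

theorem angle_dilation (hα : ∀ j, 0 < α j) {c : ℝ} (hc : 0 < c) (x : Fin d → ℝ) :
    angle α (dilation α c x) = angle α x := by
  unfold angle
  have := alphaNorm_nonneg α x
  rw [alphaNorm_dilation hα hc.le, dilation_dilation (by positivity) hc.le]
  congr 1
  rw [mul_inv, mul_comm c⁻¹, inv_mul_cancel_right₀ hc.ne']

/-- A continuous cutoff to the annulus between `1` and `M + 1`. -/
noncomputable def annulusCutoff (ε M r : ℝ) : ℝ := min 1 (max 0 (min ((r - 1) / ε) (M + 1 - r)))

theorem annulusCutoff_nonneg (ε M r : ℝ) : 0 ≤ annulusCutoff ε M r :=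
  le_min zero_le_one (le_max_left _ _)

theorem annulusCutoff_le_one (ε M r : ℝ) : annulusCutoff ε M r ≤ 1 := min_le_left _ _

theorem annulusCutoff_of_le {ε M r : ℝ} (hε : 0 < ε) (hr : r ≤ 1) : annulusCutoff ε M r = 0 := by
  have h1 : (r - 1) / ε ≤ 0 := div_nonpos_of_nonpos_of_nonneg (by linarith) hε.le
  rw [annulusCutoff, max_eq_left ((min_le_left _ _).trans h1)]
  simp

theorem annulusCutoff_of_ge {ε M r : ℝ} (hr : M + 1 ≤ r) : annulusCutoff ε M r = 0 := by
  rw [annulusCutoff, max_eq_left ((min_le_right _ _).trans (by linarith))]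
  simp

theorem annulusCutoff_eq_one {ε M r : ℝ} (hε : 0 < ε) (h1 : 1 + ε ≤ r) (h2 : r ≤ M) :
    annulusCutoff ε M r = 1 := by
  have h3 : 1 ≤ (r - 1) / ε := by rw [le_div_iff₀ hε]; linarith
  exact min_eq_left (le_max_of_le_right (le_min h3 (by linarith)))

/-- A bounded continuous function of the angle, cut off to an annulus. -/
noncomputable def angularTest (α : Fin d → ℝ) (H : (Fin d → ℝ) → ℝ) (ε M : ℝ) (x : Fin d → ℝ) : ℝ :=
  H (angle α x) * annulusCutoff ε M (alphaNorm α x)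

/-- The angle is not continuous at the origin, but the cutoff vanishes for |x|_α ≤ 1; so the
normalizing factor may use max(1, |x|_α). -/
theorem continuous_angularTest (hα : ∀ j, 0 < α j) {H : (Fin d → ℝ) → ℝ} (hH : Continuous H)
    {ε : ℝ} (hε : 0 < ε) (M : ℝ) : Continuous (angularTest α H ε M) := by
  have h1 : angularTest α H ε M = fun x =>
      H (dilation α (max 1 (alphaNorm α x))⁻¹ x) * annulusCutoff ε M (alphaNorm α x) := by
    ext x
    rcases le_total (alphaNorm α x) 1 with h | h
    · simp [angularTest, annulusCutoff_of_le hε h]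
    · rw [max_eq_right h]; rfl
  have hN := continuous_alphaNorm hα
  rw [h1]
  refine Continuous.mul (hH.comp ?_) ?_
  · unfold dilation
    refine continuous_pi fun j => Continuous.mul ?_ (continuous_apply j)
    have h2 : ∀ x, max 1 (alphaNorm α x) ≠ 0 := fun x =>
      (zero_lt_one.trans_le (le_max_left _ _)).ne'
    exact ((continuous_const.max hN).inv₀ h2).rpow_const fun x => Or.inl (inv_ne_zero (h2 x))
  · unfold annulusCutoff
    fun_prop

end

/-- The approximate limit may depend on e: the function is then Cauchy at infinity. -/
theorem exists_tendsto_of_approx {N : ℝ → ℝ}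
    (h : ∀ e, 0 < e → ∃ l, ∀ᶠ t in atTop, |N t - l| ≤ e) : ∃ l, Tendsto N atTop (𝓝 l) := by
  rw [← cauchy_map_iff_exists_tendsto, Metric.cauchy_iff]
  refine ⟨inferInstance, fun e he => ?_⟩
  obtain ⟨l, hl⟩ := h (e / 3) (by positivity)
  refine ⟨{y | |y - l| ≤ e / 3}, hl, fun x hx y hy => ?_⟩
  rw [Set.mem_ofPred_eq, abs_le] at hx hy
  rw [Real.dist_eq, abs_lt]
  constructor <;> linarith [hx.1, hx.2, hy.1, hy.2]

/-- Continuous functions with compact support off the origin are uniform limits of test functions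
with a common neighbourhood of `0` on which they vanish. -/
theorem exists_tailTest_approx {d : ℕ} {f : (Fin d → ℝ) → ℝ} (hf : Continuous f) {δ R : ℝ}
    (hδ : 0 < δ) (hf0 : ∀ x, ‖x‖ ≤ δ → f x = 0) (hfR : ∀ x, R < ‖x‖ → f x = 0) {η : ℝ}
    (hη : 0 < η) : ∃ g : (Fin d → ℝ) → ℝ, TailTest g ∧ (∀ x, ‖x‖ ≤ δ / 2 → g x = 0) ∧
      ∀ x, |g x - f x| ≤ η := by
  have hcs : HasCompactSupport f := HasCompactSupport.intro (isCompact_closedBall 0 R) fun x hx =>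
    hfR x (by simpa using hx)
  obtain ⟨ε₀, hε₀, hu⟩ := Metric.uniformContinuous_iff.1 (hcs.uniformContinuous_of_continuous hf) η hη
  set ε := min ε₀ (δ / 2) with hε
  have hε0 : 0 < ε := by positivity
  -- The error of the smoothing at a point is at most the oscillation of f on the ε-ball. It is
  -- therefore 0 where f vanishes on that ball; ε ≤ δ/2 then yields the zero set near the origin.
  obtain ⟨g, hg, hgf⟩ := hf.exists_contDiff_dist_le_of_forall_mem_ball_dist_le hε0
  have hzero : ∀ a, (∀ x ∈ Metric.ball a ε, f x = 0) → g a = 0 := fun a ha => by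
    have h1 := ha a (Metric.mem_ball_self hε0)
    have := hgf a 0 fun x hx => by rw [ha x hx, h1, dist_self]
    rwa [h1, dist_le_zero] at this
  have hnear : ∀ x a : Fin d → ℝ, x ∈ Metric.ball a ε → ‖x‖ ≤ ‖a‖ + ε ∧ ‖a‖ ≤ ‖x‖ + ε := by
    intro x a hx
    rw [Metric.mem_ball, dist_eq_norm] at hx
    have h1 := norm_le_norm_add_norm_sub' x a
    have h2 := norm_le_norm_add_norm_sub' a x
    rw [norm_sub_rev] at h2
    constructor <;> linarith
  have hg0 : ∀ x, ‖x‖ ≤ δ / 2 → g x = 0 := fun a ha => hzero a fun x hx =>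
    hf0 x (by linarith [(hnear x a hx).1, min_le_right ε₀ (δ / 2)])
  have hgcs : HasCompactSupport g :=
    HasCompactSupport.intro (isCompact_closedBall 0 (R + ε)) fun a ha => hzero a fun x hx => by
      refine hfR x ?_
      have h1 : R + ε < ‖a‖ := by simpa using ha
      linarith [(hnear x a hx).2]
  have happ : ∀ x, |g x - f x| ≤ η := fun a => hgf a η fun x hx =>
    (hu (lt_of_lt_of_le hx (min_le_left _ _))).le
  obtain ⟨F, hF⟩ := hg.continuous.bounded_above_of_compact_support hgcs
  exact ⟨g, ⟨hg.lipschitzWith_of_hasCompactSupport hgcs (by simp), ⟨F, hF⟩, δ / 2, by positivity, hg0⟩,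
    hg0, happ⟩

/-! ### Scaled limits for continuous functions and the existence of c_∞ -/

namespace DiagonalAffine

variable {Ω : Type*} [MeasurableSpace Ω] {P : Measure Ω} {d : ℕ} {X A B : Ω → Fin d → ℝ}
  {α : Fin d → ℝ}

/-- The scaled tail of `|X|_α` on the logarithmic scale. -/
noncomputable def normTail (P : Measure Ω) (X : Ω → Fin d → ℝ) (α : Fin d → ℝ) (t : ℝ) : ℝ :=
  Real.exp t * P.real {ω | Real.exp t < alphaNorm α (X ω)}

theorem measurableSet_lt_alphaNorm (h : DiagonalAffine P X A B α) (t : ℝ) :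
    MeasurableSet {ω | t < alphaNorm α (X ω)} :=
  measurableSet_lt measurable_const ((continuous_alphaNorm h.pos).measurable.comp h.measX)

theorem exp_mul_tail (t : ℝ) {c : ℝ} (hc : 0 < c) :
    Real.exp t * P.real {ω | c * Real.exp t < alphaNorm α (X ω)} =
      c⁻¹ * normTail P X α (t + Real.log c) := by
  rw [normTail, Real.exp_add, Real.exp_log hc, mul_comm (Real.exp t) c, mul_assoc,
    inv_mul_cancel_left₀ hc.ne']

variable [IsProbabilityMeasure P]

/-- Angular test functions are only continuous. A uniform approximation with error η vanishing on
the same neighbourhood of 0 changes the scaled mean by at most η times a bounded scaled tail. -/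
theorem tendsto_scaledMean_of_compactSupport (h : DiagonalAffine P X A B α)
    {f : (Fin d → ℝ) → ℝ} (hf : Continuous f) {δ R F : ℝ} (hδ : 0 < δ)
    (hf0 : ∀ x, ‖x‖ ≤ δ → f x = 0) (hfR : ∀ x, R < ‖x‖ → f x = 0) (hF : ∀ x, |f x| ≤ F) :
    ∃ l, Tendsto (scaledMean P X α f) atTop (𝓝 l) := by
  obtain ⟨T, -, hT⟩ := h.exists_tail_sum_bound
  have hδ2 : 0 < δ / 2 := by positivity
  have hTd := (hT (δ / 2) hδ2).1
  refine exists_tendsto_of_approx fun e he => ?_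
  set η := e / 2 / (T (δ / 2) + 1) with hη
  have hη0 : 0 < η := by positivity
  obtain ⟨g, hg, hg0, hgf⟩ := exists_tailTest_approx hf hδ hf0 hfR hη0
  obtain ⟨l, hl⟩ := h.tendsto_scaledMean hg
  refine ⟨l, ?_⟩
  have hfi : ∀ t, Integrable (fun ω => f (dilation α t (X ω))) P := fun t =>
    Integrable.of_bound
      ((hf.comp (continuous_dilation α t)).measurable.comp h.measX).aestronglyMeasurable F
      (ae_of_all _ fun ω => hF _)
  have hclose : ∀ t, |scaledMean P X α f t - scaledMean P X α g t| ≤ e / 2 := by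
    intro t
    obtain ⟨i1, e1⟩ := integral_ite_lt_dilation (P := P) h.pos h.measX hδ2.le t
    have h1 : |∫ ω, f (dilation α (Real.exp (-t)) (X ω)) ∂P -
        ∫ ω, g (dilation α (Real.exp (-t)) (X ω)) ∂P| ≤
        η * ∑ j, P.real {ω | (δ / 2) ^ α j * Real.exp t < coordPow α X j ω} := by
      rw [← e1, ← integral_const_mul, ← integral_sub (hfi _) (integrable_test hg h.measX _),
        ← Real.norm_eq_abs]
      refine norm_integral_le_of_norm_le (i1.const_mul _) (ae_of_all _ fun ω => ?_)
      have n : ∀ j, (0 : ℝ) ≤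
          if δ / 2 < |dilation α (Real.exp (-t)) (X ω) j| then (1 : ℝ) else 0 :=
        fun j => by split_ifs <;> norm_num
      rcases le_or_gt ‖dilation α (Real.exp (-t)) (X ω)‖ (δ / 2) with hy | hy
      · rw [hf0 _ (by linarith), hg0 _ hy, sub_zero, norm_zero]
        exact mul_nonneg hη0.le (Finset.sum_nonneg fun j _ => n j)
      · obtain ⟨j, hj⟩ := exists_lt_abs_of_lt_norm hδ2.le hy
        have h2 := Finset.single_le_sum
          (f := fun j => if δ / 2 < |dilation α (Real.exp (-t)) (X ω) j| then (1 : ℝ) else 0)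
          (fun j _ => n j) (Finset.mem_univ j)
        simp only [hj, if_true] at h2
        rw [Real.norm_eq_abs, abs_sub_comm]
        refine (hgf _).trans ?_
        nlinarith
    rw [scaledMean, scaledMean, ← mul_sub, abs_mul, abs_of_pos (Real.exp_pos t)]
    have h3 := mul_le_mul_of_nonneg_left h1 (Real.exp_pos t).le
    have h4 := mul_le_mul_of_nonneg_left ((hT (δ / 2) hδ2).2 t) hη0.le
    have h5 : η * (T (δ / 2) + 1) = e / 2 := by rw [hη]; field_simp
    linarith
  filter_upwards [(Metric.tendsto_nhds.1 hl) (e / 2) (by positivity)] with t ht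
  rw [Real.dist_eq, abs_lt] at ht
  have := hclose t
  rw [abs_le] at this ⊢
  constructor <;> linarith [this.1, this.2, ht.1, ht.2]

theorem normTail_le (h : DiagonalAffine P X A B α) :
    ∃ K, 0 ≤ K ∧ ∀ t, normTail P X α t ≤ K := by
  obtain ⟨T, -, hT⟩ := h.exists_tail_sum_bound
  refine ⟨T 1, (hT 1 one_pos).1, fun t => le_trans ?_ ((hT 1 one_pos).2 t)⟩
  refine mul_le_mul_of_nonneg_left ?_ (Real.exp_pos t).le
  simp only [Real.one_rpow, one_mul]
  have h1 : {ω | Real.exp t < alphaNorm α (X ω)} ⊆ ⋃ j, {ω | Real.exp t < coordPow α X j ω} := by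
    intro ω hω
    obtain ⟨j, hj⟩ := (lt_alphaNorm_iff (Real.exp_pos t).le _).1 hω
    exact Set.mem_iUnion.2 ⟨j, hj⟩
  exact (measureReal_mono h1).trans (measureReal_iUnion_fintype_le _)

theorem tailTest_normRamp {ε : ℝ} (hε : 0 < ε) :
    TailTest (fun x : Fin d → ℝ => min 1 (max 0 ((‖x‖ - 1) / ε))) := by
  refine ⟨⟨Real.toNNReal ε⁻¹, ?_⟩, ⟨1, fun x => ?_⟩, 1, one_pos, fun x hx => ?_⟩
  · have h1 : LipschitzWith (Real.toNNReal ε⁻¹) fun x : Fin d → ℝ => (‖x‖ - 1) / ε := by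
      refine LipschitzWith.of_dist_le_mul fun x y => ?_
      rw [Real.dist_eq, Real.coe_toNNReal _ (by positivity), ← sub_div, sub_sub_sub_cancel_right,
        abs_div, abs_of_pos hε, div_eq_inv_mul]
      refine mul_le_mul_of_nonneg_left ?_ (by positivity)
      rw [dist_eq_norm]
      exact abs_norm_sub_norm_le x y
    exact (h1.const_max 0).const_min 1
  · rw [abs_of_nonneg (le_min zero_le_one (le_max_left _ _))]
    exact min_le_left _ _
  · have : (‖x‖ - 1) / ε ≤ 0 := div_nonpos_of_nonpos_of_nonneg (by linarith) hε.le
    rw [max_eq_left this]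
    simp

/-- The ramp lies between the indicators of ‖x‖ ≥ 1 + ε and ‖x‖ > 1. The levels ‖x‖ > 1 and |x|_α >
1 coincide, while |x|_α > lam forces ‖x‖ > 1 + ε. -/
theorem normRamp_bounds (h : DiagonalAffine P X A B α) {ε lam : ℝ} (hε : 0 < ε)
    (hlam : ∀ j, (1 + ε) ^ α j ≤ lam) (hlam0 : 0 < lam) (t : ℝ) :
    Real.exp t * P.real {ω | lam * Real.exp t < alphaNorm α (X ω)} ≤
      scaledMean P X α (fun x => min 1 (max 0 ((‖x‖ - 1) / ε))) t ∧
    scaledMean P X α (fun x => min 1 (max 0 ((‖x‖ - 1) / ε))) t ≤ normTail P X α t := by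
  have hi := integrable_test (P := P) (α := α) (tailTest_normRamp (d := d) hε) h.measX
    (Real.exp (-t))
  have hm := h.measurableSet_lt_alphaNorm
  constructor
  · refine mul_le_mul_of_nonneg_left ?_ (Real.exp_pos t).le
    rw [← integral_indicator_one (hm _)]
    refine integral_mono ((integrable_const (1 : ℝ)).indicator (hm _)) hi fun ω => ?_
    by_cases hω : ω ∈ {ω | lam * Real.exp t < alphaNorm α (X ω)}
    · rw [Set.indicator_of_mem hω]
      obtain ⟨j, hj⟩ := (lt_alphaNorm_iff (by positivity) _).1 hω
      have h1 : 1 + ε < |dilation α (Real.exp (-t)) (X ω) j| := by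
        rw [lt_abs_dilation_iff (h.pos j) (by positivity)]
        exact (mul_le_mul_of_nonneg_right (hlam j) (Real.exp_pos t).le).trans_lt hj
      have h2 := norm_le_pi_norm (dilation α (Real.exp (-t)) (X ω)) j
      rw [Real.norm_eq_abs] at h2
      refine le_min le_rfl (le_max_of_le_right ?_)
      rw [Pi.one_apply, le_div_iff₀ hε]
      linarith
    · rw [Set.indicator_of_notMem hω]
      exact le_min zero_le_one (le_max_left _ _)
  · refine mul_le_mul_of_nonneg_left ?_ (Real.exp_pos t).le
    rw [← integral_indicator_one (hm _)]
    refine integral_mono hi ((integrable_const (1 : ℝ)).indicator (hm _)) fun ω => ?_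
    by_cases hω : ω ∈ {ω | Real.exp t < alphaNorm α (X ω)}
    · rw [Set.indicator_of_mem hω]; exact min_le_left _ _
    · rw [Set.indicator_of_notMem hω]
      have h1 : ‖dilation α (Real.exp (-t)) (X ω)‖ ≤ 1 := by
        by_contra! hc
        obtain ⟨j, hj⟩ := exists_lt_abs_of_lt_norm zero_le_one hc
        rw [lt_abs_dilation_iff (h.pos j) zero_le_one, Real.one_rpow, one_mul] at hj
        exact hω ((lt_alphaNorm_iff (Real.exp_pos t).le _).2 ⟨j, hj⟩)
      have h2 : (‖dilation α (Real.exp (-t)) (X ω)‖ - 1) / ε ≤ 0 :=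
        div_nonpos_of_nonpos_of_nonneg (by linarith) hε.le
      simp only
      rw [max_eq_left h2]
      simp

/-- The limit `c_∞` exists. -/
theorem tendsto_normTail (h : DiagonalAffine P X A B α) :
    ∃ c, Tendsto (normTail P X α) atTop (𝓝 c) := by
  obtain ⟨K, hK0, hK⟩ := h.normTail_le
  refine exists_tendsto_of_approx fun e he => ?_
  -- A common upper bound for the exponents, so that (1 + ε)^a dominates every (1 + ε)^{α_j}.
  set a := ∑ j, α j with ha
  have haj : ∀ j, α j ≤ a := fun j =>
    Finset.single_le_sum (f := α) (fun j _ => (h.pos j).le) (Finset.mem_univ j)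
  have ha0 : 0 ≤ a := Finset.sum_nonneg fun j _ => (h.pos j).le
  obtain ⟨ε, hε, hε2, hεK⟩ : ∃ ε : ℝ, 0 < ε ∧ (1 + ε) ^ a ≤ 2 ∧ ((1 + ε) ^ a - 1) * K ≤ e / 2 := by
    have h1 : Tendsto (fun ε : ℝ => (1 + ε) ^ a) (𝓝[>] 0) (𝓝 ((1 + 0) ^ a)) :=
      (Tendsto.rpow_const (tendsto_const_nhds.add tendsto_id) (Or.inl (by simp))).mono_left
        nhdsWithin_le_nhds
    rw [add_zero, Real.one_rpow] at h1
    have h2 := (h1.sub_const 1).mul_const K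
    rw [sub_self, zero_mul] at h2
    obtain ⟨ε, ⟨h3, h4⟩, h5⟩ := ((h1.eventually (ge_mem_nhds one_lt_two)).and
      (h2.eventually (ge_mem_nhds (show 0 < e / 2 by positivity)))).and self_mem_nhdsWithin |>.exists
    exact ⟨ε, h5, h3, h4⟩
  set lam := (1 + ε) ^ a with hlam
  have hlam1 : 1 ≤ lam := Real.one_le_rpow (by linarith) ha0
  have hlam0 : 0 < lam := by linarith
  have hb := h.normRamp_bounds hε (fun j => Real.rpow_le_rpow_of_exponent_le (by linarith) (haj j))
    hlam0
  obtain ⟨l, hl⟩ := h.tendsto_scaledMean (tailTest_normRamp (d := d) hε)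
  have hlK : l ≤ K := le_of_tendsto' hl fun t => (hb t).2.trans (hK t)
  -- The ramp at t bounds the tail from below; at t - log lam it bounds it from above, up to the
  -- factor lam, which is near 1.
  have hl' := hl.comp (tendsto_atTop_add_const_right atTop (-Real.log lam) tendsto_id)
  refine ⟨l, ?_⟩
  filter_upwards [Metric.tendsto_nhds.1 hl (e / 4) (by positivity),
    Metric.tendsto_nhds.1 hl' (e / 4) (by positivity)] with t h1 h2
  simp only [Function.comp, id] at h2
  rw [Real.dist_eq, abs_lt] at h1 h2
  have h3 := (hb t).2
  have h4 := (hb (t + -Real.log lam)).1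
  rw [exp_mul_tail _ hlam0, neg_add_cancel_right, inv_mul_le_iff₀ hlam0] at h4
  have h5 : lam * scaledMean P X α (fun x => min 1 (max 0 ((‖x‖ - 1) / ε))) (t + -Real.log lam) ≤
      lam * (l + e / 4) := mul_le_mul_of_nonneg_left (by linarith [h2.2]) hlam0.le
  have h6 : (lam - 1) * l ≤ (lam - 1) * K := mul_le_mul_of_nonneg_left hlK (by linarith)
  have h7 : lam * (e / 4) ≤ 2 * (e / 4) := mul_le_mul_of_nonneg_right hε2 (by positivity)
  rw [abs_le]
  constructor
  · linarith [h1.1]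
  · nlinarith

end DiagonalAffine

/-! ### Convergence of the angular measures -/

section
variable {d : ℕ} {α : Fin d → ℝ}

theorem alphaNorm_le_one_of_norm_le_one (hα : ∀ j, 0 < α j) {x : Fin d → ℝ} (hx : ‖x‖ ≤ 1) :
    alphaNorm α x ≤ 1 := by
  by_contra! hc
  obtain ⟨j, hj⟩ := (lt_alphaNorm_iff zero_le_one x).1 hc
  have h1 : |x j| ≤ 1 := (norm_le_pi_norm x j).trans hx
  exact absurd (Real.rpow_le_one (abs_nonneg _) h1 (hα j).le) (not_le.2 hj)

theorem exists_lt_alphaNorm_of_lt_norm (hα : ∀ j, 0 < α j) {M : ℝ} (hM : 0 ≤ M) :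
    ∃ R, ∀ x : Fin d → ℝ, R < ‖x‖ → M < alphaNorm α x := by
  refine ⟨∑ j, M ^ (1 / α j), fun x hx => ?_⟩
  have h0 : ∀ j, 0 ≤ M ^ (1 / α j) := fun j => Real.rpow_nonneg hM _
  obtain ⟨j, hj⟩ := exists_lt_abs_of_lt_norm (Finset.sum_nonneg fun j _ => h0 j) hx
  refine (lt_alphaNorm_iff hM x).2 ⟨j, ?_⟩
  have h1 : M ^ (1 / α j) < |x j| :=
    (Finset.single_le_sum (f := fun j => M ^ (1 / α j)) (fun j _ => h0 j)
      (Finset.mem_univ j)).trans_lt hj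
  have h2 := Real.rpow_lt_rpow (h0 j) h1 (hα j)
  rwa [← Real.rpow_mul hM, one_div_mul_cancel (hα j).ne', Real.rpow_one] at h2

end

namespace DiagonalAffine

variable {Ω : Type*} [MeasurableSpace Ω] {P : Measure Ω} {d : ℕ} {X A B : Ω → Fin d → ℝ}
  {α : Fin d → ℝ}

/-- The scaled angular integral over the tail event of `|X|_α`, on the logarithmic scale. -/
noncomputable def angularTail (P : Measure Ω) (X : Ω → Fin d → ℝ) (α : Fin d → ℝ)
    (H : (Fin d → ℝ) → ℝ) (t : ℝ) : ℝ :=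
  Real.exp t * ∫ ω in {ω | Real.exp t < alphaNorm α (X ω)}, H (angle α (X ω)) ∂P

/-- On the conditioning event |X|_α > 0, so the angle lies on the sphere and pulling back to the
subtype loses no mass. -/
theorem integral_angularMeasure (h : DiagonalAffine P X A B α) {H : (Fin d → ℝ) → ℝ}
    (hH : Continuous H) {t : ℝ} (ht : 0 ≤ t) :
    ∫ x, H x ∂(angularMeasure P α X t) = (P.real {ω | t < alphaNorm α (X ω)})⁻¹ *
      ∫ ω in {ω | t < alphaNorm α (X ω)}, H (angle α (X ω)) ∂P := by
  have hS : MeasurableSet (alphaSphere α) := (isCompact_alphaSphere h.pos).isClosed.measurableSet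
  have hm := h.measurableSet_lt_alphaNorm t
  have ha : Measurable fun ω => angle α (X ω) := (measurable_angle h.pos).comp h.measX
  change ∫ x : alphaSphere α, H x ∂(Measure.comap Subtype.val
    (Measure.map (fun ω => angle α (X ω)) (cond P {ω | t < alphaNorm α (X ω)}))) = _
  have hae : ∀ᵐ x ∂(Measure.map (fun ω => angle α (X ω)) (cond P {ω | t < alphaNorm α (X ω)})),
      x ∈ alphaSphere α := by
    refine (ae_map_iff ha.aemeasurable hS).2 (ae_cond_of_forall_mem hm fun ω hω => ?_)
    exact angle_mem h.pos (ht.trans_lt hω)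
  rw [integral_subtype_comap hS, Measure.restrict_eq_self_of_ae_mem hae,
    integral_map ha.aemeasurable hH.aestronglyMeasurable, ProbabilityTheory.cond,
    integral_smul_measure, ENNReal.toReal_inv, smul_eq_mul]
  rfl

variable [IsProbabilityMeasure P]

/-- With y = e^{-t}|X|_α, the cutoff differs from the indicator of y > 1 only on 1 < y ≤ 1 + ε and
on y > M. The bound is F times the scaled mass of these two regions. -/
theorem abs_angularTail_sub_le (h : DiagonalAffine P X A B α) {H : (Fin d → ℝ) → ℝ}
    (hH : Continuous H) {F : ℝ} (hF : ∀ x, |H x| ≤ F) {ε M : ℝ} (hε : 0 < ε) (hM : 1 + ε ≤ M)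
    (t : ℝ) :
    |angularTail P X α H t - scaledMean P X α (angularTest α H ε M) t| ≤
      F * (normTail P X α t - (1 + ε)⁻¹ * normTail P X α (t + Real.log (1 + ε)) +
        M⁻¹ * normTail P X α (t + Real.log M)) := by
  have hF0 : 0 ≤ F := (abs_nonneg _).trans (hF 0)
  have hm := h.measurableSet_lt_alphaNorm
  have he := Real.exp_pos t
  have hi : ∀ c, Integrable ({ω | c < alphaNorm α (X ω)}.indicator (1 : Ω → ℝ)) P := fun c =>
    (integrable_const (1 : ℝ)).indicator (hm c)
  have hi₂ : ∀ a b, Integrable (fun ω => {ω | a < alphaNorm α (X ω)}.indicator (1 : Ω → ℝ) ω -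
      {ω | b < alphaNorm α (X ω)}.indicator (1 : Ω → ℝ) ω) P := fun a b => (hi a).sub (hi b)
  have hHi : Integrable (fun ω => H (angle α (X ω))) P :=
    Integrable.of_bound (hH.measurable.comp
      ((measurable_angle h.pos).comp h.measX)).aestronglyMeasurable F (ae_of_all _ fun ω => hF _)
  have hfi : Integrable (fun ω => angularTest α H ε M (dilation α (Real.exp (-t)) (X ω))) P := by
    refine Integrable.of_bound (((continuous_angularTest h.pos hH hε M).comp
      (continuous_dilation α _)).measurable.comp h.measX).aestronglyMeasurable F
      (ae_of_all _ fun ω => ?_)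
    rw [Real.norm_eq_abs, angularTest, abs_mul, abs_of_nonneg (annulusCutoff_nonneg _ _ _)]
    exact (mul_le_of_le_one_right (abs_nonneg _) (annulusCutoff_le_one _ _ _)).trans (hF _)
  rw [← exp_mul_tail t (by linarith), ← exp_mul_tail t (by linarith : 0 < M), normTail,
    angularTail, scaledMean, ← mul_sub, abs_mul, abs_of_pos he, ← mul_sub, ← mul_add,
    mul_left_comm]
  refine mul_le_mul_of_nonneg_left ?_ he.le
  rw [← integral_indicator (hm _), ← integral_sub (hHi.indicator (hm _)) hfi,
    ← integral_indicator_one (hm _), ← integral_indicator_one (hm _),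
    ← integral_indicator_one (hm _), ← integral_sub (hi _) (hi _),
    ← integral_add (hi₂ _ _) (hi _), ← integral_const_mul, ← Real.norm_eq_abs]
  refine norm_integral_le_of_norm_le (((hi₂ _ _).add (hi _)).const_mul _)
    (ae_of_all _ fun ω => ?_)
  have hr : alphaNorm α (dilation α (Real.exp (-t)) (X ω)) =
      Real.exp (-t) * alphaNorm α (X ω) := alphaNorm_dilation h.pos (Real.exp_pos _).le _
  set y := Real.exp (-t) * alphaNorm α (X ω) with hy
  have hiff : ∀ c, c * Real.exp t < alphaNorm α (X ω) ↔ c < y := fun c => by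
    rw [hy, Real.exp_neg, ← div_eq_inv_mul, lt_div_iff₀ he]
  have hiff1 : Real.exp t < alphaNorm α (X ω) ↔ 1 < y := by rw [← hiff, one_mul]
  simp only [Set.indicator_apply, Set.mem_ofPred_eq, Pi.one_apply, hiff, hiff1]
  rw [angularTest, angle_dilation h.pos (Real.exp_pos _), hr, Real.norm_eq_abs]
  have hc0 := annulusCutoff_nonneg ε M y
  have hc1 := annulusCutoff_le_one ε M y
  have hmul : |H (angle α (X ω)) - H (angle α (X ω)) * annulusCutoff ε M y| ≤ F := by
    rw [← mul_one_sub, abs_mul, abs_of_nonneg (by linarith : 0 ≤ 1 - annulusCutoff ε M y)]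
    exact (mul_le_of_le_one_right (abs_nonneg _) (by linarith)).trans (hF _)
  rcases le_or_gt y 1 with h1 | h1
  · rw [annulusCutoff_of_le hε h1, if_neg (by linarith), if_neg (by linarith),
      if_neg (by linarith), if_neg (by linarith)]
    simp
  rw [if_pos h1, if_pos h1]
  rcases le_or_gt y (1 + ε) with h2 | h2
  · rw [if_neg (by linarith), if_neg (by linarith)]
    linarith
  rw [if_pos h2]
  rcases le_or_gt y M with h3 | h3
  · rw [annulusCutoff_eq_one hε h2.le h3, if_neg (by linarith)]
    simp
  · rw [if_pos h3]
    linarith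

theorem tendsto_angularTail (h : DiagonalAffine P X A B α) {H : (Fin d → ℝ) → ℝ}
    (hH : Continuous H) {F : ℝ} (hF : ∀ x, |H x| ≤ F) :
    ∃ l, Tendsto (angularTail P X α H) atTop (𝓝 l) := by
  have hF0 : 0 ≤ F := (abs_nonneg _).trans (hF 0)
  obtain ⟨c, hc⟩ := h.tendsto_normTail
  have hc0 : 0 ≤ c := ge_of_tendsto' hc fun t => mul_nonneg (Real.exp_pos t).le measureReal_nonneg
  refine exists_tendsto_of_approx fun e he => ?_
  -- The limiting error is Fc(1 - (1 + ε)⁻¹ + M⁻¹) ≤ 2Fcε ≤ e/4; M contains ε⁻¹ so that M⁻¹ ≤ ε.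
  set ε := e / (8 * (F * c + 1)) with hεdef
  have hε : 0 < ε := by positivity
  have hFcε : F * c * ε ≤ e / 8 := by
    have : ε * (F * c + 1) = e / 8 := by rw [hεdef]; field_simp
    nlinarith
  set M := 1 + ε + ε⁻¹ with hMdef
  have hM : 1 + ε ≤ M := by have := inv_pos.2 hε; linarith
  have hM0 : 0 < M := by linarith
  have hMinv : M⁻¹ ≤ ε := inv_le_of_inv_le₀ hε (by linarith)
  have hεinv : 1 - (1 + ε)⁻¹ ≤ ε := by
    have : (1 + ε) * (1 + ε)⁻¹ = 1 := mul_inv_cancel₀ (by linarith)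
    have h1 : (1 + ε)⁻¹ ≤ 1 := inv_le_one_of_one_le₀ (by linarith)
    nlinarith
  obtain ⟨R, hR⟩ := exists_lt_alphaNorm_of_lt_norm h.pos (by linarith : 0 ≤ M + 1)
  obtain ⟨l, hl⟩ := h.tendsto_scaledMean_of_compactSupport (F := F)
    (continuous_angularTest h.pos hH hε M) one_pos
    (fun x hx => by
      rw [angularTest, annulusCutoff_of_le hε (alphaNorm_le_one_of_norm_le_one h.pos hx), mul_zero])
    (fun x hx => by rw [angularTest, annulusCutoff_of_ge (hR x hx).le, mul_zero])
    (fun x => by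
      rw [angularTest, abs_mul, abs_of_nonneg (annulusCutoff_nonneg _ _ _)]
      exact (mul_le_of_le_one_right (abs_nonneg _) (annulusCutoff_le_one _ _ _)).trans (hF _))
  have hshift : ∀ a, Tendsto (fun t => normTail P X α (t + a)) atTop (𝓝 c) := fun a =>
    hc.comp (tendsto_atTop_add_const_right atTop a tendsto_id)
  have hB := ((hc.sub ((hshift (Real.log (1 + ε))).const_mul (1 + ε)⁻¹)).add
    ((hshift (Real.log M)).const_mul M⁻¹)).const_mul F
  have hlim : F * (c - (1 + ε)⁻¹ * c + M⁻¹ * c) < e / 2 := by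
    have h1 := mul_le_mul_of_nonneg_left (add_le_add hεinv hMinv) (mul_nonneg hF0 hc0)
    nlinarith
  refine ⟨l, ?_⟩
  filter_upwards [hB.eventually_lt_const hlim, Metric.tendsto_nhds.1 hl (e / 2) (by positivity)]
    with t h1 h2
  have h3 := h.abs_angularTail_sub_le hH hF hε hM t
  rw [Real.dist_eq, abs_lt] at h2
  rw [abs_le] at h3 ⊢
  constructor <;> linarith [h3.1, h3.2, h2.1, h2.2]

theorem isProbabilityMeasure_angularMeasure (h : DiagonalAffine P X A B α) {t : ℝ} (ht : 0 ≤ t)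
    (hP : P.real {ω | t < alphaNorm α (X ω)} ≠ 0) :
    IsProbabilityMeasure (angularMeasure P α X t) := by
  have h1 := h.integral_angularMeasure (H := fun _ => 1) continuous_const ht
  simp only [integral_const, smul_eq_mul, mul_one, measureReal_restrict_apply_univ,
    inv_mul_cancel₀ hP] at h1
  exact ⟨by rw [← ENNReal.ofReal_one, ← h1, ofReal_measureReal]⟩

theorem tendsto_integral_angularMeasure (h : DiagonalAffine P X A B α) {c : ℝ} (hc : 0 < c)
    (hlim : Tendsto (normTail P X α) atTop (𝓝 c))
    (g : BoundedContinuousFunction (alphaSphere α) ℝ) :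
    ∃ l, Tendsto (fun t => ∫ x, g x ∂(angularMeasure P α X t)) atTop (𝓝 l) := by
  -- Tietze extension from the closed sphere. The integral against m_t is the ratio of the angular
  -- tail to the norm tail, and c > 0 permits division in the limit.
  obtain ⟨H, -, hHg⟩ := g.exists_extension_norm_eq_of_isClosedEmbedding
    (isCompact_alphaSphere h.pos).isClosed.isClosedEmbedding_subtypeVal
  obtain ⟨l, hl⟩ := h.tendsto_angularTail H.continuous (F := ‖H‖) fun x => H.norm_coe_le_norm x
  refine ⟨l / c, ((hl.div hlim hc.ne').comp Real.tendsto_log_atTop).congr' ?_⟩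
  filter_upwards [eventually_gt_atTop 0] with t ht
  have h1 : ∀ x : alphaSphere α, g x = H x := fun x => (congrFun hHg x).symm
  simp only [h1, Function.comp, Pi.div_apply, angularTail, normTail, Real.exp_log ht]
  rw [h.integral_angularMeasure H.continuous ht.le, mul_div_mul_left _ _ ht.ne', div_eq_inv_mul]

/-- Weak convergence of the angular measures. -/
theorem exists_tendsto_angularFiniteMeasure (h : DiagonalAffine P X A B α) {c : ℝ} (hc : 0 < c)
    (hlim : Tendsto (normTail P X α) atTop (𝓝 c)) :
    ∃ ν : ProbabilityMeasure (alphaSphere α),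
      Tendsto (fun t : ℝ => angularFiniteMeasure P α X t) atTop (𝓝 ν.toFiniteMeasure) := by
  have : CompactSpace (alphaSphere α) := isCompact_iff_compactSpace.1 (isCompact_alphaSphere h.pos)
  have hev : ∀ᶠ t in atTop, IsProbabilityMeasure (angularMeasure P α X t) := by
    filter_upwards [eventually_gt_atTop 0, (hlim.comp Real.tendsto_log_atTop).eventually_const_lt hc]
      with t ht hpos
    refine h.isProbabilityMeasure_angularMeasure ht.le fun h0 => ?_
    simp [normTail, Real.exp_log ht, h0] at hpos
  obtain ⟨t₀, ht₀⟩ := eventually_atTop.1 hev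
  -- Replacing t by max(t, t₀) makes every member of the family a probability measure without
  -- affecting the limit.
  let m : ℝ → ProbabilityMeasure (alphaSphere α) := fun t =>
    ⟨angularMeasure P α X (max t t₀), ht₀ _ (le_max_right _ _)⟩
  -- Probability measures on a compact space have a cluster point. All integrals already converge,
  -- so a finer ultrafilter identifies their limits as integrals against ν.
  obtain ⟨ν, hν⟩ := exists_clusterPt_of_compactSpace (map m atTop)
  obtain ⟨U, hU, hUν⟩ := mapClusterPt_iff_ultrafilter.1 hν
  refine ⟨ν, FiniteMeasure.tendsto_iff_forall_integral_tendsto.2 fun g => ?_⟩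
  obtain ⟨l, hl⟩ := h.tendsto_integral_angularMeasure hc hlim g
  have h1 := ProbabilityMeasure.tendsto_iff_forall_integral_tendsto.1 hUν g
  have h2 : Tendsto (fun t => ∫ x, g x ∂(m t : Measure (alphaSphere α))) U (𝓝 l) :=
    (hl.comp (tendsto_atTop_mono (fun t => le_max_left t t₀) tendsto_id)).mono_left hU
  rw [tendsto_nhds_unique h2 h1] at hl
  exact hl

end DiagonalAffine

/-! ### The assumptions in terms of the coefficients -/

section
variable {Ω : Type*} [MeasurableSpace Ω] {P : Measure Ω}

/-- Taking the power p multiplies the logarithm by p, so a span h for the power is a span h/p for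
|a|. -/
theorem not_ae_log_rpow_of_nonArithmetic {a : Ω → ℝ} (ha : Measurable a) {p : ℝ} (hp : 0 < p)
    (hna : NonArithmetic (Measure.map (fun ω => Real.log |a ω|) (cond P {ω | a ω ≠ 0}))) :
    ¬ ∃ h : ℝ, 0 < h ∧ ∀ᵐ ω ∂P, a ω ≠ 0 → ∃ n : ℤ, Real.log (|a ω| ^ p) = n * h := by
  rintro ⟨h, hh, hae⟩
  refine hna ⟨h / p, by positivity, ?_⟩
  have hm : MeasurableSet {x : ℝ | ∃ n : ℤ, x = n * (h / p)} := by
    have : {x : ℝ | ∃ n : ℤ, x = n * (h / p)} = Set.range fun n : ℤ => (n : ℝ) * (h / p) := by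
      ext x
      exact exists_congr fun n => eq_comm
    rw [this]
    exact (Set.countable_range _).measurableSet
  have h0 : MeasurableSet {ω | a ω ≠ 0} := (ha (measurableSet_singleton 0)).compl
  refine (ae_map_iff (Real.measurable_log.comp
    (continuous_abs.measurable.comp ha)).aemeasurable hm).2 ?_
  refine Measure.ae_smul_measure ((ae_restrict_iff' h0).2 ?_) _
  filter_upwards [hae] with ω hω hne
  obtain ⟨n, hn⟩ := hω hne
  rw [Real.log_rpow (abs_pos.2 hne)] at hn
  refine ⟨n, ?_⟩
  rw [← mul_div_assoc, eq_div_iff hp.ne']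
  exact (mul_comm _ _).trans hn

variable [IsProbabilityMeasure P]

/-- The negative part costs nothing: u log u ≥ u - 1 ≥ -1. The positive part is at most p times the
assumed integrable function. -/
theorem integrable_rpow_mul_log {a : Ω → ℝ} (ha : Measurable a) {p : ℝ} (hp : 0 < p)
    (hi : Integrable (fun ω => |a ω| ^ p * Real.posLog |a ω|) P) :
    Integrable (fun ω => |a ω| ^ p * Real.log (|a ω| ^ p)) P := by
  have hm : Measurable fun ω => |a ω| ^ p := (continuous_abs.measurable.comp ha).pow_const _
  refine Integrable.mono' ((hi.const_mul p).add (integrable_const 1))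
    (hm.mul (Real.measurable_log.comp hm)).aestronglyMeasurable (ae_of_all _ fun ω => ?_)
  have h0 := abs_nonneg (a ω)
  have hu : 0 ≤ |a ω| ^ p := Real.rpow_nonneg h0 p
  have hpl : 0 ≤ |a ω| ^ p * Real.posLog |a ω| := mul_nonneg hu Real.posLog_nonneg
  rw [Real.norm_eq_abs, abs_le]
  simp only [Pi.add_apply]
  constructor
  · rcases hu.eq_or_lt with h | h
    · rw [← h]; simp
    · have h1 := Real.one_sub_inv_le_log_of_pos h
      have h2 := mul_le_mul_of_nonneg_left h1 hu
      rw [mul_sub, mul_inv_cancel₀ h.ne'] at h2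
      nlinarith
  · rcases h0.eq_or_lt with h | h
    · rw [← h, Real.zero_rpow hp.ne']; simp
    · rw [Real.log_rpow h, mul_left_comm]
      have : Real.log |a ω| ≤ Real.posLog |a ω| := le_max_right _ _
      have := mul_le_mul_of_nonneg_left (mul_le_mul_of_nonneg_left this hu) hp.le
      linarith

/-- Markov's inequality for |b|^{p+σ} = (|b|^p)^{1+σ/p}. -/
theorem measureReal_lt_rpow_le {b : Ω → ℝ} {p σ : ℝ} (hp : 0 < p) (hσ : 0 < σ)
    (hi : Integrable (fun ω => |b ω| ^ (p + σ)) P) {s : ℝ} (hs : 0 < s) :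
    P.real {ω | s < |b ω| ^ p} ≤ (∫ ω, |b ω| ^ (p + σ) ∂P) * s ^ (-(1 + σ / p)) := by
  have h1 := mul_meas_ge_le_integral_of_nonneg
    (ae_of_all P fun ω => Real.rpow_nonneg (abs_nonneg (b ω)) (p + σ)) hi (s ^ (1 + σ / p))
  have hsub : {ω | s < |b ω| ^ p} ⊆ {ω | s ^ (1 + σ / p) ≤ |b ω| ^ (p + σ)} := fun ω hω => by
    have h2 : |b ω| ^ (p + σ) = (|b ω| ^ p) ^ (1 + σ / p) := by
      rw [← Real.rpow_mul (abs_nonneg _)]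
      congr 1
      field_simp
    rw [Set.mem_ofPred_eq, h2]
    exact Real.rpow_le_rpow hs.le (le_of_lt hω) (by positivity)
  have h3 : 0 < s ^ (1 + σ / p) := Real.rpow_pos_of_pos hs _
  rw [Real.rpow_neg hs.le, ← div_eq_mul_inv, le_div_iff₀ h3, mul_comm]
  exact (mul_le_mul_of_nonneg_left (measureReal_mono hsub) h3.le).trans h1

end

theorem mainTheorem2 {Ω : Type*} [MeasurableSpace Ω] (P : Measure Ω) [IsProbabilityMeasure P]
    {d : ℕ} (X A B : Ω → Fin d → ℝ) (hX : Measurable X) (hA : Measurable A) (hB : Measurable B)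
    (hAX : IndepFun A X P)
    (heq : IdentDistrib X (fun ω => (Matrix.diagonal (A ω)).mulVec (X ω) + B ω) P P)
    (α : Fin d → ℝ) (hα : ∀ j, 0 < α j)
    (hA0 : ∀ j, NonArithmetic
      (Measure.map (fun ω => Real.log |A ω j|) (cond P {ω | A ω j ≠ 0})))
    (hA1 : ∀ j, ∫ ω, |A ω j| ^ α j ∂P = 1)
    (hA2 : ∀ j, Integrable (fun ω => |A ω j| ^ α j * Real.posLog |A ω j|) P ∧
      ∃ σ : ℝ, 0 < σ ∧ Integrable (fun ω => |B ω j| ^ (α j + σ)) P) :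
    ∃ c : ℝ,
      Tendsto (fun t : ℝ => t * P.real {ω | t < alphaNorm α (X ω)}) atTop (𝓝 c) ∧
      (0 < c → ∃ ν : ProbabilityMeasure (alphaSphere α),
        Tendsto (fun t : ℝ => angularFiniteMeasure P α X t) atTop (𝓝 ν.toFiniteMeasure)) := by
  have h : DiagonalAffine P X A B α :=
    { measX := hX
      measA := hA
      measB := hB
      indep := hAX
      law := by
        convert heq using 1
        ext ω j
        simp [Matrix.mulVec_diagonal]
      pos := hα
      nonarith := fun j =>
        not_ae_log_rpow_of_nonArithmetic ((measurable_pi_apply j).comp hA) (hα j) (hA0 j)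
      moment := hA1
      logMoment := fun j =>
        integrable_rpow_mul_log ((measurable_pi_apply j).comp hA) (hα j) (hA2 j).1
      tailB := fun j => by
        obtain ⟨σ, hσ, hi⟩ := (hA2 j).2
        exact ⟨σ / α j, div_pos hσ (hα j), _,
          integral_nonneg fun ω => Real.rpow_nonneg (abs_nonneg _) _,
          fun s hs => measureReal_lt_rpow_le (hα j) hσ hi hs⟩ }
  obtain ⟨c, hc⟩ := h.tendsto_normTail
  refine ⟨c, (hc.comp Real.tendsto_log_atTop).congr' ?_,
    fun hpos => h.exists_tendsto_angularFiniteMeasure hpos hc⟩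
  filter_upwards [eventually_gt_atTop 0] with t ht
  simp only [Function.comp, DiagonalAffine.normTail, Real.exp_log ht]
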